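/- Let $\mathcal F=(\mathcal X_n,K_n,\pi_n)_{n\ge1}$ be a family of irreducible Markov chains on countable sets, with transition matrices $K_n$ and stationary distributions $\pi_n$, and let $\mathcal F_c$ be the family of continuous time chains with transition matrices $H_{n,t}=e^{-t(I-K_n)}$. Put $$d^{(c)}_{n,\mathrm{TV}}(t)=\sup_{x\in\mathcal X_n,\,A\subset\mathcal X_n}\{H_{n,t}(x,A)-\pi_n(A)\},\qquad d^{(c)}_{n,H}(t)=\sup_{x\in\mathcal X_n}\Big(\tfrac12\sum_{y}\big(\sqrt{H_{n,t}(x,y)}-\sqrt{\pi_n(y)}\big)^2\Big)^{1/2}.$$ $\mathcal F_c$ has a cutoff in total variation (resp. in the Hellinger distance) if there are $t_n>0$ such that, for $d_n=d^{(c)}_{n,\mathrm{TV}}$ (resp. $d_n=d^{(c)}_{n,H}$), $d_n(at_n)\to0$ for all $a>1$ and $d_n(at_n)\to1$ for all $a\in(0,1)$. For a sequence $\mathcal P=(p_n)_{n\ge1}$ of positive reals with $q_n=p_1+\dots+p_n$, let $\mathcal F^{\mathcal P}$ be the family whose $n$-th chain is the product of the first $n$ chains of $\mathcal F$: its state space is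 $\mathcal X_1\times\dots\times\mathcal X_n$, its stationary distribution $\pi_1\times\dots\times\pi_n$ and its transition matrix $\sum_{i=1}^n\frac{p_i}{q_n}\,I_1\otimes\dots\otimes I_{i-1}\otimes K_i\otimes I_{i+1}\otimes\dots\otimes I_n$. Let $\mathcal F^{\mathcal P}_c$ be the associated continuous time family. **Theorem.** Neither of the statements "$\mathcal F_c$ has a cutoff" and "$\mathcal F_c^{\mathcal P}$ has a cutoff" implies the other, in total variation as well as in the Hellinger distance. Explicitly: (1) For $n\ge1$ let $\mathcal F$ have as its $(2n-1)$-th chain the Ehrenfest chain on $\{0,\dots,n\}$, with $K(j,j+1)=\frac{n-j}n$, $K(j+1,j)=\frac{j+1}n$ for $0\le j<n$ and $\pi(j)=2^{-n}\binom nj$, and as its $2n$-th chain the walk on $\{0,\dots,n\}$ with $K(j,j+1)=K(j+1,j)=K(0,0)=K(n,n)=\frac12$ for $0\le j<n$ and $\pi(j)=\frac1{n+1}$. Let $r\in(0,1)$, $p_{2n-1}=r^{n-1}$ and $p_{2n}=1$. Then $\mathcal F_c$ has no cutoff and $\mathcal F_c^{\mathcal P}$ has a cutoff, in total variation and in the Hellinger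 distance. (2) For $n\ge1$ and $0<a<b$ with $a+b<\frac12$ let $L_n(a,b)$ be the chain on $\{0,\dots,2n\}$ with $K(j,j+1)=1-a$ for $j\notin\{n,2n\}$, $K(0,0)=a$, $K(j,j-1)=a$ for $1\le j\le 2n$, $K(n,n+1)=b$, $K(n,2n)=1-a-b$, $K(2n,n)=c$, $K(2n,2n)=1-a-c$, where $c=\frac{(1-a-b)a^n}{b(1-a)^{n-1}}$ is the value that makes $K$ reversible, and with its stationary distribution (for $n=1$, transitions between the same two states are added up). For $1\le i\le n$ let $p_{n,i}>0$, $0<a_{n,i}<b_{n,i}$, $a_{n,i}+b_{n,i}<\frac12$, and suppose that $$\max_{1\le i\le n}a_{n,i}=O(n^{-2}),\qquad \sum_{i=1}^na_{n,i}=o(1/n),\qquad \frac1{Cn}\le b_{n,i}\le\frac Cn\ \text{ for some } C>1,\qquad \frac{\max_{1\le i\le n} p_{n,i}}{\min_{1\le i\le n} p_{n,i}}\to1 .$$ Such arrays exist. Let $\alpha\ge1$, $q_n=\sum_{i=1}^np_{n,i}$, $\hat p_n=\min_{1\le i\le n} p_{n,i}$ and $r_n=(q_nn/\hat p_n)e^{-n^\alpha}$.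 List the pairs $(n,i)$, $1\le i\le n$, row by row, as $(1,1),(2,1),(2,2),(3,1),\dots$; let $\mathcal F$ be the corresponding sequence of chains $L_n(a_{n,i},b_{n,i})$ and $\mathcal U$ the corresponding sequence of weights $p_{n,i}r_n/q_n$. Then $\mathcal F_c$ has a cutoff and $\mathcal F_c^{\mathcal U}$ has no cutoff, in total variation and in the Hellinger distance. -/

import Mathlib

open Filter Topology

namespace ProductCutoff

noncomputable section

/-- The data `(𝒳, K, π)` of a Markov chain: state space, transition matrix, distribution. -/
structure Chain where
  /-- state space -/
  X : Type
  /-- transition matrix -/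
  K : X → X → ℝ
  /-- stationary distribution -/
  stat : X → ℝ

namespace Chain

open Classical in
/-- The entries `K^m(x,y)` of the powers of the transition matrix. -/
def pow (C : Chain) : ℕ → C.X → C.X → ℝ
  | 0 => fun x y => if x = y then 1 else 0
  | m + 1 => fun x y => ∑' z, C.K x z * pow C m z y

/-- `C` is an irreducible Markov chain on a countable set, with stationary distribution
`C.stat`. -/
structure IsIrreducibleMarkov (C : Chain) : Prop where
  countable : Countable C.X
  K_nonneg : ∀ x y, 0 ≤ C.K x y
  K_sum : ∀ x, HasSum (C.K x) 1
  irreducible : ∀ x y, ∃ m, 0 < C.pow m x y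
  stat_nonneg : ∀ x, 0 ≤ C.stat x
  stat_sum : HasSum C.stat 1
  stationary : ∀ y, HasSum (fun x => C.stat x * C.K x y) (C.stat y)

/-- The entries of `H_t = e^{-t(I-K)}`, the transition matrices of the associated continuous time
chain (the discrete time chain run at the jump times of a rate one Poisson process). -/
def H (C : Chain) (t : ℝ) (x y : C.X) : ℝ :=
  ∑' m : ℕ, Real.exp (-t) * t ^ m / (m.factorial : ℝ) * C.pow m x y

/-- Maximum total variation distance of the continuous time chain at time `t`. -/
def dTV (C : Chain) (t : ℝ) : ℝ :=
  ⨆ x : C.X, ⨆ A : Set C.X, ((∑' y : A, C.H t x y) - ∑' y : A, C.stat y)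

/-- Maximum Hellinger distance of the continuous time chain at time `t`. -/
def dH (C : Chain) (t : ℝ) : ℝ :=
  ⨆ x : C.X, Real.sqrt (1 / 2 * ∑' y, (Real.sqrt (C.H t x y) - Real.sqrt (C.stat y)) ^ 2)

end Chain

open Classical in
/-- The product of the chains `C 0, …, C (n-1)` according to the probability vector `w`, with
transition matrix `∑ i, w i • (I ⊗ ⋯ ⊗ I ⊗ K_i ⊗ I ⊗ ⋯ ⊗ I)`. -/
def prodChain {n : ℕ} (C : Fin n → Chain) (w : Fin n → ℝ) : Chain where
  X := ∀ i, (C i).X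
  K := fun x y => ∑ i, w i *
    ((C i).K (x i) (y i) * ∏ j ∈ Finset.univ.erase i, (if x j = y j then 1 else 0))
  stat := fun x => ∏ i, (C i).stat (x i)

/-- The family `ℱ^𝒫`. Families are indexed from `0`: the entry with index `n` of `ℱ^𝒫` is the
product of the entries `0, …, n` of `ℱ` according to `(p_0/q_n, …, p_n/q_n)`, where
`q_n = p_0 + ⋯ + p_n`. -/
def prodFamily (F : ℕ → Chain) (p : ℕ → ℝ) (n : ℕ) : Chain :=
  prodChain (fun i : Fin (n + 1) => F i)
    (fun i : Fin (n + 1) => p i / ∑ j ∈ Finset.range (n + 1), p j)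

/-- Cutoff, in continuous time, of a sequence of distances `d n t`. -/
def HasCutoff (d : ℕ → ℝ → ℝ) : Prop :=
  ∃ t : ℕ → ℝ, (∀ n, 0 < t n) ∧
    (∀ a : ℝ, 1 < a → Tendsto (fun n => d n (a * t n)) atTop (𝓝 0)) ∧
    (∀ a : ℝ, 0 < a → a < 1 → Tendsto (fun n => d n (a * t n)) atTop (𝓝 1))

/-- `ℱ_c` has a cutoff in the total variation. -/
def CutoffTV (F : ℕ → Chain) : Prop := HasCutoff fun n t => (F n).dTV t

/-- `ℱ_c` has a cutoff in the Hellinger distance. -/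
def CutoffH (F : ℕ → Chain) : Prop := HasCutoff fun n t => (F n).dH t

/-- The Ehrenfest chain on `{0, …, n}`. -/
def ehrenfest (n : ℕ) : Chain where
  X := Fin (n + 1)
  K := fun j k =>
    (if (k : ℕ) = j + 1 then ((n : ℝ) - (j : ℕ)) / n else 0)
      + (if (j : ℕ) = k + 1 then ((j : ℕ) : ℝ) / n else 0)
  stat := fun j => (n.choose j : ℝ) / 2 ^ n

/-- Simple random walk on the path `{0, …, n}` with holding probability `1/2` at both ends. -/
def lazyPath (n : ℕ) : Chain where
  X := Fin (n + 1)
  K := fun j k =>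
    (if (k : ℕ) = j + 1 then 1 / 2 else 0) + (if (j : ℕ) = k + 1 then 1 / 2 else 0)
      + (if (j : ℕ) = 0 ∧ (k : ℕ) = 0 then 1 / 2 else 0)
      + (if (j : ℕ) = n ∧ (k : ℕ) = n then 1 / 2 else 0)
  stat := fun _ => 1 / ((n : ℝ) + 1)

/-- Ehrenfest chains and paths alternating: Ehrenfest on `{0,1}`, path on `{0,1}`, Ehrenfest on
`{0,1,2}`, path on `{0,1,2}`, … -/
def mixedFamily (k : ℕ) : Chain :=
  if Even k then ehrenfest (k / 2 + 1) else lazyPath (k / 2 + 1)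

/-- The weights `1, 1, r, 1, r², 1, …`: the `n`-th Ehrenfest chain gets `r ^ (n-1)`, every path
gets `1`. -/
def mixedWeights (r : ℝ) (k : ℕ) : ℝ := if Even k then r ^ (k / 2) else 1

/-- The value of the transition probability from `2n` to `n` that makes the Lacoin chain
reversible, i.e. the solution `c` of `b c (1-a)^(n-1) = (1-a-b) a^n`. -/
def lacoinC (n : ℕ) (a b : ℝ) : ℝ := (1 - a - b) * a ^ n / (b * (1 - a) ^ (n - 1))

/-- Unnormalized reversible measure of the Lacoin chain. -/
def lacoinWeight (n : ℕ) (a b : ℝ) (j : ℕ) : ℝ :=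
  if j ≤ n then ((1 - a) / a) ^ j else (1 - a) ^ (j - 1) * b / a ^ j

/-- The Lacoin chain on `{0, …, 2n}`, `n ≥ 1`: steps to the right have probability `1-a` and steps
to the left (or the loop at `0`) probability `a`, except that from `n` the chain goes to `n+1` with
probability `b` and jumps to `2n` with probability `1-a-b`, and that from `2n` it jumps back to `n`
with probability `c` and stays with probability `1-a-c`. (If `n = 1`, parallel transitions are
added up.) -/
def lacoin (n : ℕ) (a b : ℝ) : Chain where
  X := Fin (2 * n + 1)
  K := fun j k =>
    (if (j : ℕ) ≠ n ∧ (j : ℕ) ≠ 2 * n ∧ (k : ℕ) = j + 1 then 1 - a else 0)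
      + (if (j : ℕ) = k + 1 then a else 0)
      + (if (j : ℕ) = 0 ∧ (k : ℕ) = 0 then a else 0)
      + (if (j : ℕ) = n ∧ (k : ℕ) = n + 1 then b else 0)
      + (if (j : ℕ) = n ∧ (k : ℕ) = 2 * n then 1 - a - b else 0)
      + (if (j : ℕ) = 2 * n ∧ (k : ℕ) = n then lacoinC n a b else 0)
      + (if (j : ℕ) = 2 * n ∧ (k : ℕ) = 2 * n then 1 - a - lacoinC n a b else 0)
  stat := fun j => lacoinWeight n a b j / ∑ i ∈ Finset.range (2 * n + 1), lacoinWeight n a b i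

/-- Smallest entry of row `n` of a triangular array `(p n i)`, `1 ≤ i ≤ n`. -/
def rowMin (p : ℕ → ℕ → ℝ) (n : ℕ) : ℝ := sInf (p n '' Set.Icc 1 n)

/-- Largest entry of row `n` of a triangular array `(p n i)`, `1 ≤ i ≤ n`. -/
def rowMax (p : ℕ → ℕ → ℝ) (n : ℕ) : ℝ := sSup (p n '' Set.Icc 1 n)

/-- Sum of row `n` of a triangular array `(p n i)`, `1 ≤ i ≤ n`. -/
def rowSum (p : ℕ → ℕ → ℝ) (n : ℕ) : ℝ := ∑ i ∈ Finset.Icc 1 n, p n i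

/-- Conditions on the triangular arrays `a`, `b`, `p` (entries `n, i` with `1 ≤ i ≤ n`). -/
structure LacoinArrays (a b p : ℕ → ℕ → ℝ) : Prop where
  p_pos : ∀ n i, 1 ≤ i → i ≤ n → 0 < p n i
  a_pos : ∀ n i, 1 ≤ i → i ≤ n → 0 < a n i
  a_lt_b : ∀ n i, 1 ≤ i → i ≤ n → a n i < b n i
  a_add_b : ∀ n i, 1 ≤ i → i ≤ n → a n i + b n i < 1 / 2
  a_bound : ∃ C : ℝ, ∀ n i, 1 ≤ i → i ≤ n → a n i ≤ C / (n : ℝ) ^ 2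
  a_sum : Tendsto (fun n : ℕ => (n : ℝ) * rowSum a n) atTop (𝓝 0)
  b_bound : ∃ C : ℝ, 1 < C ∧ ∀ n i, 1 ≤ i → i ≤ n →
    1 / (C * n) ≤ b n i ∧ b n i ≤ C / n
  p_ratio : Tendsto (fun n => rowMax p n / rowMin p n) atTop (𝓝 1)

/-- If `k = n(n+1)/2 + i` with `0 ≤ i ≤ n`, then `triRow k = n + 1`: the (1-based) row of position
`k` when a triangular array is listed row by row. -/
def triRow (k : ℕ) : ℕ := Nat.findGreatest (fun n => n * (n + 1) / 2 ≤ k) k + 1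

/-- If `k = n(n+1)/2 + i` with `0 ≤ i ≤ n`, then `triCol k = i + 1`. -/
def triCol (k : ℕ) : ℕ := k - (triRow k - 1) * triRow k / 2 + 1

/-- The Lacoin chains `(n, i)`, `1 ≤ i ≤ n`, listed row by row. -/
def lacoinFamily (a b : ℕ → ℕ → ℝ) (k : ℕ) : Chain :=
  lacoin (triRow k) (a (triRow k) (triCol k)) (b (triRow k) (triCol k))

/-- `r_n = (q_n n / p̂_n) exp(-n^α)`, where `q_n` and `p̂_n` are the sum and the minimum of row `n`
of `p`. -/
def lacoinR (p : ℕ → ℕ → ℝ) (α : ℝ) (n : ℕ) : ℝ :=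
  rowSum p n * n / rowMin p n * Real.exp (-(n : ℝ) ^ α)

/-- The weight `p_{n,i} r_n / q_n` of the chain `(n, i)`, listed row by row. -/
def lacoinWeights (p : ℕ → ℕ → ℝ) (α : ℝ) (k : ℕ) : ℝ :=
  p (triRow k) (triCol k) * lacoinR p α (triRow k) / rowSum p (triRow k)

end

end ProductCutoff

/-!
Both kinds of cutoff are equivalent to cutoff for the Hellinger affinity `∑ √(H_t(x, y) π(y))`,
minimised over `x`: it tends to one (zero) exactly when either distance tends to zero (one). In
continuous time the law of a product chain is the product of the laws of its factors, so affinities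
multiply, and a product has mixed exactly when the product of the affinities of its factors is close
to one.

In the first example the lazy paths, which mix without cutoff on the time scale `n ^ 2`, destroy the
cutoff of the Ehrenfest chains. In the product the `n`-th Ehrenfest chain is slowed down by the
factor `r ^ (1 - n)`; the last one then mixes long after all the paths, and its cutoff is inherited
by the product.

In the second example a single chain crosses the left half in time about `n` and then jumps to `2n`,
which carries almost all of the stationary mass, except with probability `b` of order `1 / n`, when
it needs an additional time of about `n`. So it has a cutoff at time `n`. When `n` such chains are
run at the same speed, the probability that one of them is delayed is bounded away from zero and
one, so the product of a row is only partially mixed between the times `n` and `2 * n`. The factor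
`exp (-n ^ α)` in the weights makes the last row of a product the slowest, while the earlier rows
cost only a bounded factor.
-/

namespace ProductCutoff

noncomputable section

/-! ### Hellinger affinity and total variation distance -/

section Distances

variable {ι : Type*}

/-- The Hellinger affinity (Bhattacharyya coefficient) of two distributions. -/
def affinity (μ ν : ι → ℝ) : ℝ := ∑' i, √(μ i) * √(ν i)

/-- The total variation distance of two distributions, as half of their `ℓ¹` distance. -/
def tvDist (μ ν : ι → ℝ) : ℝ := 1 / 2 * ∑' i, |μ i - ν i|

lemma affinity_nonneg (μ ν : ι → ℝ) : 0 ≤ affinity μ ν := tsum_nonneg fun _ => by positivity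

lemma abs_sub_eq_abs_sqrt_sub_mul_sqrt_add {x y : ℝ} (hx : 0 ≤ x) (hy : 0 ≤ y) :
    |x - y| = |√x - √y| * (√x + √y) := by
  have : x - y = (√x - √y) * (√x + √y) := by
    linear_combination -Real.sq_sqrt hx + Real.sq_sqrt hy
  rw [this, abs_mul, abs_of_nonneg (by positivity : 0 ≤ √x + √y)]

variable [Fintype ι] {μ ν : ι → ℝ}

lemma affinity_eq_sum (μ ν : ι → ℝ) : affinity μ ν = ∑ i, √(μ i) * √(ν i) := tsum_fintype _

lemma tvDist_eq_sum (μ ν : ι → ℝ) : tvDist μ ν = 1 / 2 * ∑ i, |μ i - ν i| := by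
  rw [tvDist, tsum_fintype]

lemma sum_erase_of_mem_stdSimplex [DecidableEq ι] (hμ : μ ∈ stdSimplex ℝ ι) (z : ι) :
    ∑ i ∈ Finset.univ.erase z, μ i = 1 - μ z := by
  rw [← hμ.2, ← Finset.add_sum_erase _ _ (Finset.mem_univ z), add_sub_cancel_left]

lemma half_sum_sq_sqrt_sub_eq (hμ : μ ∈ stdSimplex ℝ ι) (hν : ν ∈ stdSimplex ℝ ι) :
    1 / 2 * ∑ i, (√(μ i) - √(ν i)) ^ 2 = 1 - affinity μ ν := by
  have hi : ∀ i, (√(μ i) - √(ν i)) ^ 2 = μ i + ν i - 2 * (√(μ i) * √(ν i)) := fun i => by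
    rw [sub_sq, Real.sq_sqrt (hμ.1 i), Real.sq_sqrt (hν.1 i)]; ring
  simp only [hi, Finset.sum_sub_distrib, Finset.sum_add_distrib, hμ.2, hν.2, ← Finset.mul_sum,
    ← affinity_eq_sum]
  ring

lemma sum_sq_sqrt_add_eq (hμ : μ ∈ stdSimplex ℝ ι) (hν : ν ∈ stdSimplex ℝ ι) :
    ∑ i, (√(μ i) + √(ν i)) ^ 2 = 2 * (1 + affinity μ ν) := by
  have hi : ∀ i, (√(μ i) + √(ν i)) ^ 2 = μ i + ν i + 2 * (√(μ i) * √(ν i)) := fun i => by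
    rw [add_sq, Real.sq_sqrt (hμ.1 i), Real.sq_sqrt (hν.1 i)]; ring
  simp only [hi, Finset.sum_add_distrib, hμ.2, hν.2, ← Finset.mul_sum, ← affinity_eq_sum]
  ring

lemma affinity_le_one (hμ : μ ∈ stdSimplex ℝ ι) (hν : ν ∈ stdSimplex ℝ ι) :
    affinity μ ν ≤ 1 := by
  have hsq : 0 ≤ ∑ i, (√(μ i) - √(ν i)) ^ 2 := Finset.sum_nonneg fun _ _ => sq_nonneg _
  linarith [half_sum_sq_sqrt_sub_eq hμ hν]

lemma one_sub_affinity_le_tvDist (hμ : μ ∈ stdSimplex ℝ ι) (hν : ν ∈ stdSimplex ℝ ι) :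
    1 - affinity μ ν ≤ tvDist μ ν := by
  rw [← half_sum_sq_sqrt_sub_eq hμ hν, tvDist_eq_sum]
  gcongr with i
  rw [abs_sub_eq_abs_sqrt_sub_mul_sqrt_add (hμ.1 i) (hν.1 i), ← sq_abs, sq]
  gcongr
  have hμi := Real.sqrt_nonneg (μ i)
  have hνi := Real.sqrt_nonneg (ν i)
  exact abs_le.2 ⟨by linarith, by linarith⟩

lemma tvDist_le_sqrt_one_sub_sq_affinity (hμ : μ ∈ stdSimplex ℝ ι) (hν : ν ∈ stdSimplex ℝ ι) :
    tvDist μ ν ≤ √(1 - affinity μ ν ^ 2) := by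
  apply Real.le_sqrt_of_sq_le
  have hcs := Finset.sum_mul_sq_le_sq_mul_sq Finset.univ (fun i => |√(μ i) - √(ν i)|)
    (fun i => √(μ i) + √(ν i))
  have hprod : ∀ i, |√(μ i) - √(ν i)| * (√(μ i) + √(ν i)) = |μ i - ν i| := fun i =>
    (abs_sub_eq_abs_sqrt_sub_mul_sqrt_add (hμ.1 i) (hν.1 i)).symm
  have hsub : ∑ i, (√(μ i) - √(ν i)) ^ 2 = 2 * (1 - affinity μ ν) := by
    linarith [half_sum_sq_sqrt_sub_eq hμ hν]
  simp only [hprod, sq_abs, hsub, sum_sq_sqrt_add_eq hμ hν] at hcs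
  rw [tvDist_eq_sum]
  linarith

lemma tvDist_le_one (hμ : μ ∈ stdSimplex ℝ ι) (hν : ν ∈ stdSimplex ℝ ι) : tvDist μ ν ≤ 1 :=
  (tvDist_le_sqrt_one_sub_sq_affinity hμ hν).trans
    (Real.sqrt_le_one.2 (sub_le_self _ (sq_nonneg _)))

lemma sum_sub_le_tvDist (hμ : μ ∈ stdSimplex ℝ ι) (hν : ν ∈ stdSimplex ℝ ι) (s : Finset ι) :
    ∑ i ∈ s, (μ i - ν i) ≤ tvDist μ ν := by
  have hs : ∑ i ∈ s, (μ i - ν i) ≤ ∑ i, (|μ i - ν i| + (μ i - ν i)) / 2 :=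
    calc ∑ i ∈ s, (μ i - ν i) ≤ ∑ i ∈ s, (|μ i - ν i| + (μ i - ν i)) / 2 :=
          Finset.sum_le_sum fun i _ => by linarith [le_abs_self (μ i - ν i)]
      _ ≤ _ := Finset.sum_le_sum_of_subset_of_nonneg (Finset.subset_univ _)
          fun i _ _ => by linarith [neg_abs_le (μ i - ν i)]
  have hzero : ∑ i, (μ i - ν i) = 0 := by rw [Finset.sum_sub_distrib, hμ.2, hν.2, sub_self]
  rw [← Finset.sum_div, Finset.sum_add_distrib, hzero] at hs
  rw [tvDist_eq_sum]
  linarith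

lemma exists_sum_sub_eq_tvDist (hμ : μ ∈ stdSimplex ℝ ι) (hν : ν ∈ stdSimplex ℝ ι) :
    ∃ s : Finset ι, ∑ i ∈ s, (μ i - ν i) = tvDist μ ν := by
  classical
  refine ⟨Finset.univ.filter fun i => 0 ≤ μ i - ν i, ?_⟩
  have hpos : ∀ i, (if 0 ≤ μ i - ν i then μ i - ν i else 0)
      = 1 / 2 * (|μ i - ν i| + (μ i - ν i)) := by
    intro i
    split_ifs with h
    · rw [abs_of_nonneg h]; ring
    · rw [abs_of_neg (not_le.1 h)]; ring
  rw [tvDist_eq_sum, Finset.sum_filter, Finset.sum_congr rfl fun i _ => hpos i, ← Finset.mul_sum,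
    Finset.sum_add_distrib, Finset.sum_sub_distrib, hμ.2, hν.2]
  ring

lemma iSup_tsum_sub_tsum_eq_tvDist (hμ : μ ∈ stdSimplex ℝ ι) (hν : ν ∈ stdSimplex ℝ ι) :
    ⨆ A : Set ι, ((∑' i : A, μ i) - ∑' i : A, ν i) = tvDist μ ν := by
  classical
  have htsum : ∀ (A : Set ι) (f : ι → ℝ), ∑' i : A, f i = ∑ i ∈ A.toFinset, f i := fun A f => by
    rw [tsum_subtype A f, tsum_fintype, ← Finset.sum_indicator_subset f A.toFinset.subset_univ,
      Set.coe_toFinset]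
  simp only [htsum, ← Finset.sum_sub_distrib]
  refine le_antisymm (ciSup_le fun A => sum_sub_le_tvDist hμ hν _) ?_
  obtain ⟨s, hs⟩ := exists_sum_sub_eq_tvDist hμ hν
  have hle := le_ciSup (f := fun A : Set ι => ∑ i ∈ A.toFinset, (μ i - ν i))
    (Set.finite_range _).bddAbove (s : Set ι)
  simpa only [Finset.toFinset_coe, hs] using hle

lemma tvDist_le_of_concentrated (hμ : μ ∈ stdSimplex ℝ ι) (hν : ν ∈ stdSimplex ℝ ι) {α β : ℝ}
    (z : ι) (hα : 1 - α ≤ μ z) (hβ : 1 - β ≤ ν z) : tvDist μ ν ≤ α + β := by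
  classical
  have hoff : ∑ i ∈ Finset.univ.erase z, |μ i - ν i| ≤ ∑ i ∈ Finset.univ.erase z, (μ i + ν i) :=
    Finset.sum_le_sum fun i _ =>
      abs_le.2 ⟨by linarith [hμ.1 i, hν.1 i], by linarith [hμ.1 i, hν.1 i]⟩
  rw [Finset.sum_add_distrib, sum_erase_of_mem_stdSimplex hμ, sum_erase_of_mem_stdSimplex hν]
    at hoff
  have hz : |μ z - ν z| ≤ α + β := by
    have := mem_Icc_of_mem_stdSimplex hμ z
    have := mem_Icc_of_mem_stdSimplex hν z
    simp only [Set.mem_Icc] at *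
    exact abs_le.2 ⟨by linarith, by linarith⟩
  rw [tvDist_eq_sum, ← Finset.add_sum_erase _ _ (Finset.mem_univ z)]
  linarith

-- AM-GM: `√(μ i) √(ν i) ≤ μ i / 4 + ν i` off `z`, and `√(μ z) ≤ (1 + μ z) / 2` at `z`.
lemma affinity_le_one_sub_quarter_add (hμ : μ ∈ stdSimplex ℝ ι) (hν : ν ∈ stdSimplex ℝ ι)
    (z : ι) : affinity μ ν ≤ 1 - (1 - μ z) / 4 + (1 - ν z) := by
  classical
  have hoff : ∑ i ∈ Finset.univ.erase z, √(μ i) * √(ν i)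
      ≤ ∑ i ∈ Finset.univ.erase z, (μ i / 4 + ν i) := by
    refine Finset.sum_le_sum fun i _ => ?_
    nlinarith [sq_nonneg (√(μ i) / 2 - √(ν i)), Real.sq_sqrt (hμ.1 i), Real.sq_sqrt (hν.1 i)]
  rw [Finset.sum_add_distrib, ← Finset.sum_div, sum_erase_of_mem_stdSimplex hμ,
    sum_erase_of_mem_stdSimplex hν] at hoff
  have hz : √(μ z) * √(ν z) ≤ (1 + μ z) / 2 := by
    have hνz : √(ν z) ≤ 1 := Real.sqrt_le_one.2 (mem_Icc_of_mem_stdSimplex hν z).2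
    nlinarith [sq_nonneg (√(μ z) - 1), Real.sq_sqrt (hμ.1 z), Real.sqrt_nonneg (μ z)]
  rw [affinity_eq_sum, ← Finset.add_sum_erase _ _ (Finset.mem_univ z)]
  linarith

lemma affinity_le_sqrt_add_sqrt_one_sub (hμ : μ ∈ stdSimplex ℝ ι) (hν : ν ∈ stdSimplex ℝ ι)
    (z : ι) : affinity μ ν ≤ √(μ z) + √(1 - ν z) := by
  classical
  have hoff := Real.sum_sqrt_mul_sqrt_le (Finset.univ.erase z) hμ.1 hν.1
  rw [sum_erase_of_mem_stdSimplex hμ, sum_erase_of_mem_stdSimplex hν] at hoff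
  have hμz : √(1 - μ z) ≤ 1 := Real.sqrt_le_one.2 (by linarith [hμ.1 z])
  have hνz : √(ν z) ≤ 1 := Real.sqrt_le_one.2 (mem_Icc_of_mem_stdSimplex hν z).2
  rw [affinity_eq_sum, ← Finset.add_sum_erase _ _ (Finset.mem_univ z)]
  nlinarith [Real.sqrt_nonneg (μ z), Real.sqrt_nonneg (1 - ν z)]

end Distances

/-! ### Continuous time chains and cutoff in terms of affinities -/

section Poisson

lemma hasSum_poisson_geometric (t ρ : ℝ) :
    HasSum (fun m : ℕ => Real.exp (-t) * t ^ m / (m.factorial : ℝ) * ρ ^ m)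
      (Real.exp (-t * (1 - ρ))) := by
  have hexp := (NormedSpace.expSeries_div_hasSum_exp (t * ρ)).mul_left (Real.exp (-t))
  rw [← Real.exp_eq_exp_ℝ, ← Real.exp_add] at hexp
  rw [show -t * (1 - ρ) = -t + t * ρ by ring]
  refine hexp.congr_fun fun m => ?_
  rw [mul_pow]
  ring

lemma hasSum_poisson (t : ℝ) :
    HasSum (fun m : ℕ => Real.exp (-t) * t ^ m / (m.factorial : ℝ)) 1 := by
  simpa using hasSum_poisson_geometric t 1

lemma hasSum_poisson_mul_nat (t : ℝ) :
    HasSum (fun m : ℕ => Real.exp (-t) * t ^ m / (m.factorial : ℝ) * m) t := by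
  rw [← hasSum_nat_add_iff' 1]
  have hsum := (hasSum_poisson t).mul_right t
  simp only [Finset.range_one, Finset.sum_singleton, Nat.cast_zero, mul_zero, sub_zero]
  rw [one_mul] at hsum
  refine hsum.congr_fun fun m => ?_
  rw [Nat.factorial_succ]
  push_cast
  field_simp
  ring

lemma hasSum_poisson_affine (t α ρ β γ : ℝ) :
    HasSum (fun m : ℕ => Real.exp (-t) * t ^ m / (m.factorial : ℝ) * (α * ρ ^ m + β * m + γ))
      (α * Real.exp (-t * (1 - ρ)) + β * t + γ) := by
  have hsum := (((hasSum_poisson_geometric t ρ).mul_left α).add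
    ((hasSum_poisson_mul_nat t).mul_left β)).add ((hasSum_poisson t).mul_left γ)
  rw [mul_one] at hsum
  exact hsum.congr_fun fun m => by ring

end Poisson

namespace Chain

variable {C : Chain}

section Exp

variable [Fintype C.X]

lemma pow_succ_apply (m : ℕ) (x y : C.X) : C.pow (m + 1) x y = ∑ z, C.K x z * C.pow m z y :=
  tsum_fintype _

lemma pow_eq_matrix_pow [DecidableEq C.X] (m : ℕ) (x y : C.X) :
    C.pow m x y = (Matrix.of C.K ^ m) x y := by
  induction m generalizing x with
  | zero => simp [pow, Matrix.one_apply]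
  | succ m ih => simp [pow_succ', Matrix.mul_apply, pow_succ_apply, ih]

open scoped Matrix.Norms.Operator in
lemma hasSum_poisson_mul_pow [DecidableEq C.X] (t : ℝ) (x y : C.X) :
    HasSum (fun m : ℕ => Real.exp (-t) * t ^ m / (m.factorial : ℝ) * C.pow m x y)
      (Real.exp (-t) * NormedSpace.exp (t • (Matrix.of C.K : Matrix C.X C.X ℝ)) x y) := by
  have hexp := NormedSpace.exp_series_hasSum_exp' (𝕂 := ℝ)
    (t • (Matrix.of C.K : Matrix C.X C.X ℝ))
  refine ((hexp.map (Matrix.entryLinearMap ℝ ℝ x y).toAddMonoidHom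
    (LinearMap.continuous_of_finiteDimensional (Matrix.entryLinearMap ℝ ℝ x y))).mul_left
      (Real.exp (-t))).congr_fun fun m => ?_
  simp only [Function.comp, LinearMap.toAddMonoidHom_coe, Matrix.entryLinearMap_apply,
    Matrix.smul_apply, smul_pow, smul_eq_mul, pow_eq_matrix_pow]
  ring

lemma H_eq_exp [DecidableEq C.X] (t : ℝ) (x y : C.X) :
    C.H t x y = Real.exp (-t) * NormedSpace.exp (t • (Matrix.of C.K : Matrix C.X C.X ℝ)) x y :=
  (hasSum_poisson_mul_pow t x y).tsum_eq

omit [Fintype C.X] in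
lemma hasSum_H [Finite C.X] (t : ℝ) (x y : C.X) :
    HasSum (fun m : ℕ => Real.exp (-t) * t ^ m / (m.factorial : ℝ) * C.pow m x y)
      (C.H t x y) := by
  classical
  cases nonempty_fintype C.X
  exact (hasSum_poisson_mul_pow t x y).summable.hasSum

omit [Fintype C.X] in
lemma H_zero [Finite C.X] [DecidableEq C.X] (x y : C.X) :
    C.H 0 x y = if x = y then 1 else 0 := by
  cases nonempty_fintype C.X
  simp [H_eq_exp, Matrix.one_apply]

lemma H_add (s t : ℝ) (x y : C.X) : C.H (s + t) x y = ∑ z, C.H s x z * C.H t z y := by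
  classical
  simp only [H_eq_exp]
  rw [add_smul, Matrix.exp_add_of_commute _ _ (((Commute.refl _).smul_left s).smul_right t),
    Matrix.mul_apply, Finset.mul_sum, neg_add, Real.exp_add]
  exact Finset.sum_congr rfl fun z _ => by ring

open scoped Matrix.Norms.Operator in
lemma hasDerivAt_H (t : ℝ) (x y : C.X) :
    HasDerivAt (fun t => C.H t x y) (∑ z, C.K x z * C.H t z y - C.H t x y) t := by
  classical
  have hexp := hasDerivAt_exp_smul_const' (Matrix.of C.K : Matrix C.X C.X ℝ) t
  have hentry := (LinearMap.toContinuousLinearMap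
    (Matrix.entryLinearMap ℝ ℝ x y : Matrix C.X C.X ℝ →ₗ[ℝ] ℝ)).hasFDerivAt.comp_hasDerivAt t hexp
  simp only [H_eq_exp]
  refine ((hasDerivAt_neg t).exp.mul hentry).congr_deriv ?_
  change Real.exp (-t) * -1 * NormedSpace.exp (t • (Matrix.of C.K : Matrix C.X C.X ℝ)) x y
    + Real.exp (-t) * ∑ z, C.K x z * NormedSpace.exp (t • (Matrix.of C.K : Matrix C.X C.X ℝ)) z y
    = _
  simp only [Finset.mul_sum, mul_left_comm (C.K _ _)]
  ring

lemma eq_H_of_hasDerivAt [DecidableEq C.X] {G : ℝ → C.X → C.X → ℝ}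
    (h0 : ∀ x y, G 0 x y = if x = y then 1 else 0)
    (h : ∀ t x y, HasDerivAt (fun t => G t x y) (∑ z, C.K x z * G t z y - G t x y) t) :
    G = C.H := by
  let generator : (C.X → C.X → ℝ) →ₗ[ℝ] (C.X → C.X → ℝ) :=
    { toFun := fun M x y => ∑ z, C.K x z * M z y - M x y
      map_add' := fun M N => by
        funext x y
        simp only [Pi.add_apply, mul_add, Finset.sum_add_distrib]
        ring
      map_smul' := fun c M => by
        funext x y
        simp only [Pi.smul_apply, smul_eq_mul, mul_left_comm (C.K _ _), ← Finset.mul_sum,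
          RingHom.id_apply]
        ring }
  have hasDerivAt_of_entries : ∀ {G : ℝ → C.X → C.X → ℝ},
      (∀ t x y, HasDerivAt (fun t => G t x y) (∑ z, C.K x z * G t z y - G t x y) t) →
      ∀ t, HasDerivAt G (generator.toContinuousLinearMap (G t)) t := fun hG t =>
    hasDerivAt_pi.2 fun x => hasDerivAt_pi.2 fun y => hG t x y
  refine ODE_solution_unique_univ (t₀ := 0) (s := fun _ => Set.univ)
    (v := fun _ => generator.toContinuousLinearMap)
    (fun _ => (generator.toContinuousLinearMap.lipschitz).lipschitzOnWith)
    (fun t => ⟨hasDerivAt_of_entries h t, Set.mem_univ _⟩)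
    (fun t => ⟨hasDerivAt_of_entries hasDerivAt_H t, Set.mem_univ _⟩) ?_
  funext x y
  rw [h0, H_zero]

end Exp

section PowerBounds

variable [Finite C.X] {t α ρ β γ : ℝ} {x y : C.X}

lemma H_le_of_pow_le (ht : 0 ≤ t) (hp : ∀ m, C.pow m x y ≤ α * ρ ^ m + β * m + γ) :
    C.H t x y ≤ α * Real.exp (-t * (1 - ρ)) + β * t + γ :=
  hasSum_le (fun m => mul_le_mul_of_nonneg_left (hp m) (by positivity)) (hasSum_H t x y)
    (hasSum_poisson_affine t α ρ β γ)

lemma one_sub_H_le_of_one_sub_pow_le (ht : 0 ≤ t)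
    (hp : ∀ m, 1 - C.pow m x y ≤ α * ρ ^ m + β * m + γ) :
    1 - C.H t x y ≤ α * Real.exp (-t * (1 - ρ)) + β * t + γ := by
  refine hasSum_le (fun m => ?_) ((hasSum_poisson t).sub (hasSum_H t x y))
    (hasSum_poisson_affine t α ρ β γ)
  rw [← mul_one_sub]
  exact mul_le_mul_of_nonneg_left (hp m) (by positivity)

end PowerBounds

/-- The part of `IsIrreducibleMarkov` that does not concern irreducibility: `C.K` is a transition
matrix and `C.stat` is a stationary distribution of it. -/
structure IsMarkov (C : Chain) : Prop where
  K_nonneg : ∀ x y, 0 ≤ C.K x y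
  K_sum : ∀ x, HasSum (C.K x) 1
  stat_nonneg : ∀ x, 0 ≤ C.stat x
  stat_sum : HasSum C.stat 1
  stationary : ∀ y, HasSum (fun x => C.stat x * C.K x y) (C.stat y)

lemma IsIrreducibleMarkov.isMarkov (h : C.IsIrreducibleMarkov) : C.IsMarkov :=
  ⟨h.K_nonneg, h.K_sum, h.stat_nonneg, h.stat_sum, h.stationary⟩

/-- The Hellinger affinity between the law at time `t` of the continuous time chain started at `x`
and the stationary distribution. -/
def aff (C : Chain) (t : ℝ) (x : C.X) : ℝ := affinity (C.H t x) C.stat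

/-- The total variation distance between the law at time `t` of the continuous time chain started
at `x` and the stationary distribution. -/
def tv (C : Chain) (t : ℝ) (x : C.X) : ℝ := tvDist (C.H t x) C.stat

/-- The affinity to the stationary distribution from the worst initial state, i.e. the square of
the Hellinger distance subtracted from one. -/
def minAff (C : Chain) (t : ℝ) : ℝ := ⨅ x, C.aff t x

lemma aff_nonneg (C : Chain) (t : ℝ) (x : C.X) : 0 ≤ C.aff t x := affinity_nonneg _ _

lemma minAff_nonneg (C : Chain) (t : ℝ) : 0 ≤ C.minAff t := Real.iInf_nonneg (C.aff_nonneg t)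

lemma minAff_le_aff (C : Chain) (t : ℝ) (x : C.X) : C.minAff t ≤ C.aff t x :=
  ciInf_le ⟨0, by rintro _ ⟨x, rfl⟩; exact C.aff_nonneg t x⟩ x

namespace IsMarkov

variable (h : C.IsMarkov)
include h

lemma nonempty : Nonempty C.X := by
  by_contra hempty
  rw [not_nonempty_iff] at hempty
  exact zero_ne_one (hasSum_empty.unique h.stat_sum)

lemma le_minAff {t c : ℝ} (hc : ∀ x, c ≤ C.aff t x) : c ≤ C.minAff t :=
  have := h.nonempty
  le_ciInf hc

section Fintype

variable [Fintype C.X]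

lemma sum_K (x : C.X) : ∑ y, C.K x y = 1 := (hasSum_fintype _).unique (h.K_sum x)

lemma sum_stat_mul_K (y : C.X) : ∑ x, C.stat x * C.K x y = C.stat y :=
  (hasSum_fintype _).unique (h.stationary y)

lemma stat_mem_stdSimplex : C.stat ∈ stdSimplex ℝ C.X :=
  ⟨h.stat_nonneg, (hasSum_fintype _).unique h.stat_sum⟩

lemma pow_mem_stdSimplex (m : ℕ) (x : C.X) : C.pow m x ∈ stdSimplex ℝ C.X := by
  classical
  induction m generalizing x with
  | zero => exact ⟨fun y => by rw [pow]; positivity, by simp [pow]⟩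
  | succ m ih =>
    refine ⟨fun y => ?_, ?_⟩
    · rw [pow_succ_apply]
      exact Finset.sum_nonneg fun z _ => mul_nonneg (h.K_nonneg _ _) ((ih z).1 y)
    · simp only [pow_succ_apply]
      rw [Finset.sum_comm]
      simp only [← Finset.mul_sum, (ih _).2, mul_one, h.sum_K]

lemma sum_stat_mul_pow (m : ℕ) (y : C.X) : ∑ x, C.stat x * C.pow m x y = C.stat y := by
  classical
  induction m with
  | zero => simp [pow]
  | succ m ih =>
    simp only [pow_succ_apply, Finset.mul_sum]
    rw [Finset.sum_comm]
    simp only [← mul_assoc, ← Finset.sum_mul, h.sum_stat_mul_K, ih]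

lemma H_mem_stdSimplex {t : ℝ} (ht : 0 ≤ t) (x : C.X) : C.H t x ∈ stdSimplex ℝ C.X := by
  refine ⟨fun y => tsum_nonneg fun m => mul_nonneg (by positivity)
    ((h.pow_mem_stdSimplex m x).1 y), ?_⟩
  have hsum := hasSum_sum fun y (_ : y ∈ Finset.univ) => hasSum_H (C := C) t x y
  simp only [← Finset.mul_sum, (h.pow_mem_stdSimplex _ x).2, mul_one] at hsum
  exact hsum.unique (hasSum_poisson t)

lemma sum_stat_mul_H (t : ℝ) (y : C.X) : ∑ x, C.stat x * C.H t x y = C.stat y := by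
  have hsum := hasSum_sum fun x (_ : x ∈ Finset.univ) =>
    (hasSum_H (C := C) t x y).mul_left (C.stat x)
  simp only [mul_left_comm (C.stat _), ← Finset.mul_sum, h.sum_stat_mul_pow] at hsum
  simpa using hsum.unique ((hasSum_poisson t).mul_right (C.stat y))

end Fintype

section Finite

variable [Finite C.X] {t : ℝ}

lemma H_nonneg (ht : 0 ≤ t) (x y : C.X) : 0 ≤ C.H t x y := by
  cases nonempty_fintype C.X
  exact (h.H_mem_stdSimplex ht x).1 y

lemma H_le_one (ht : 0 ≤ t) (x y : C.X) : C.H t x y ≤ 1 := by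
  cases nonempty_fintype C.X
  exact (mem_Icc_of_mem_stdSimplex (h.H_mem_stdSimplex ht x) y).2

lemma stat_le_one (x : C.X) : C.stat x ≤ 1 := by
  cases nonempty_fintype C.X
  exact (mem_Icc_of_mem_stdSimplex h.stat_mem_stdSimplex x).2

lemma one_sub_pow_self_le (m : ℕ) {z : C.X} {δ : ℝ} (hδ : δ ≤ 1 / 2) (hz : 1 - δ ≤ C.stat z) :
    1 - C.pow m z z ≤ 2 * δ := by
  classical
  cases nonempty_fintype C.X
  have hpow_le : ∀ x, C.pow m x z ≤ 1 := fun x =>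
    (mem_Icc_of_mem_stdSimplex (h.pow_mem_stdSimplex m x) z).2
  have hstat := h.sum_stat_mul_pow m z
  have hoff : ∑ x ∈ Finset.univ.erase z, C.stat x * C.pow m x z ≤ 1 - C.stat z :=
    (Finset.sum_le_sum fun x _ => mul_le_of_le_one_right (h.stat_nonneg x) (hpow_le x)).trans_eq
      (sum_erase_of_mem_stdSimplex h.stat_mem_stdSimplex z)
  rw [← Finset.add_sum_erase _ _ (Finset.mem_univ z)] at hstat
  nlinarith [hpow_le z, h.stat_le_one z]

-- Doeblin: subtracting the common mass `1 - η` at `z` from all rows of `H_s` leaves a nonnegative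
-- matrix with row sums `η`.
lemma tv_add_le {s η : ℝ} (z x : C.X) (hs : 0 ≤ s) (ht : 0 ≤ t) (hη : ∀ w, 1 - η ≤ C.H s w z) :
    C.tv (t + s) x ≤ η * C.tv t x := by
  classical
  cases nonempty_fintype C.X
  have hrow := (h.H_mem_stdSimplex ht x).2
  have hstat := h.stat_mem_stdSimplex.2
  let R : C.X → C.X → ℝ := fun w y => C.H s w y - if y = z then 1 - η else 0
  have hR_nonneg : ∀ w y, 0 ≤ R w y := by
    intro w y
    simp only [R]
    split_ifs with hy
    · rw [hy]
      linarith [hη w]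
    · linarith [h.H_nonneg hs w y]
  have hR_sum : ∀ w, ∑ y, R w y = η := fun w => by
    simp only [R, Finset.sum_sub_distrib, (h.H_mem_stdSimplex hs w).2, Finset.sum_ite_eq',
      Finset.mem_univ, if_true, sub_sub_cancel]
  have hsub : ∀ y, C.H (t + s) x y - C.stat y = ∑ w, (C.H t x w - C.stat w) * R w y := by
    intro y
    simp only [R, mul_sub, sub_mul, Finset.sum_sub_distrib]
    rw [H_add, h.sum_stat_mul_H, ← Finset.sum_mul, ← Finset.sum_mul, hrow, hstat]
    ring
  simp only [tv, tvDist_eq_sum]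
  calc 1 / 2 * ∑ y, |C.H (t + s) x y - C.stat y|
      ≤ 1 / 2 * ∑ y, ∑ w, |C.H t x w - C.stat w| * R w y := by
        gcongr with y
        rw [hsub]
        refine (Finset.abs_sum_le_sum_abs _ _).trans_eq (Finset.sum_congr rfl fun w _ => ?_)
        rw [abs_mul, abs_of_nonneg (hR_nonneg w y)]
    _ = η * (1 / 2 * ∑ w, |C.H t x w - C.stat w|) := by
        rw [Finset.sum_comm]
        simp only [← Finset.mul_sum, hR_sum, ← Finset.sum_mul]
        ring

lemma tv_antitone {s : ℝ} (hs : 0 ≤ s) (hst : s ≤ t) (x : C.X) : C.tv t x ≤ C.tv s x := by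
  have := h.tv_add_le (η := 1) x x (sub_nonneg.2 hst) hs
    fun w => by simpa using h.H_nonneg (sub_nonneg.2 hst) w x
  simpa using this

lemma tv_le_one (ht : 0 ≤ t) (x : C.X) : C.tv t x ≤ 1 := by
  cases nonempty_fintype C.X
  exact tvDist_le_one (h.H_mem_stdSimplex ht x) h.stat_mem_stdSimplex

lemma tv_add_mul_le {s η : ℝ} (z x : C.X) (hs : 0 ≤ s) (ht : 0 ≤ t) (hη0 : 0 ≤ η)
    (hη : ∀ w, 1 - η ≤ C.H s w z) (k : ℕ) : C.tv (t + k * s) x ≤ η ^ k * C.tv t x := by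
  induction k with
  | zero => simp
  | succ k ih =>
    rw [Nat.cast_succ, add_one_mul, ← add_assoc, pow_succ', mul_assoc]
    exact (h.tv_add_le z x hs (by positivity) hη).trans (mul_le_mul_of_nonneg_left ih hη0)

lemma tv_le_of_concentrated {α β : ℝ} (ht : 0 ≤ t) (z x : C.X) (hα : 1 - α ≤ C.H t x z)
    (hβ : 1 - β ≤ C.stat z) : C.tv t x ≤ α + β := by
  cases nonempty_fintype C.X
  exact tvDist_le_of_concentrated (h.H_mem_stdSimplex ht x) h.stat_mem_stdSimplex z hα hβ

lemma aff_le_one (ht : 0 ≤ t) (x : C.X) : C.aff t x ≤ 1 := by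
  cases nonempty_fintype C.X
  exact affinity_le_one (h.H_mem_stdSimplex ht x) h.stat_mem_stdSimplex

lemma one_sub_aff_le_tv (ht : 0 ≤ t) (x : C.X) : 1 - C.aff t x ≤ C.tv t x := by
  cases nonempty_fintype C.X
  exact one_sub_affinity_le_tvDist (h.H_mem_stdSimplex ht x) h.stat_mem_stdSimplex

lemma tv_le_sqrt_one_sub_sq_aff (ht : 0 ≤ t) (x : C.X) : C.tv t x ≤ √(1 - C.aff t x ^ 2) := by
  cases nonempty_fintype C.X
  exact tvDist_le_sqrt_one_sub_sq_affinity (h.H_mem_stdSimplex ht x) h.stat_mem_stdSimplex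

lemma exists_aff_eq_minAff (t : ℝ) : ∃ x, C.aff t x = C.minAff t :=
  have := h.nonempty
  exists_eq_ciInf_of_finite

lemma minAff_le_one (ht : 0 ≤ t) : C.minAff t ≤ 1 := by
  obtain ⟨x, hx⟩ := h.exists_aff_eq_minAff t
  exact hx ▸ h.aff_le_one ht x

lemma one_sub_le_minAff_of_tv_le (ht : 0 ≤ t) {c : ℝ} (hc : ∀ x, C.tv t x ≤ c) :
    1 - c ≤ C.minAff t :=
  h.le_minAff fun x => by linarith [h.one_sub_aff_le_tv ht x, hc x]

lemma dH_eq_sqrt (ht : 0 ≤ t) : C.dH t = √(1 - C.minAff t) := by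
  cases nonempty_fintype C.X
  have := h.nonempty
  have hsqrt : ∀ x, √(1 / 2 * ∑' y, (√(C.H t x y) - √(C.stat y)) ^ 2) = √(1 - C.aff t x) :=
    fun x => by
      rw [tsum_fintype,
        half_sum_sq_sqrt_sub_eq (h.H_mem_stdSimplex ht x) h.stat_mem_stdSimplex, aff]
  simp only [dH, hsqrt]
  refine le_antisymm (ciSup_le fun x => Real.sqrt_le_sqrt (by linarith [C.minAff_le_aff t x])) ?_
  obtain ⟨x, hx⟩ := h.exists_aff_eq_minAff t
  rw [← hx]
  exact le_ciSup (f := fun x => √(1 - C.aff t x)) (Set.finite_range _).bddAbove x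

lemma minAff_eq_one_sub_dH_sq (ht : 0 ≤ t) : C.minAff t = 1 - C.dH t ^ 2 := by
  rw [h.dH_eq_sqrt ht, Real.sq_sqrt (sub_nonneg.2 (h.minAff_le_one ht)), sub_sub_cancel]

lemma dTV_eq_iSup_tv (ht : 0 ≤ t) : C.dTV t = ⨆ x, C.tv t x := by
  cases nonempty_fintype C.X
  exact iSup_congr fun x =>
    iSup_tsum_sub_tsum_eq_tvDist (h.H_mem_stdSimplex ht x) h.stat_mem_stdSimplex

lemma one_sub_minAff_le_dTV (ht : 0 ≤ t) : 1 - C.minAff t ≤ C.dTV t := by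
  obtain ⟨x, hx⟩ := h.exists_aff_eq_minAff t
  rw [← hx, h.dTV_eq_iSup_tv ht]
  exact (h.one_sub_aff_le_tv ht x).trans (le_ciSup (Set.finite_range _).bddAbove x)

lemma dTV_nonneg (ht : 0 ≤ t) : 0 ≤ C.dTV t :=
  (sub_nonneg.2 (h.minAff_le_one ht)).trans (h.one_sub_minAff_le_dTV ht)

lemma tv_le_sqrt_one_sub_sq_minAff (ht : 0 ≤ t) (x : C.X) :
    C.tv t x ≤ √(1 - C.minAff t ^ 2) := by
  refine (h.tv_le_sqrt_one_sub_sq_aff ht x).trans (Real.sqrt_le_sqrt ?_)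
  have := C.minAff_le_aff t x
  have := C.minAff_nonneg t
  gcongr

lemma dTV_le_sqrt_one_sub_sq_minAff (ht : 0 ≤ t) : C.dTV t ≤ √(1 - C.minAff t ^ 2) := by
  have := h.nonempty
  rw [h.dTV_eq_iSup_tv ht]
  exact ciSup_le (h.tv_le_sqrt_one_sub_sq_minAff ht)

lemma dTV_le_one (ht : 0 ≤ t) : C.dTV t ≤ 1 :=
  (h.dTV_le_sqrt_one_sub_sq_minAff ht).trans
    (Real.sqrt_le_one.2 (sub_le_self _ (sq_nonneg _)))

lemma minAff_le_sqrt_one_sub_sq_dTV (ht : 0 ≤ t) : C.minAff t ≤ √(1 - C.dTV t ^ 2) := by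
  have hdTV := h.dTV_le_sqrt_one_sub_sq_minAff ht
  rw [Real.le_sqrt (h.dTV_nonneg ht)] at hdTV
  · exact Real.le_sqrt_of_sq_le (by linarith)
  · nlinarith [h.minAff_le_one ht, C.minAff_nonneg t]

end Finite

end IsMarkov

namespace IsIrreducibleMarkov

variable (h : C.IsIrreducibleMarkov)
include h

lemma H_pos [Finite C.X] {t : ℝ} (ht : 0 < t) (x y : C.X) : 0 < C.H t x y := by
  cases nonempty_fintype C.X
  obtain ⟨m, hm⟩ := h.irreducible x y
  refine lt_of_lt_of_le ?_ ((hasSum_H t x y).summable.le_tsum m fun k _ =>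
    mul_nonneg (by positivity) ((h.isMarkov.pow_mem_stdSimplex k x).1 y))
  positivity

lemma exists_tv_le [Finite C.X] {ε : ℝ} (hε : 0 < ε) :
    ∃ T, 0 ≤ T ∧ ∀ t, T ≤ t → ∀ x, C.tv t x ≤ ε := by
  have := h.isMarkov.nonempty
  obtain ⟨z⟩ := h.isMarkov.nonempty
  obtain ⟨w, hw⟩ := Finite.exists_min fun w => C.H 1 w z
  let η := 1 - C.H 1 w z
  have hη_nonneg : 0 ≤ η := sub_nonneg.2 (h.isMarkov.H_le_one zero_le_one w z)
  have hη_lt : η < 1 := sub_lt_self _ (h.H_pos one_pos w z)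
  obtain ⟨k, hk⟩ := exists_pow_lt_of_lt_one hε hη_lt
  refine ⟨k, by positivity, fun t ht x => ?_⟩
  calc C.tv t x ≤ C.tv (0 + k * 1) x := by
        rw [zero_add, mul_one]
        exact h.isMarkov.tv_antitone (by positivity) ht x
    _ ≤ η ^ k * C.tv 0 x := h.isMarkov.tv_add_mul_le z x zero_le_one le_rfl hη_nonneg
        (fun v => by simpa only [η, sub_sub_cancel] using hw v) k
    _ ≤ η ^ k := mul_le_of_le_one_right (pow_nonneg hη_nonneg k)
        (h.isMarkov.tv_le_one le_rfl x)
    _ ≤ ε := hk.le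

end IsIrreducibleMarkov

end Chain

/-- Cutoff in terms of the affinities `minAff`, which tend to one where the distances tend to zero
and to zero where the distances tend to one. -/
def CutoffAff (F : ℕ → Chain) : Prop :=
  ∃ t : ℕ → ℝ, (∀ n, 0 < t n) ∧
    (∀ a : ℝ, 1 < a → Tendsto (fun n => (F n).minAff (a * t n)) atTop (𝓝 1)) ∧
    (∀ a : ℝ, 0 < a → a < 1 → Tendsto (fun n => (F n).minAff (a * t n)) atTop (𝓝 0))

section Cutoff

variable {F : ℕ → Chain} [∀ n, Finite (F n).X] (hF : ∀ n, (F n).IsMarkov) {s : ℕ → ℝ}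
include hF

lemma tendsto_dTV_zero_iff (hs : ∀ n, 0 ≤ s n) :
    Tendsto (fun n => (F n).dTV (s n)) atTop (𝓝 0) ↔
      Tendsto (fun n => (F n).minAff (s n)) atTop (𝓝 1) := by
  constructor
  · intro hdTV
    have hlower := hdTV.const_sub 1
    rw [sub_zero] at hlower
    exact tendsto_of_tendsto_of_tendsto_of_le_of_le hlower tendsto_const_nhds
      (fun n => sub_le_comm.1 ((hF n).one_sub_minAff_le_dTV (hs n)))
      fun n => (hF n).minAff_le_one (hs n)
  · intro haff
    have hupper := ((haff.pow 2).const_sub 1).sqrt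
    norm_num at hupper
    exact tendsto_of_tendsto_of_tendsto_of_le_of_le tendsto_const_nhds hupper
      (fun n => (hF n).dTV_nonneg (hs n)) fun n => (hF n).dTV_le_sqrt_one_sub_sq_minAff (hs n)

lemma tendsto_dTV_one_iff (hs : ∀ n, 0 ≤ s n) :
    Tendsto (fun n => (F n).dTV (s n)) atTop (𝓝 1) ↔
      Tendsto (fun n => (F n).minAff (s n)) atTop (𝓝 0) := by
  constructor
  · intro hdTV
    have hupper := ((hdTV.pow 2).const_sub 1).sqrt
    norm_num at hupper
    exact tendsto_of_tendsto_of_tendsto_of_le_of_le tendsto_const_nhds hupper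
      (fun n => (F n).minAff_nonneg _) fun n => (hF n).minAff_le_sqrt_one_sub_sq_dTV (hs n)
  · intro haff
    have hlower := haff.const_sub 1
    rw [sub_zero] at hlower
    exact tendsto_of_tendsto_of_tendsto_of_le_of_le hlower tendsto_const_nhds
      (fun n => (hF n).one_sub_minAff_le_dTV (hs n)) fun n => (hF n).dTV_le_one (hs n)

lemma tendsto_dH_iff (hs : ∀ n, 0 ≤ s n) {d : ℝ} (hd : 0 ≤ d) :
    Tendsto (fun n => (F n).dH (s n)) atTop (𝓝 d) ↔
      Tendsto (fun n => (F n).minAff (s n)) atTop (𝓝 (1 - d ^ 2)) := by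
  constructor
  · intro hdH
    simp only [fun n => (hF n).minAff_eq_one_sub_dH_sq (hs n)]
    exact (hdH.pow 2).const_sub 1
  · intro haff
    simp only [fun n => (hF n).dH_eq_sqrt (hs n)]
    have hsqrt := (haff.const_sub 1).sqrt
    rwa [sub_sub_cancel, Real.sqrt_sq hd] at hsqrt

lemma cutoffTV_iff : CutoffTV F ↔ CutoffAff F := by
  refine exists_congr fun t => and_congr_right fun ht => and_congr ?_ ?_
  · exact forall_congr' fun a => imp_congr_right fun ha => tendsto_dTV_zero_iff hF fun n =>
      mul_nonneg (by linarith) (ht n).le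
  · exact forall_congr' fun a => imp_congr_right fun ha => imp_congr_right fun _ =>
      tendsto_dTV_one_iff hF fun n => mul_nonneg ha.le (ht n).le

lemma cutoffH_iff : CutoffH F ↔ CutoffAff F := by
  refine exists_congr fun t => and_congr_right fun ht => and_congr ?_ ?_
  · refine forall_congr' fun a => imp_congr_right fun ha => ?_
    simpa using tendsto_dH_iff hF (fun n => mul_nonneg (by linarith) (ht n).le) le_rfl
  · refine forall_congr' fun a => imp_congr_right fun ha => imp_congr_right fun _ => ?_
    simpa using tendsto_dH_iff hF (fun n => mul_nonneg ha.le (ht n).le) zero_le_one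

end Cutoff

/-! ### Product chains -/

section Product

variable {n : ℕ} {C : Fin n → Chain} {w : Fin n → ℝ}

instance prodChainFintype [∀ i, Fintype (C i).X] : Fintype (prodChain C w).X :=
  inferInstanceAs (Fintype (∀ i, (C i).X))

instance prodChainFinite [∀ i, Finite (C i).X] : Finite (prodChain C w).X :=
  inferInstanceAs (Finite (∀ i, (C i).X))

lemma sum_prod_pi [∀ i, Fintype (C i).X] (f : ∀ i, (C i).X → ℝ) :
    ∑ x : (prodChain C w).X, ∏ i, f i (x i) = ∏ i, ∑ z, f i z := by
  classical
  rw [Finset.prod_univ_sum, Fintype.piFinset_univ]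
  rfl

lemma sum_prodChain_K_mul [∀ i, Fintype (C i).X] (x : ∀ i, (C i).X) (g : (∀ i, (C i).X) → ℝ) :
    ∑ y : (prodChain C w).X, (prodChain C w).K x y * g y
      = ∑ i, w i * ∑ z, (C i).K (x i) z * g (Function.update x i z) := by
  classical
  simp only [prodChain, Finset.sum_mul]
  rw [Finset.sum_comm]
  refine Finset.sum_congr rfl fun i _ => ?_
  rw [Finset.mul_sum]
  refine (Finset.sum_of_injOn (fun z => Function.update x i z)
    (Function.update_injective x i).injOn (fun _ _ => Finset.mem_univ _) ?_ ?_).symm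
  · intro y _ hy
    obtain ⟨j, hj, hxy⟩ : ∃ j ∈ Finset.univ.erase i, x j ≠ y j := by
      by_contra! hxy
      refine hy ⟨y i, Finset.mem_coe.2 (Finset.mem_univ _), funext fun j => ?_⟩
      rcases eq_or_ne j i with rfl | hj
      · exact Function.update_self ..
      · simpa only [Function.update_of_ne hj] using
          hxy j (Finset.mem_erase.2 ⟨hj, Finset.mem_univ _⟩)
    rw [Finset.prod_eq_zero hj (if_neg hxy)]
    ring
  · intro z _
    rw [Finset.prod_eq_one fun j hj => if_pos
      (Function.update_of_ne (Finset.ne_of_mem_erase hj) ..).symm, Function.update_self]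
    ring

lemma sum_prodChain_stat_mul_K [∀ i, Fintype (C i).X] (hC : ∀ i, (C i).IsMarkov)
    (hw : ∑ i, w i = 1) (y : ∀ i, (C i).X) :
    ∑ x : (prodChain C w).X, (prodChain C w).stat x * (prodChain C w).K x y
      = (prodChain C w).stat y := by
  classical
  have hfactor : ∀ i, ∑ x : (prodChain C w).X, (∏ j, (C j).stat (x j)) *
      ((C i).K (x i) (y i) * ∏ j ∈ Finset.univ.erase i, if x j = y j then 1 else 0)
        = ∏ j, (C j).stat (y j) := by
    intro i
    have hprod : ∀ x : ∀ j, (C j).X, (∏ j, (C j).stat (x j)) *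
        ((C i).K (x i) (y i) * ∏ j ∈ Finset.univ.erase i, if x j = y j then 1 else 0)
          = ∏ j, (C j).stat (x j) *
            if j = i then (C j).K (x j) (y j) else if x j = y j then 1 else 0 := by
      intro x
      rw [Finset.prod_mul_distrib, ← Finset.mul_prod_erase _ (fun j => ite (j = i) _ _)
        (Finset.mem_univ i), if_pos rfl]
      congr 2
      exact Finset.prod_congr rfl fun j hj => (if_neg (Finset.ne_of_mem_erase hj)).symm
    refine (Finset.sum_congr rfl fun x _ => hprod x).trans ((sum_prod_pi fun j z =>
      (C j).stat z * if j = i then (C j).K z (y j) else if z = y j then 1 else 0).trans ?_)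
    refine Finset.prod_congr rfl fun j _ => ?_
    split_ifs
    · exact (hC j).sum_stat_mul_K (y j)
    · simp
  simp only [prodChain, Finset.mul_sum, mul_left_comm _ (w _)] at hfactor ⊢
  rw [Finset.sum_comm]
  simp only [← Finset.mul_sum, hfactor, ← Finset.sum_mul, hw, one_mul]

lemma isMarkov_prodChain [∀ i, Finite (C i).X] (hC : ∀ i, (C i).IsMarkov) (hw0 : ∀ i, 0 ≤ w i)
    (hw : ∑ i, w i = 1) : (prodChain C w).IsMarkov := by
  classical
  have := fun i => Fintype.ofFinite (C i).X
  refine ⟨fun x y => ?_, fun x => ?_, fun x => ?_, ?_, fun y => ?_⟩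
  · change 0 ≤ ∑ i, w i * _
    refine Finset.sum_nonneg fun i _ => mul_nonneg (hw0 i)
      (mul_nonneg ((hC i).K_nonneg _ _) (Finset.prod_nonneg fun j _ => ?_))
    split_ifs <;> norm_num
  · have hrow := sum_prodChain_K_mul (w := w) x fun _ => 1
    simp only [mul_one, (hC _).sum_K, hw] at hrow
    exact hrow ▸ hasSum_fintype _
  · change 0 ≤ ∏ i, (C i).stat (x i)
    exact Finset.prod_nonneg fun i _ => (hC i).stat_nonneg (x i)
  · have hstat := sum_prod_pi (w := w) fun i => (C i).stat
    rw [Finset.prod_eq_one fun i _ => (hC i).stat_mem_stdSimplex.2] at hstat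
    exact hstat ▸ hasSum_fintype _
  · exact sum_prodChain_stat_mul_K hC hw y ▸ hasSum_fintype _

lemma hasDerivAt_prod_H [∀ i, Fintype (C i).X] (t : ℝ) (x y : ∀ i, (C i).X) :
    HasDerivAt (fun t => ∏ i, (C i).H (w i * t) (x i) (y i))
      (∑ i, w i * ((∑ z, (C i).K (x i) z * (C i).H (w i * t) z (y i)
        - (C i).H (w i * t) (x i) (y i))
          * ∏ j ∈ Finset.univ.erase i, (C j).H (w j * t) (x j) (y j))) t := by
  have hfactor : ∀ i ∈ Finset.univ, HasDerivAt (fun t => (C i).H (w i * t) (x i) (y i))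
      ((∑ z, (C i).K (x i) z * (C i).H (w i * t) z (y i) - (C i).H (w i * t) (x i) (y i)) * w i)
      t := fun i _ =>
    (Chain.hasDerivAt_H (w i * t) (x i) (y i)).comp t (hasDerivAt_const_mul (w i))
  refine (HasDerivAt.fun_finsetProd hfactor).congr_deriv (Finset.sum_congr rfl fun i _ => ?_)
  rw [smul_eq_mul]
  ring

lemma H_prodChain [∀ i, Finite (C i).X] (hw : ∑ i, w i = 1) (t : ℝ) (x y : ∀ i, (C i).X) :
    (prodChain C w).H t x y = ∏ i, (C i).H (w i * t) (x i) (y i) := by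
  classical
  have := fun i => Fintype.ofFinite (C i).X
  have hzero : ∀ x y : (prodChain C w).X,
      ∏ i, (C i).H (w i * 0) (x i) (y i) = if x = y then 1 else 0 := by
    intro x y
    simp only [mul_zero, Chain.H_zero]
    split_ifs with hxy
    · exact Finset.prod_eq_one fun i _ => if_pos (congrFun hxy i)
    · obtain ⟨i, hi⟩ := Function.ne_iff.1 hxy
      exact Finset.prod_eq_zero (Finset.mem_univ i) (if_neg hi)
  have hderiv : ∀ t (x y : ∀ i, (C i).X),
      HasDerivAt (fun t => ∏ i, (C i).H (w i * t) (x i) (y i))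
        (∑ z : (prodChain C w).X, (prodChain C w).K x z * ∏ i, (C i).H (w i * t) (z i) (y i)
          - ∏ i, (C i).H (w i * t) (x i) (y i)) t := by
    intro t x y
    refine (hasDerivAt_prod_H t x y).congr_deriv ?_
    have hupdate : ∀ i z, ∏ j, (C j).H (w j * t) (Function.update x i z j) (y j)
        = (C i).H (w i * t) z (y i)
          * ∏ j ∈ Finset.univ.erase i, (C j).H (w j * t) (x j) (y j) := by
      intro i z
      rw [← Finset.mul_prod_erase _ _ (Finset.mem_univ i), Function.update_self]
      congr 1
      exact Finset.prod_congr rfl fun j hj => by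
        rw [Function.update_of_ne (Finset.ne_of_mem_erase hj)]
    rw [sum_prodChain_K_mul x fun z => ∏ i, (C i).H (w i * t) (z i) (y i)]
    simp only [hupdate, sub_mul, mul_sub, Finset.sum_sub_distrib, Finset.sum_mul, ← mul_assoc,
      Finset.mul_prod_erase _ (fun j => (C j).H (w j * t) (x j) (y j)) (Finset.mem_univ _)]
    rw [← Finset.sum_mul, hw, one_mul]
  exact congrFun (congrFun (congrFun (Chain.eq_H_of_hasDerivAt (C := prodChain C w)
    (G := fun t x y => ∏ i, (C i).H (w i * t) (x i) (y i)) hzero hderiv) t) x) y |>.symm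

variable [∀ i, Finite (C i).X] (hC : ∀ i, (C i).IsMarkov) (hw0 : ∀ i, 0 ≤ w i)
  (hw : ∑ i, w i = 1) {t : ℝ} (ht : 0 ≤ t)
include hC hw0 hw ht

lemma aff_prodChain (x : ∀ i, (C i).X) :
    (prodChain C w).aff t x = ∏ i, (C i).aff (w i * t) (x i) := by
  have := fun i => Fintype.ofFinite (C i).X
  simp only [Chain.aff, affinity_eq_sum]
  rw [← sum_prod_pi (w := w) (fun i z => √((C i).H (w i * t) (x i) z) * √((C i).stat z))]
  refine Finset.sum_congr rfl fun y _ => ?_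
  rw [Finset.prod_mul_distrib]
  exact congrArg₂ _ ((congrArg Real.sqrt (H_prodChain hw t x y)).trans
      (Real.sqrt_prod _ fun i _ => (hC i).H_nonneg (mul_nonneg (hw0 i) ht) _ _))
    (show √(∏ i, (C i).stat (y i)) = _ from Real.sqrt_prod _ fun i _ => (hC i).stat_nonneg (y i))

lemma minAff_prodChain : (prodChain C w).minAff t = ∏ i, (C i).minAff (w i * t) := by
  apply le_antisymm
  · choose x hx using fun i => (hC i).exists_aff_eq_minAff (w i * t)
    simp only [← hx]
    rw [← aff_prodChain hC hw0 hw ht]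
    exact (prodChain C w).minAff_le_aff t x
  · refine (isMarkov_prodChain hC hw0 hw).le_minAff fun x => ?_
    rw [aff_prodChain hC hw0 hw ht x]
    exact Finset.prod_le_prod (fun i _ => (C i).minAff_nonneg _)
      fun i _ => (C i).minAff_le_aff _ _

end Product

section ProductFamily

variable {F : ℕ → Chain} {p : ℕ → ℝ}

instance prodFamilyFinite [∀ k, Finite (F k).X] (n : ℕ) : Finite (prodFamily F p n).X :=
  prodChainFinite

lemma sum_normalized_weights (hp : ∀ k, 0 < p k) (n : ℕ) :
    ∑ i : Fin (n + 1), p i / ∑ j ∈ Finset.range (n + 1), p j = 1 := by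
  rw [← Finset.sum_div, Fin.sum_univ_eq_sum_range p,
    div_self (Finset.sum_pos (fun j _ => hp j) (by simp)).ne']

variable [∀ k, Finite (F k).X] (hF : ∀ k, (F k).IsMarkov) (hp : ∀ k, 0 < p k)
include hF hp

lemma isMarkov_prodFamily (n : ℕ) : (prodFamily F p n).IsMarkov :=
  isMarkov_prodChain (fun i => hF i)
    (fun i => div_nonneg (hp i).le (Finset.sum_nonneg fun j _ => (hp j).le))
    (sum_normalized_weights hp n)

lemma minAff_prodFamily (n : ℕ) {t : ℝ} (ht : 0 ≤ t) :
    (prodFamily F p n).minAff t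
      = ∏ k ∈ Finset.range (n + 1),
        (F k).minAff (p k * (t / ∑ j ∈ Finset.range (n + 1), p j)) := by
  rw [prodFamily, minAff_prodChain (fun i => hF i)
    (fun i => div_nonneg (hp i).le (Finset.sum_nonneg fun j _ => (hp j).le))
    (sum_normalized_weights hp n) ht, ← Fin.prod_univ_eq_prod_range]
  exact Finset.prod_congr rfl fun i _ => by rw [div_mul_eq_mul_div, mul_div_assoc]

end ProductFamily

lemma one_sub_sum_le_prod {ι : Type*} (s : Finset ι) (f g : ι → ℝ) (hf0 : ∀ i ∈ s, 0 ≤ f i)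
    (hf1 : ∀ i ∈ s, f i ≤ 1) (hg : ∀ i ∈ s, 1 - g i ≤ f i) :
    1 - ∑ i ∈ s, g i ≤ ∏ i ∈ s, f i := by
  induction s using Finset.cons_induction with
  | empty => simp
  | cons a s ha ih =>
    simp only [Finset.mem_cons, forall_eq_or_imp] at hf0 hf1 hg
    rw [Finset.prod_cons, Finset.sum_cons]
    have hle : ∏ i ∈ s, f i ≤ 1 := Finset.prod_le_one hf0.2 hf1.2
    nlinarith [ih hf0.2 hf1.2 hg.2, mul_nonneg (sub_nonneg.2 hf1.1) (sub_nonneg.2 hle)]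

/-! ### Irreducibility of the chains of the two counterexamples -/

section NearestNeighbour

lemma sum_ite_val_mul {N c : ℕ} {P : Prop} [Decidable P] {Q : Fin N → Prop} [DecidablePred Q]
    (A : ℝ) (g : ℕ → ℝ) (hQ : ∀ k, Q k ↔ P ∧ (k : ℕ) = c) (hc : P → c < N) :
    ∑ k : Fin N, (if Q k then A else 0) * g k = if P then A * g c else 0 := by
  split_ifs with hP
  · rw [Finset.sum_eq_single ⟨c, hc hP⟩]
    · rw [if_pos ((hQ _).2 ⟨hP, rfl⟩)]
    · intro k _ hk
      rw [if_neg, zero_mul]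
      exact fun h => hk (Fin.ext ((hQ k).1 h).2)
    · simp
  · refine Finset.sum_eq_zero fun k _ => ?_
    rw [if_neg (fun h => hP ((hQ k).1 h).1), zero_mul]

lemma Chain.pow_nonneg {C : Chain} (hK : ∀ x y, 0 ≤ C.K x y) (m : ℕ) (x y : C.X) :
    0 ≤ C.pow m x y := by
  induction m generalizing x with
  | zero => rw [Chain.pow]; positivity
  | succ m ih => exact tsum_nonneg fun z => mul_nonneg (hK x z) (ih z)

lemma Chain.pow_succ_pos {C : Chain} [Finite C.X] (hK : ∀ x y, 0 ≤ C.K x y) {m : ℕ}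
    {x y z : C.X} (hxz : 0 < C.K x z) (hzy : 0 < C.pow m z y) : 0 < C.pow (m + 1) x y := by
  have := Fintype.ofFinite C.X
  rw [Chain.pow_succ_apply]
  exact (mul_pos hxz hzy).trans_le (Finset.single_le_sum
    (f := fun w => C.K x w * C.pow m w y)
    (fun w _ => mul_nonneg (hK x w) (pow_nonneg hK m w y)) (Finset.mem_univ z))

variable {N : ℕ} {K : Fin (N + 1) → Fin (N + 1) → ℝ} {π : Fin (N + 1) → ℝ}

lemma exists_pow_pos_of_neighbours (hK : ∀ x y, 0 ≤ K x y)
    (hup : ∀ x y : Fin (N + 1), (y : ℕ) = x + 1 → 0 < K x y)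
    (hdown : ∀ x y : Fin (N + 1), (x : ℕ) = y + 1 → 0 < K x y) (x y : Fin (N + 1)) :
    ∃ m, 0 < (Chain.mk (Fin (N + 1)) K π).pow m x y := by
  have : Finite (Chain.mk (Fin (N + 1)) K π).X := inferInstanceAs (Finite (Fin (N + 1)))
  have hrefl : ∀ x, 0 < (Chain.mk (Fin (N + 1)) K π).pow 0 x x := fun x => by simp [Chain.pow]
  rcases le_total (x : ℕ) y with hxy | hxy
  all_goals
    obtain ⟨d, hd⟩ := Nat.exists_eq_add_of_le hxy
    clear hxy
    induction d generalizing x with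
    | zero =>
      obtain rfl : x = y := Fin.ext (by omega)
      exact ⟨0, hrefl x⟩
    | succ d ih => ?_
  · obtain ⟨m, hm⟩ := ih ⟨x + 1, by omega⟩ (by simp only; omega)
    exact ⟨m + 1, Chain.pow_succ_pos hK (hup _ _ rfl) hm⟩
  · obtain ⟨m, hm⟩ := ih ⟨x - 1, by omega⟩ (by simp only; omega)
    exact ⟨m + 1, Chain.pow_succ_pos hK (hdown _ _ (by simp only; omega)) hm⟩

lemma isIrreducibleMarkov_of_reversible (hK : ∀ x y, 0 ≤ K x y) (hK1 : ∀ x, ∑ y, K x y = 1)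
    (hup : ∀ x y : Fin (N + 1), (y : ℕ) = x + 1 → 0 < K x y)
    (hdown : ∀ x y : Fin (N + 1), (x : ℕ) = y + 1 → 0 < K x y) (hπ : ∀ x, 0 ≤ π x)
    (hπ1 : ∑ x, π x = 1) (hrev : ∀ x y, π x * K x y = π y * K y x) :
    (Chain.mk (Fin (N + 1)) K π).IsIrreducibleMarkov where
  countable := inferInstanceAs (Countable (Fin (N + 1)))
  K_nonneg := hK
  K_sum x := hK1 x ▸ hasSum_fintype (K x)
  irreducible := exists_pow_pos_of_neighbours hK hup hdown
  stat_nonneg := hπ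
  stat_sum := hπ1 ▸ hasSum_fintype π
  stationary y := by
    have hsum : ∑ x, π x * K x y = π y := by
      rw [Finset.sum_congr rfl fun x _ => hrev x y, ← Finset.mul_sum, hK1, mul_one]
    change HasSum (fun x => π x * K x y) (π y)
    rw [← hsum]
    exact hasSum_fintype _

end NearestNeighbour

section Ehrenfest

variable {n : ℕ}

instance ehrenfestFintype : Fintype (ehrenfest n).X := inferInstanceAs (Fintype (Fin (n + 1)))

lemma sum_ehrenfest_K_mul (j : Fin (n + 1)) (g : ℕ → ℝ) :
    ∑ k : Fin (n + 1), (ehrenfest n).K j k * g k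
      = ((n : ℝ) - (j : ℕ)) / n * g (j + 1) + ((j : ℕ) : ℝ) / n * g (j - 1) := by
  simp only [ehrenfest, add_mul, Finset.sum_add_distrib]
  have hup := sum_ite_val_mul (N := n + 1) (c := j + 1) (P := (j : ℕ) < n)
    (Q := fun k => (k : ℕ) = j + 1) (((n : ℝ) - (j : ℕ)) / n) g
    (fun k => ⟨fun h => ⟨by omega, h⟩, fun h => h.2⟩) (by omega)
  have hdown := sum_ite_val_mul (N := n + 1) (c := j - 1) (P := 0 < (j : ℕ))
    (Q := fun k => (j : ℕ) = k + 1) (((j : ℕ) : ℝ) / n) g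
    (fun k => ⟨fun h => ⟨by omega, by omega⟩, fun h => by omega⟩) (by omega)
  refine congrArg₂ (· + ·) (hup.trans ?_) (hdown.trans ?_)
  · split_ifs with h
    · rfl
    · simp [show (j : ℕ) = n by omega]
  · split_ifs with h
    · rfl
    · simp [show (j : ℕ) = 0 by omega]

lemma choose_mul_sub_eq_choose_succ_mul {j : ℕ} (hj : j ≤ n) :
    (n.choose j : ℝ) * ((n : ℝ) - j) = n.choose (j + 1) * ((j + 1 : ℕ) : ℝ) := by
  rw [← Nat.cast_sub hj]
  exact_mod_cast (Nat.choose_succ_right_eq n j).symm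

lemma ehrenfest_reversible (x y : Fin (n + 1)) :
    (ehrenfest n).stat x * (ehrenfest n).K x y = (ehrenfest n).stat y * (ehrenfest n).K y x := by
  wlog hxy : (x : ℕ) ≤ y generalizing x y
  · exact (this y x (by omega)).symm
  simp only [ehrenfest, if_neg (show ¬ (x : ℕ) = y + 1 by omega), add_zero]
  rcases eq_or_ne (y : ℕ) (x + 1) with hy | hy
  · simp only [hy, if_true, zero_add]
    rw [div_mul_div_comm, div_mul_div_comm, choose_mul_sub_eq_choose_succ_mul (by omega)]
  · simp [hy]

lemma ehrenfest_isIrreducibleMarkov (hn : 1 ≤ n) : (ehrenfest n).IsIrreducibleMarkov := by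
  have hn' : (0 : ℝ) < n := by exact_mod_cast hn
  have hle : ∀ j : Fin (n + 1), ((j : ℕ) : ℝ) ≤ n := fun j => by
    exact_mod_cast Nat.lt_succ_iff.1 j.2
  have hup : ∀ x y : Fin (n + 1),
      0 ≤ if (y : ℕ) = x + 1 then ((n : ℝ) - (x : ℕ)) / n else 0 := fun x y =>
    ite_nonneg (div_nonneg (sub_nonneg.2 (hle x)) hn'.le) le_rfl
  refine isIrreducibleMarkov_of_reversible
    (fun x y => add_nonneg (hup x y) (ite_nonneg (by positivity) le_rfl))
    (fun x => ?_) (fun x y hxy => ?_) (fun x y hxy => ?_) (fun x => by positivity) ?_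
    ehrenfest_reversible
  · have hrow := sum_ehrenfest_K_mul x fun _ => 1
    simp only [mul_one] at hrow
    refine hrow.trans ?_
    field_simp
    ring
  · simp only [if_pos hxy]
    refine add_pos_of_pos_of_nonneg (div_pos (sub_pos.2 ?_) hn') (ite_nonneg (by positivity) le_rfl)
    exact_mod_cast (show (x : ℕ) < n by omega)
  · refine add_pos_of_nonneg_of_pos (hup x y) ?_
    rw [if_pos hxy]
    exact div_pos (by exact_mod_cast (show 0 < (x : ℕ) by omega)) hn'
  · rw [← Finset.sum_div, Fin.sum_univ_eq_sum_range (fun j => (n.choose j : ℝ)) (n + 1),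
      div_eq_one_iff_eq (by positivity)]
    exact_mod_cast Nat.sum_range_choose n

end Ehrenfest

section Path

variable {n : ℕ}

instance lazyPathFintype : Fintype (lazyPath n).X := inferInstanceAs (Fintype (Fin (n + 1)))

lemma sum_lazyPath_K_mul (j : Fin (n + 1)) (g : ℕ → ℝ) :
    ∑ k : Fin (n + 1), (lazyPath n).K j k * g k
      = 1 / 2 * (if (j : ℕ) < n then g (j + 1) else g n)
        + 1 / 2 * (if 0 < (j : ℕ) then g (j - 1) else g 0) := by
  simp only [lazyPath, add_mul, Finset.sum_add_distrib]
  have hup := sum_ite_val_mul (N := n + 1) (c := j + 1) (P := (j : ℕ) < n)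
    (Q := fun k => (k : ℕ) = j + 1) (1 / 2) g
    (fun k => ⟨fun h => ⟨by omega, h⟩, fun h => h.2⟩) (by omega)
  have hdown := sum_ite_val_mul (N := n + 1) (c := j - 1) (P := 0 < (j : ℕ))
    (Q := fun k => (j : ℕ) = k + 1) (1 / 2) g
    (fun k => ⟨fun h => ⟨by omega, by omega⟩, fun h => by omega⟩) (by omega)
  have hbot := sum_ite_val_mul (N := n + 1) (c := 0) (P := (j : ℕ) = 0)
    (Q := fun k => (j : ℕ) = 0 ∧ (k : ℕ) = 0) (1 / 2) g (fun k => Iff.rfl) (by omega)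
  have htop := sum_ite_val_mul (N := n + 1) (c := n) (P := (j : ℕ) = n)
    (Q := fun k => (j : ℕ) = n ∧ (k : ℕ) = n) (1 / 2) g (fun k => Iff.rfl) (by omega)
  refine (congrArg₂ (· + ·) (congrArg₂ (· + ·) (congrArg₂ (· + ·) hup hdown) hbot) htop).trans ?_
  have := j.2
  split_ifs <;> first | omega | ring

lemma lazyPath_isIrreducibleMarkov (n : ℕ) : (lazyPath n).IsIrreducibleMarkov := by
  refine isIrreducibleMarkov_of_reversible (fun x y => by positivity) (fun x => ?_)
    (fun x y hxy => ?_) (fun x y hxy => ?_) (fun _ => by positivity) ?_ (fun x y => ?_)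
  · have hrow := sum_lazyPath_K_mul x fun _ => 1
    simp only [mul_one] at hrow
    refine hrow.trans ?_
    norm_num
  · simp only [if_pos hxy]
    positivity
  · simp only [if_pos hxy]
    positivity
  · simp only [Finset.sum_const, Finset.card_univ, Fintype.card_fin, nsmul_eq_mul]
    push_cast
    field_simp
  · congr 1
    simp only [and_comm]
    ring

end Path

section Lacoin

variable {n : ℕ} {a b : ℝ}

instance lacoinFintype : Fintype (lacoin n a b).X := inferInstanceAs (Fintype (Fin (2 * n + 1)))

lemma sum_lacoin_K_mul (hn : 1 ≤ n) (j : Fin (2 * n + 1)) (g : ℕ → ℝ) :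
    ∑ k : Fin (2 * n + 1), (lacoin n a b).K j k * g k
      = (if (j : ℕ) ≠ n ∧ (j : ℕ) ≠ 2 * n then (1 - a) * g (j + 1) else 0)
      + (if 0 < (j : ℕ) then a * g (j - 1) else 0)
      + (if (j : ℕ) = 0 then a * g 0 else 0)
      + (if (j : ℕ) = n then b * g (n + 1) else 0)
      + (if (j : ℕ) = n then (1 - a - b) * g (2 * n) else 0)
      + (if (j : ℕ) = 2 * n then lacoinC n a b * g n else 0)
      + (if (j : ℕ) = 2 * n then (1 - a - lacoinC n a b) * g (2 * n) else 0) := by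
  simp only [lacoin, add_mul, Finset.sum_add_distrib]
  refine congrArg₂ (· + ·) (congrArg₂ (· + ·) (congrArg₂ (· + ·) (congrArg₂ (· + ·)
    (congrArg₂ (· + ·) (congrArg₂ (· + ·) ?_ ?_) ?_) ?_) ?_) ?_) ?_
  · exact sum_ite_val_mul (N := 2 * n + 1) (1 - a) g (fun k => and_assoc.symm) (by omega)
  · exact sum_ite_val_mul (N := 2 * n + 1) a g
      (fun k => ⟨fun h => ⟨by omega, by omega⟩, fun h => by omega⟩) (by omega)
  all_goals exact sum_ite_val_mul (N := 2 * n + 1) _ g (fun k => Iff.rfl) (by omega)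

/-- The conditions `0 < a < b`, `a + b < 1 / 2` on the parameters of a Lacoin chain. -/
structure LacoinParams (a b : ℝ) : Prop where
  a_pos : 0 < a
  a_lt_b : a < b
  add_lt : a + b < 1 / 2

namespace LacoinParams

variable (h : LacoinParams a b)
include h

lemma b_pos : 0 < b := h.a_pos.trans h.a_lt_b

lemma a_lt_quarter : a < 1 / 4 := by linarith [h.a_lt_b, h.add_lt]

lemma one_sub_a_pos : 0 < 1 - a := by linarith [h.a_lt_quarter]

lemma one_sub_a_sub_b_pos : 0 < 1 - a - b := by linarith [h.add_lt]

lemma lacoinC_nonneg (n : ℕ) : 0 ≤ lacoinC n a b := by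
  have ha := h.a_pos
  have hb := h.b_pos
  have ha1 := h.one_sub_a_pos
  have hab1 := h.one_sub_a_sub_b_pos
  rw [lacoinC]
  positivity

lemma lacoinC_le (hn : 1 ≤ n) : lacoinC n a b ≤ 1 - a := by
  have ha := h.a_pos
  have hb := h.b_pos
  have ha1 := h.one_sub_a_pos
  have hab := h.a_lt_b
  rw [lacoinC, div_le_iff₀ (by positivity)]
  obtain ⟨m, rfl⟩ := Nat.exists_eq_add_of_le' hn
  rw [Nat.add_sub_cancel, pow_succ']
  have hpow : a ^ m ≤ (1 - a) ^ m := pow_le_pow_left₀ ha.le (by linarith [h.a_lt_quarter]) m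
  calc (1 - a - b) * (a * a ^ m) ≤ (1 - a) * (b * (1 - a) ^ m) := by
        gcongr
        linarith
    _ = _ := by ring

lemma lacoinWeight_pos (n j : ℕ) : 0 < lacoinWeight n a b j := by
  have ha := h.a_pos
  have hb := h.b_pos
  have ha1 := h.one_sub_a_pos
  rw [lacoinWeight]
  split_ifs <;> positivity

lemma lacoinWeight_succ {j : ℕ} (hj : j ≠ n) :
    lacoinWeight n a b (j + 1) * a = lacoinWeight n a b j * (1 - a) := by
  have ha := h.a_pos
  rw [lacoinWeight, lacoinWeight]
  rcases lt_or_gt_of_ne hj with hlt | hgt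
  · rw [if_pos (by omega), if_pos (by omega), pow_succ]
    field_simp
  · rw [if_neg (by omega), if_neg (by omega)]
    obtain ⟨i, rfl⟩ := Nat.exists_eq_add_of_lt hgt
    simp only [Nat.add_sub_cancel]
    field_simp
    ring

lemma lacoinWeight_succ_mid :
    lacoinWeight n a b (n + 1) * a = lacoinWeight n a b n * b := by
  have ha := h.a_pos
  rw [lacoinWeight, lacoinWeight, if_neg (by omega), if_pos le_rfl, Nat.add_sub_cancel, div_pow]
  field_simp
  ring

lemma lacoinWeight_last (hn : 1 ≤ n) :
    lacoinWeight n a b (2 * n) * lacoinC n a b = lacoinWeight n a b n * (1 - a - b) := by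
  have ha := h.a_pos
  have hb := h.b_pos
  have ha1 := h.one_sub_a_pos
  obtain ⟨m, rfl⟩ := Nat.exists_eq_add_of_le' hn
  rw [lacoinWeight, lacoinWeight, lacoinC, if_neg (by omega), if_pos le_rfl, div_pow,
    Nat.add_sub_cancel, show 2 * (m + 1) - 1 = m + (m + 1) by omega,
    show 2 * (m + 1) = (m + 1) + (m + 1) by omega, pow_add, pow_add]
  field_simp
  ring

omit h in
lemma lacoin_K_of_lt {j k : Fin (2 * n + 1)} (hjk : (j : ℕ) < k) :
    (lacoin n a b).K j k = (if (j : ℕ) ≠ n ∧ (k : ℕ) = j + 1 then 1 - a else 0)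
      + (if (j : ℕ) = n ∧ (k : ℕ) = n + 1 then b else 0)
      + (if (j : ℕ) = n ∧ (k : ℕ) = 2 * n then 1 - a - b else 0) := by
  have hup : (j : ℕ) ≠ n ∧ (j : ℕ) ≠ 2 * n ∧ (k : ℕ) = j + 1
      ↔ (j : ℕ) ≠ n ∧ (k : ℕ) = j + 1 := by omega
  simp only [lacoin, hup]
  rw [if_neg (show ¬ (j : ℕ) = k + 1 by omega),
    if_neg (show ¬ ((j : ℕ) = 0 ∧ (k : ℕ) = 0) by omega),
    if_neg (show ¬ ((j : ℕ) = 2 * n ∧ (k : ℕ) = n) by omega),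
    if_neg (show ¬ ((j : ℕ) = 2 * n ∧ (k : ℕ) = 2 * n) by omega)]
  ring

omit h in
lemma lacoin_K_of_gt {j k : Fin (2 * n + 1)} (hjk : (j : ℕ) < k) :
    (lacoin n a b).K k j = (if (j : ℕ) ≠ n ∧ (k : ℕ) = j + 1 then a else 0)
      + (if (j : ℕ) = n ∧ (k : ℕ) = n + 1 then a else 0)
      + (if (j : ℕ) = n ∧ (k : ℕ) = 2 * n then lacoinC n a b else 0) := by
  simp only [lacoin]
  rw [if_neg (show ¬ ((k : ℕ) ≠ n ∧ (k : ℕ) ≠ 2 * n ∧ (j : ℕ) = k + 1) by omega),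
    if_neg (show ¬ ((k : ℕ) = 0 ∧ (j : ℕ) = 0) by omega),
    if_neg (show ¬ ((k : ℕ) = n ∧ (j : ℕ) = n + 1) by omega),
    if_neg (show ¬ ((k : ℕ) = n ∧ (j : ℕ) = 2 * n) by omega),
    if_neg (show ¬ ((k : ℕ) = 2 * n ∧ (j : ℕ) = 2 * n) by omega)]
  simp only [and_comm (a := (k : ℕ) = 2 * n)]
  by_cases hj : (j : ℕ) = n <;> simp [hj]

lemma detailed_balance (hn : 1 ≤ n) (j k : Fin (2 * n + 1)) :
    lacoinWeight n a b j * (lacoin n a b).K j k = lacoinWeight n a b k * (lacoin n a b).K k j := by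
  wlog hjk : (j : ℕ) ≤ k generalizing j k
  · exact (this k j (by omega)).symm
  rcases hjk.eq_or_lt with hjk | hjk
  · obtain rfl := Fin.ext hjk
    rfl
  rw [lacoin_K_of_lt hjk, lacoin_K_of_gt hjk]
  simp only [mul_add, mul_ite, mul_zero]
  refine congrArg₂ (· + ·) (congrArg₂ (· + ·) ?_ ?_) ?_
  · split_ifs with hup
    · rw [hup.2, h.lacoinWeight_succ hup.1]
    · rfl
  · split_ifs with hmid
    · rw [hmid.2, hmid.1, h.lacoinWeight_succ_mid]
    · rfl
  · split_ifs with hlast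
    · rw [hlast.2, hlast.1, h.lacoinWeight_last hn]
    · rfl

lemma isIrreducibleMarkov (hn : 1 ≤ n) : (lacoin n a b).IsIrreducibleMarkov := by
  have ha := h.a_pos
  have hb := h.b_pos
  have ha1 := h.one_sub_a_pos
  have hab1 := h.one_sub_a_sub_b_pos
  have hc := h.lacoinC_nonneg n
  have hc1 : 0 ≤ 1 - a - lacoinC n a b := by linarith [h.lacoinC_le hn]
  have hW : 0 < ∑ i ∈ Finset.range (2 * n + 1), lacoinWeight n a b i :=
    Finset.sum_pos (fun j _ => h.lacoinWeight_pos n j) (by simp)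
  refine isIrreducibleMarkov_of_reversible (fun x y => by positivity) (fun x => ?_)
    (fun x y hxy => ?_) (fun x y hxy => ?_)
    (fun x => div_nonneg (h.lacoinWeight_pos n x).le hW.le) ?_ (fun x y => ?_)
  · have hrow := sum_lacoin_K_mul (a := a) (b := b) hn x fun _ => 1
    simp only [mul_one] at hrow
    refine hrow.trans ?_
    split_ifs <;> first | omega | ring
  · by_cases hx : (x : ℕ) = n
    · simp only [if_pos (show (x : ℕ) = n ∧ (y : ℕ) = n + 1 by omega)]
      positivity
    · simp only [if_pos (show (x : ℕ) ≠ n ∧ (x : ℕ) ≠ 2 * n ∧ (y : ℕ) = x + 1 by omega)]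
      positivity
  · simp only [if_pos hxy]
    positivity
  · rw [← Finset.sum_div, Fin.sum_univ_eq_sum_range (lacoinWeight n a b) (2 * n + 1),
      div_self hW.ne']
  · have hbalance := h.detailed_balance hn x y
    simp only [lacoin] at hbalance
    rw [div_mul_eq_mul_div, hbalance, div_mul_eq_mul_div]

end LacoinParams

end Lacoin

/-! ### Eigenfunctions, lumpings and the Ehrenfest chain -/

section Eigen

variable {C : Chain} [Fintype C.X] {f : C.X → ℝ} {c : ℝ}

lemma sum_pow_mul_eigenfunction (h : ∀ x, ∑ z, C.K x z * f z = c * f x) (m : ℕ) (x : C.X) :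
    ∑ z, C.pow m x z * f z = c ^ m * f x := by
  induction m generalizing x with
  | zero => classical simp [Chain.pow]
  | succ m ih =>
    calc ∑ z, C.pow (m + 1) x z * f z = ∑ y, C.K x y * ∑ z, C.pow m y z * f z := by
          simp only [Chain.pow_succ_apply, Finset.sum_mul, Finset.mul_sum, mul_assoc]
          exact Finset.sum_comm
      _ = c ^ m * ∑ y, C.K x y * f y := by
          simp only [ih, Finset.mul_sum, mul_left_comm]
      _ = c ^ (m + 1) * f x := by rw [h, pow_succ, mul_assoc]

lemma sum_H_mul_eigenfunction (h : ∀ x, ∑ z, C.K x z * f z = c * f x) (t : ℝ) (x : C.X) :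
    ∑ z, C.H t x z * f z = Real.exp (-t * (1 - c)) * f x := by
  have hsum := hasSum_sum fun y (_ : y ∈ Finset.univ) => (C.hasSum_H t x y).mul_right (f y)
  simp only [mul_assoc, ← Finset.mul_sum, sum_pow_mul_eigenfunction h] at hsum
  refine hsum.unique (((hasSum_poisson_geometric t c).mul_right (f x)).congr_fun fun m => ?_)
  rw [mul_assoc]

lemma sum_stat_mul_eigenfunction (hC : C.IsMarkov) (h : ∀ x, ∑ z, C.K x z * f z = c * f x)
    (hc : c ≠ 1) : ∑ y, C.stat y * f y = 0 := by
  have hinv : ∑ y, C.stat y * f y = c * ∑ y, C.stat y * f y := by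
    calc ∑ y, C.stat y * f y = ∑ y, (∑ z, C.stat z * C.K z y) * f y := by
          simp only [hC.sum_stat_mul_K]
      _ = ∑ z, C.stat z * ∑ y, C.K z y * f y := by
          simp only [Finset.sum_mul, Finset.mul_sum, mul_assoc]
          exact Finset.sum_comm
      _ = c * ∑ y, C.stat y * f y := by
          simp only [h, Finset.mul_sum, mul_left_comm]
  have hzero : (1 - c) * ∑ y, C.stat y * f y = 0 := by linarith
  exact (mul_eq_zero.1 hzero).resolve_left (sub_ne_zero.2 hc.symm)

lemma exp_mul_eigenfunction_le_tv (hC : C.IsMarkov) (h : ∀ x, ∑ z, C.K x z * f z = c * f x)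
    (hc : c ≠ 1) (hf : ∀ x, |f x| ≤ 1) (t : ℝ) (x : C.X) :
    Real.exp (-t * (1 - c)) * f x / 2 ≤ C.tv t x := by
  have hdiff : ∑ y, (C.H t x y - C.stat y) * f y = Real.exp (-t * (1 - c)) * f x := by
    simp only [sub_mul, Finset.sum_sub_distrib, sum_stat_mul_eigenfunction hC h hc,
      sum_H_mul_eigenfunction h, sub_zero]
  rw [← hdiff, Chain.tv, tvDist_eq_sum, div_eq_inv_mul, ← one_div]
  gcongr with y
  calc (C.H t x y - C.stat y) * f y ≤ |C.H t x y - C.stat y| * |f y| :=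
        (le_abs_self _).trans_eq (abs_mul _ _)
    _ ≤ |C.H t x y - C.stat y| := mul_le_of_le_one_right (abs_nonneg _) (hf y)

end Eigen

section Lumping

/-- The projection `φ` is a lumping (in the sense of Kemeny and Snell) of the chain `C` onto the
chain `D`. The condition on the transition matrices is stated in its integrated form. -/
structure IsLumping (C D : Chain) [Fintype C.X] [Fintype D.X] [DecidableEq D.X]
    (φ : C.X → D.X) : Prop where
  sum_K_mul : ∀ x (g : D.X → ℝ), ∑ y, C.K x y * g (φ y) = ∑ k, D.K (φ x) k * g k
  sum_stat : ∀ k, ∑ y with φ y = k, C.stat y = D.stat k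

namespace IsLumping

variable {C D : Chain} [Fintype C.X] [Fintype D.X] [DecidableEq D.X] {φ : C.X → D.X}
  (hφ : IsLumping C D φ)
include hφ

lemma sum_pow_mul (m : ℕ) (x : C.X) (g : D.X → ℝ) :
    ∑ y, C.pow m x y * g (φ y) = ∑ k, D.pow m (φ x) k * g k := by
  induction m generalizing x with
  | zero => classical simp [Chain.pow]
  | succ m ih =>
    calc ∑ y, C.pow (m + 1) x y * g (φ y)
        = ∑ z, C.K x z * ∑ y, C.pow m z y * g (φ y) := by
          simp only [Chain.pow_succ_apply, Finset.sum_mul, Finset.mul_sum, mul_assoc]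
          exact Finset.sum_comm
      _ = ∑ j, D.K (φ x) j * ∑ k, D.pow m j k * g k := by
          simp only [ih]
          exact hφ.sum_K_mul x fun j => ∑ k, D.pow m j k * g k
      _ = ∑ k, D.pow (m + 1) (φ x) k * g k := by
          simp only [Chain.pow_succ_apply, Finset.sum_mul, Finset.mul_sum, mul_assoc]
          exact Finset.sum_comm

lemma sum_H_mul (t : ℝ) (x : C.X) (g : D.X → ℝ) :
    ∑ y, C.H t x y * g (φ y) = ∑ k, D.H t (φ x) k * g k := by
  have hsum := hasSum_sum fun y (_ : y ∈ Finset.univ) => (C.hasSum_H t x y).mul_right (g (φ y))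
  have hlump := hasSum_sum fun k (_ : k ∈ Finset.univ) => (D.hasSum_H t (φ x) k).mul_right (g k)
  simp only [mul_assoc, ← Finset.mul_sum, hφ.sum_pow_mul] at hsum hlump
  exact hsum.unique hlump

lemma sum_H_fibre (t : ℝ) (x : C.X) (k : D.X) :
    ∑ y with φ y = k, C.H t x y = D.H t (φ x) k := by
  have hsum := hφ.sum_H_mul t x fun j => if j = k then 1 else 0
  simp only [mul_ite, mul_one, mul_zero] at hsum
  rw [Finset.sum_filter, hsum]
  simp

lemma aff_le (hC : C.IsMarkov) {t : ℝ} (ht : 0 ≤ t) (x : C.X) : C.aff t x ≤ D.aff t (φ x) := by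
  rw [Chain.aff, Chain.aff, affinity_eq_sum, affinity_eq_sum,
    ← Finset.sum_fiberwise Finset.univ φ]
  refine Finset.sum_le_sum fun k _ => ?_
  rw [← hφ.sum_H_fibre, ← hφ.sum_stat]
  exact Real.sum_sqrt_mul_sqrt_le _ (hC.H_nonneg ht x) hC.stat_nonneg

lemma aff_eq {t : ℝ} {x : C.X} (hH : ∀ y z, φ y = φ z → C.H t x y = C.H t x z)
    (hstat : ∀ y z, φ y = φ z → C.stat y = C.stat z) : D.aff t (φ x) = C.aff t x := by
  rw [Chain.aff, Chain.aff, affinity_eq_sum, affinity_eq_sum,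
    ← Finset.sum_fiberwise Finset.univ φ]
  refine Finset.sum_congr rfl fun k _ => ?_
  rw [← hφ.sum_H_fibre, ← hφ.sum_stat]
  rcases (Finset.univ.filter fun y => φ y = k).eq_empty_or_nonempty with hempty | ⟨z, hz⟩
  · simp [hempty]
  · have hfibre : ∀ y ∈ Finset.univ.filter (fun y => φ y = k), φ y = φ z := fun y hy =>
      (Finset.mem_filter.1 hy).2.trans (Finset.mem_filter.1 hz).2.symm
    rw [Finset.sum_congr rfl fun y hy => hH y z (hfibre y hy),
      Finset.sum_congr rfl fun y hy => hstat y z (hfibre y hy),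
      Finset.sum_congr rfl fun y hy => congrArg₂ (√· * √·) (hH y z (hfibre y hy))
        (hstat y z (hfibre y hy))]
    simp only [Finset.sum_const, nsmul_eq_mul]
    rw [Real.sqrt_mul (Nat.cast_nonneg _), Real.sqrt_mul (Nat.cast_nonneg _), mul_mul_mul_comm,
      Real.mul_self_sqrt (Nat.cast_nonneg _)]

end IsLumping

end Lumping

section Flip

/-- The chain on two points that changes its state at every step; products of it are random walks
on hypercubes. -/
def flipChain : Chain where
  X := Bool
  K := fun x y => if x = y then 0 else 1
  stat := fun _ => 1 / 2

instance flipChainFintype : Fintype flipChain.X := inferInstanceAs (Fintype Bool)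

lemma sum_flipChain_K_mul (x : Bool) (g : Bool → ℝ) :
    ∑ z : flipChain.X, flipChain.K x z * g z = g (!x) := by
  change ∑ z : Bool, (if x = z then 0 else 1) * g z = g (!x)
  cases x <;> simp

lemma H_flipChain (t : ℝ) (x y : Bool) :
    flipChain.H t x y = (1 + (if x = y then 1 else -1) * Real.exp (-2 * t)) / 2 := by
  have hone := sum_H_mul_eigenfunction (C := flipChain) (f := fun _ => 1) (c := 1)
    (fun x => (sum_flipChain_K_mul x fun _ => 1).trans (one_mul 1).symm) t x
  have hsign := sum_H_mul_eigenfunction (C := flipChain)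
    (f := fun z : Bool => if z = y then 1 else -1) (c := -1) (fun (x : Bool) =>
      (sum_flipChain_K_mul x _).trans (by cases x <;> cases y <;> norm_num)) t x
  replace hone := (Fintype.sum_bool _).symm.trans hone
  replace hsign := (Fintype.sum_bool _).symm.trans hsign
  rw [show -t * (1 - -1) = -2 * t by ring] at hsign
  rw [sub_self, mul_zero, Real.exp_zero] at hone
  cases y <;> simp only [if_true, Bool.false_eq_true, Bool.true_eq_false, if_false, mul_one,
    mul_neg] at hone hsign ⊢ <;> linarith

lemma isMarkov_flipChain : flipChain.IsMarkov where
  K_nonneg := fun (x y : Bool) => by simp only [flipChain]; split_ifs <;> norm_num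
  K_sum := fun (x : Bool) => by
    have hrow := sum_flipChain_K_mul x fun _ => 1
    simp only [mul_one] at hrow
    rw [← hrow]
    exact hasSum_fintype _
  stat_nonneg := fun _ => one_half_pos.le
  stat_sum := by
    have hstat : ∑ _x : Bool, (1 / 2 : ℝ) = 1 := by norm_num
    rw [← hstat]
    exact hasSum_fintype _
  stationary := fun (y : Bool) => by
    have hcol : ∑ x : Bool, (1 / 2 : ℝ) * (if x = y then 0 else 1) = flipChain.stat y := by
      cases y <;> simp [flipChain]
    rw [← hcol]
    exact hasSum_fintype _

/-- The Hellinger affinity at time `t` of the two-point chain `flipChain`, from any state. -/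
def flipAff (t : ℝ) : ℝ :=
  √((1 + Real.exp (-2 * t)) / 2) * √(1 / 2) + √((1 - Real.exp (-2 * t)) / 2) * √(1 / 2)

lemma aff_flipChain (t : ℝ) (x : Bool) : flipChain.aff t x = flipAff t := by
  have hsum : flipChain.aff t x = ∑ y : Bool, √(flipChain.H t x y) * √(1 / 2) :=
    affinity_eq_sum _ _
  rw [hsum, Fintype.sum_bool, H_flipChain, H_flipChain, flipAff]
  cases x <;> simp [← sub_eq_add_neg, add_comm]

lemma flipAff_nonneg (t : ℝ) : 0 ≤ flipAff t := by rw [flipAff]; positivity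

lemma flipAff_sq {t : ℝ} (ht : 0 ≤ t) :
    flipAff t ^ 2 = (1 + √(1 - Real.exp (-4 * t))) / 2 := by
  have hexp_le : Real.exp (-2 * t) ≤ 1 := Real.exp_le_one_iff.2 (by linarith)
  have hexp_pos := Real.exp_pos (-2 * t)
  have hexp_sq : Real.exp (-4 * t) = Real.exp (-2 * t) ^ 2 := by
    rw [← Real.exp_nat_mul]
    congr 1
    push_cast
    ring
  have hprod : (1 + Real.exp (-2 * t)) / 2 * ((1 - Real.exp (-2 * t)) / 2)
      = (1 - Real.exp (-2 * t) ^ 2) / 2 ^ 2 := by ring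
  rw [flipAff, hexp_sq, ← add_mul, mul_pow, Real.sq_sqrt (by norm_num), add_sq,
    Real.sq_sqrt (by linarith), Real.sq_sqrt (by linarith), mul_assoc,
    ← Real.sqrt_mul (by linarith), hprod, Real.sqrt_div' _ (by norm_num),
    Real.sqrt_sq (by norm_num)]
  ring

lemma le_flipAff_sq {t : ℝ} (ht : 0 ≤ t) : 1 - Real.exp (-4 * t) / 2 ≤ flipAff t ^ 2 := by
  have hexp_le : Real.exp (-4 * t) ≤ 1 := Real.exp_le_one_iff.2 (by linarith)
  have hexp_pos := Real.exp_pos (-4 * t)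
  have hsqrt : 1 - Real.exp (-4 * t) ≤ √(1 - Real.exp (-4 * t)) :=
    Real.le_sqrt_of_sq_le (by nlinarith)
  rw [flipAff_sq ht]
  linarith

lemma flipAff_sq_le {t : ℝ} (ht : 0 ≤ t) : flipAff t ^ 2 ≤ 1 - Real.exp (-4 * t) / 4 := by
  have hexp_le : Real.exp (-4 * t) ≤ 1 := Real.exp_le_one_iff.2 (by linarith)
  have hsqrt : √(1 - Real.exp (-4 * t)) ≤ 1 - Real.exp (-4 * t) / 2 :=
    Real.sqrt_le_iff.2 ⟨by linarith, by nlinarith [sq_nonneg (Real.exp (-4 * t))]⟩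
  rw [flipAff_sq ht]
  linarith

end Flip

section Cube

variable {n : ℕ}

/-- Random walk on the hypercube, which lumps to the Ehrenfest chain. -/
def cube (n : ℕ) : Chain := prodChain (fun _ : Fin n => flipChain) fun _ => 1 / (n : ℝ)

instance cubeFintype : Fintype (cube n).X := inferInstanceAs (Fintype (Fin n → Bool))

instance ehrenfestDecidableEq : DecidableEq (ehrenfest n).X :=
  inferInstanceAs (DecidableEq (Fin (n + 1)))

/-- The number of coordinates equal to `true`: the projection of the hypercube onto the state space
of the Ehrenfest chain. -/
def countTrue (x : Fin n → Bool) : Fin (n + 1) :=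
  ⟨(Finset.univ.filter fun i => x i = true).card,
    Nat.lt_succ_of_le ((Finset.card_le_univ _).trans_eq (Fintype.card_fin n))⟩

lemma countTrue_update_of_true {x : Fin n → Bool} {i : Fin n} (hi : x i = true) :
    (countTrue (Function.update x i false) : ℕ) = countTrue x - 1 := by
  have herase : (Finset.univ.filter fun j => Function.update x i false j = true)
      = (Finset.univ.filter fun j => x j = true).erase i := by
    ext j
    rcases eq_or_ne j i with rfl | hj <;> simp [*]
  simp only [countTrue, herase]
  exact Finset.card_erase_of_mem (by simp [hi])

lemma countTrue_update_of_false {x : Fin n → Bool} {i : Fin n} (hi : x i = false) :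
    (countTrue (Function.update x i true) : ℕ) = countTrue x + 1 := by
  have hinsert : (Finset.univ.filter fun j => Function.update x i true j = true)
      = insert i (Finset.univ.filter fun j => x j = true) := by
    ext j
    rcases eq_or_ne j i with rfl | hj <;> simp [*]
  simp only [countTrue, hinsert]
  exact Finset.card_insert_of_notMem (by simp [hi])

lemma card_filter_eq_true (x : Fin n → Bool) :
    (Finset.univ.filter fun i => x i = true).card = (countTrue x : ℕ) := rfl

lemma card_filter_not_eq_true (x : Fin n → Bool) :
    (Finset.univ.filter fun i => ¬ x i = true).card = n - (countTrue x : ℕ) := by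
  have hcard := Finset.card_filter_add_card_filter_not (s := (Finset.univ : Finset (Fin n)))
    (fun i => x i = true)
  rw [Finset.card_univ, Fintype.card_fin, card_filter_eq_true] at hcard
  omega

lemma sum_cube_K_mul (x : Fin n → Bool) (g : ℕ → ℝ) :
    ∑ y : (cube n).X, (cube n).K x y * g (countTrue y)
      = ∑ k : Fin (n + 1), (ehrenfest n).K (countTrue x) k * g k := by
  have hflip : ∀ i, ∑ z : flipChain.X, flipChain.K (x i) z * g (countTrue (Function.update x i z))
      = if x i = true then g (countTrue x - 1) else g (countTrue x + 1) := by
    intro i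
    rw [sum_flipChain_K_mul (x i) fun z => g (countTrue (Function.update x i z))]
    cases hi : x i
    · rw [if_neg (by simp), Bool.not_false, countTrue_update_of_false hi]
    · rw [if_pos rfl, Bool.not_true, countTrue_update_of_true hi]
  refine ((sum_prodChain_K_mul (C := fun _ : Fin n => flipChain) (w := fun _ => 1 / (n : ℝ)) x
    fun y => g (countTrue y)).trans (Finset.sum_congr rfl
      fun i _ => congrArg (1 / (n : ℝ) * ·) (hflip i))).trans ?_
  rw [sum_ehrenfest_K_mul, ← Finset.mul_sum, Finset.sum_ite, Finset.sum_const, Finset.sum_const,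
    card_filter_eq_true, card_filter_not_eq_true, nsmul_eq_mul, nsmul_eq_mul,
    Nat.cast_sub (Nat.lt_succ_iff.1 (countTrue x).2)]
  ring

lemma card_filter_countTrue_eq (k : Fin (n + 1)) :
    (Finset.univ.filter fun y : Fin n → Bool => countTrue y = k).card = n.choose k := by
  have hcard := Finset.card_powersetCard k (Finset.univ : Finset (Fin n))
  rw [Finset.card_univ, Fintype.card_fin] at hcard
  rw [← hcard]
  refine Finset.card_bij' (fun y _ => Finset.univ.filter fun i => y i = true)
    (fun s _ i => decide (i ∈ s)) ?_ ?_ ?_ ?_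
  · intro y hy
    rw [Finset.mem_powersetCard]
    exact ⟨Finset.subset_univ _, Fin.ext_iff.1 (Finset.mem_filter.1 hy).2⟩
  · intro s hs
    rw [Finset.mem_powersetCard] at hs
    simp only [Finset.mem_filter, Finset.mem_univ, true_and, Fin.ext_iff, countTrue,
      decide_eq_true_eq, Finset.filter_univ_mem, hs.2]
  · intro y _
    funext i
    simp
  · intro s _
    simp

lemma surjective_countTrue : Function.Surjective (countTrue : (Fin n → Bool) → Fin (n + 1)) := by
  intro k
  have hpos : 0 < (Finset.univ.filter fun y : Fin n → Bool => countTrue y = k).card := by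
    rw [card_filter_countTrue_eq]
    exact Nat.choose_pos (Nat.lt_succ_iff.1 k.2)
  obtain ⟨x, hx⟩ := Finset.card_pos.1 hpos
  exact ⟨x, (Finset.mem_filter.1 hx).2⟩

lemma stat_cube (y : (cube n).X) : (cube n).stat y = 1 / 2 ^ n := by
  change ∏ _i : Fin n, (1 / 2 : ℝ) = _
  rw [Finset.prod_const, Finset.card_univ, Fintype.card_fin, div_pow, one_pow]

lemma isLumping_countTrue : IsLumping (cube n) (ehrenfest n) countTrue where
  sum_K_mul x g := by
    have hsum := sum_cube_K_mul x fun j => g (Fin.ofNat (n + 1) j)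
    have hg : ∀ k : Fin (n + 1), g (Fin.ofNat (n + 1) k) = g k := fun k => by
      rw [Fin.ofNat_eq_cast, Fin.cast_val_eq_self]
    simp only [hg] at hsum
    exact hsum
  sum_stat k := by
    simp only [stat_cube]
    rw [Finset.sum_const, nsmul_eq_mul, mul_one_div]
    exact congrArg (fun m : ℕ => (m : ℝ) / 2 ^ n) (card_filter_countTrue_eq k)

variable (hn : 1 ≤ n)
include hn

lemma sum_one_div_card : ∑ _i : Fin n, 1 / (n : ℝ) = 1 := by
  have : (n : ℝ) ≠ 0 := by positivity
  simp [this]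

lemma isMarkov_cube : (cube n).IsMarkov :=
  isMarkov_prodChain (fun _ => isMarkov_flipChain) (fun _ => by positivity) (sum_one_div_card hn)

lemma aff_cube {t : ℝ} (ht : 0 ≤ t) (x : (cube n).X) :
    (cube n).aff t x = flipAff (t / n) ^ n := by
  refine (aff_prodChain (C := fun _ : Fin n => flipChain) (fun _ => isMarkov_flipChain)
    (fun _ => by positivity) (sum_one_div_card hn) ht x).trans
      ((Finset.prod_congr rfl fun i _ => aff_flipChain (1 / (n : ℝ) * t) (x i)).trans ?_)
  rw [Finset.prod_const, Finset.card_univ, Fintype.card_fin, one_div_mul_eq_div]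

lemma H_cube_false (t : ℝ) (y : Fin n → Bool) :
    (cube n).H t (fun _ => false) y = (flipChain.H (t / n) false true) ^ (countTrue y : ℕ)
      * (flipChain.H (t / n) false false) ^ (n - (countTrue y : ℕ)) := by
  have hcoord : ∀ i, flipChain.H (1 / (n : ℝ) * t) false (y i)
      = if y i = true then flipChain.H (t / n) false true
        else flipChain.H (t / n) false false := by
    intro i
    rw [one_div_mul_eq_div]
    cases y i <;> simp
  refine (H_prodChain (C := fun _ : Fin n => flipChain) (sum_one_div_card hn) t _ y).trans
    ((Finset.prod_congr rfl fun i _ => hcoord i).trans ?_)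
  rw [Finset.prod_ite, Finset.prod_const, Finset.prod_const, card_filter_eq_true,
    card_filter_not_eq_true]

variable {t : ℝ} (ht : 0 ≤ t)
include ht

lemma minAff_ehrenfest : (ehrenfest n).minAff t = flipAff (t / n) ^ n := by
  apply le_antisymm
  · have hfibre : (ehrenfest n).aff t (countTrue fun _ : Fin n => false)
        = (cube n).aff t fun _ => false := by
      refine isLumping_countTrue.aff_eq (fun y z hyz => ?_)
        fun y z _ => (stat_cube y).trans (stat_cube z).symm
      refine (H_cube_false hn t y).trans (Eq.trans ?_ (H_cube_false hn t z).symm)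
      rw [hyz]
    exact ((ehrenfest n).minAff_le_aff t _).trans_eq (hfibre.trans (aff_cube hn ht _))
  · refine (ehrenfest_isIrreducibleMarkov hn).isMarkov.le_minAff fun j => ?_
    obtain ⟨x, rfl⟩ := surjective_countTrue j
    exact (aff_cube hn ht x).symm.trans_le
      (isLumping_countTrue.aff_le (isMarkov_cube hn) ht x)

lemma le_minAff_ehrenfest : 1 - n * Real.exp (-4 * (t / n)) ≤ (ehrenfest n).minAff t := by
  have ht' : 0 ≤ t / n := by positivity
  have hexp_le : Real.exp (-4 * (t / n)) ≤ 1 := Real.exp_le_one_iff.2 (by linarith)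
  have hexp_pos := Real.exp_pos (-4 * (t / n))
  have hflip : 1 + -Real.exp (-4 * (t / n)) ≤ flipAff (t / n) := by
    nlinarith [flipAff_nonneg (t / n), le_flipAff_sq ht']
  calc 1 - n * Real.exp (-4 * (t / n)) = 1 + n * -Real.exp (-4 * (t / n)) := by ring
    _ ≤ (1 + -Real.exp (-4 * (t / n))) ^ n := one_add_mul_le_pow (by linarith) n
    _ ≤ flipAff (t / n) ^ n := pow_le_pow_left₀ (by linarith) hflip n
    _ = (ehrenfest n).minAff t := (minAff_ehrenfest hn ht).symm

lemma minAff_ehrenfest_sq_le :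
    (ehrenfest n).minAff t ^ 2 ≤ Real.exp (-(n * Real.exp (-4 * (t / n)) / 4)) := by
  rw [minAff_ehrenfest hn ht, ← pow_mul, mul_comm n 2, pow_mul,
    show -(n * Real.exp (-4 * (t / n)) / 4) = n * (-(Real.exp (-4 * (t / n)) / 4)) by ring,
    Real.exp_nat_mul]
  refine pow_le_pow_left₀ (sq_nonneg _) ?_ n
  linarith [flipAff_sq_le (show 0 ≤ t / n by positivity),
    Real.add_one_le_exp (-(Real.exp (-4 * (t / n)) / 4))]

end Cube

/-! ### The lazy path -/

section Path

variable {n : ℕ}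

/-- The angles `kπ/(n+1)`, whose cosines are the eigenvalues of the path. -/
def pathAngle (n k : ℕ) : ℝ := k * Real.pi / (n + 1)

/-- The eigenfunctions of the path. -/
def pathCos (n k : ℕ) (x : ℕ) : ℝ := Real.cos (pathAngle n k * (x + 1 / 2))

lemma pathAngle_mul (n k : ℕ) : pathAngle n k * (n + 1) = k * Real.pi := by
  rw [pathAngle]
  field_simp

lemma pathAngle_nonneg (n k : ℕ) : 0 ≤ pathAngle n k := by
  rw [pathAngle]
  positivity

lemma pathAngle_le_pi {k : ℕ} (hk : k ≤ n + 1) : pathAngle n k ≤ Real.pi := by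
  rw [pathAngle, div_le_iff₀ (by positivity), mul_comm]
  gcongr
  exact_mod_cast hk

lemma abs_pathCos_le_one (n k x : ℕ) : |pathCos n k x| ≤ 1 := Real.abs_cos_le_one _

lemma sum_lazyPath_K_mul_pathCos (k : ℕ) (x : Fin (n + 1)) :
    ∑ z : Fin (n + 1), (lazyPath n).K x z * pathCos n k z
      = Real.cos (pathAngle n k) * pathCos n k x := by
  rw [sum_lazyPath_K_mul]
  set θ := pathAngle n k with hθ
  have hup : (if (x : ℕ) < n then pathCos n k (x + 1) else pathCos n k n)
      = Real.cos (θ * ((x : ℕ) + 1 / 2) + θ) := by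
    split_ifs with hx
    · rw [pathCos]
      congr 1
      push_cast
      ring
    · rw [show (x : ℕ) = n by omega, pathCos, ← hθ,
        show θ * ((n : ℝ) + 1 / 2) = θ * (n + 1) - θ / 2 by ring,
        show θ * (n + 1) - θ / 2 + θ = θ * (n + 1) + θ / 2 by ring, pathAngle_mul, Real.cos_sub,
        Real.cos_add, Real.sin_nat_mul_pi]
      ring
  have hdown : (if 0 < (x : ℕ) then pathCos n k (x - 1) else pathCos n k 0)
      = Real.cos (θ * ((x : ℕ) + 1 / 2) - θ) := by
    split_ifs with hx
    · rw [pathCos, Nat.cast_sub hx]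
      congr 1
      push_cast
      ring
    · rw [show (x : ℕ) = 0 by omega, pathCos, ← hθ, ← Real.cos_neg]
      congr 1
      push_cast
      ring
  rw [hup, hdown, pathCos, ← hθ, Real.cos_add, Real.cos_sub]
  ring

lemma two_mul_sin_mul_sum_cos (φ : ℝ) (N : ℕ) :
    2 * Real.sin φ * ∑ k ∈ Finset.range N, Real.cos (2 * (k + 1) * φ)
      = Real.sin ((2 * N + 1) * φ) - Real.sin φ := by
  induction N with
  | zero => simp
  | succ N ih =>
    rw [Finset.sum_range_succ, mul_add, ih,
      show (2 * ((N + 1 : ℕ) : ℝ) + 1) * φ = 2 * (N + 1) * φ + φ by push_cast; ring,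
      show (2 * (N : ℝ) + 1) * φ = 2 * (N + 1) * φ - φ by ring, Real.sin_add, Real.sin_sub]
    ring

lemma sum_cos_pathAngle {m : ℕ} (hm0 : 0 < m) (hm : m < 2 * (n + 1)) :
    ∑ k ∈ Finset.range n, Real.cos (pathAngle n (k + 1) * m) = -((-1) ^ m + 1) / 2 := by
  set φ : ℝ := m * Real.pi / (2 * (n + 1)) with hφ
  have hφ0 : 0 < φ := by positivity
  have hφπ : φ < Real.pi := by
    rw [hφ, div_lt_iff₀ (by positivity), mul_comm]
    gcongr
    exact_mod_cast hm
  have hsin := Real.sin_pos_of_pos_of_lt_pi hφ0 hφπ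
  have hangle : ∀ k : ℕ, pathAngle n (k + 1) * m = 2 * (k + 1) * φ := fun k => by
    rw [pathAngle, hφ]
    push_cast
    field_simp
  have htelescope := two_mul_sin_mul_sum_cos φ n
  have hlast : (2 * (n : ℝ) + 1) * φ = m * Real.pi - φ := by
    rw [hφ]
    field_simp
    ring
  rw [hlast, Real.sin_sub, Real.sin_nat_mul_pi, Real.cos_nat_mul_pi] at htelescope
  simp only [hangle]
  refine mul_left_cancel₀ (mul_pos two_pos hsin).ne' ?_
  linear_combination htelescope

lemma pathCos_mul_pathCos (k x d : ℕ) :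
    pathCos n k x * pathCos n k (x + d) = (Real.cos (pathAngle n k * d)
      + Real.cos (pathAngle n k * ((2 * x + d + 1 : ℕ) : ℝ))) / 2 := by
  set θ := pathAngle n k with hθ
  have hsub : θ * (d : ℝ) = θ * ((x + d : ℕ) + 1 / 2) - θ * (x + 1 / 2) := by push_cast; ring
  have hadd : θ * ((2 * x + d + 1 : ℕ) : ℝ) = θ * ((x + d : ℕ) + 1 / 2) + θ * (x + 1 / 2) := by
    push_cast
    ring
  rw [hsub, hadd, Real.cos_add, Real.cos_sub, pathCos, pathCos, ← hθ]
  ring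

lemma sum_pathCos_mul_pathCos (x y : Fin (n + 1)) :
    1 / ((n : ℝ) + 1) * (1 + 2 * ∑ k ∈ Finset.range n, pathCos n (k + 1) x * pathCos n (k + 1) y)
      = if x = y then 1 else 0 := by
  wlog hxy : (x : ℕ) ≤ y generalizing x y
  · simp only [mul_comm (pathCos n _ x), eq_comm (a := x)]
    exact this y x (by omega)
  obtain ⟨d, hd⟩ := Nat.exists_eq_add_of_le hxy
  simp only [hd, pathCos_mul_pathCos, Fin.ext_iff]
  rw [← Finset.sum_div, Finset.sum_add_distrib,
    sum_cos_pathAngle (m := 2 * x + d + 1) (by omega) (by omega), add_assoc, pow_add, pow_mul,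
    neg_one_sq, one_pow, one_mul, pow_succ]
  rcases Nat.eq_zero_or_pos d with rfl | hd0
  · simp only [Nat.cast_zero, mul_zero, Real.cos_zero, Finset.sum_const, Finset.card_range,
      nsmul_eq_mul, pow_zero, add_zero, if_true]
    field_simp
    ring
  · rw [if_neg (by omega), sum_cos_pathAngle hd0 (by omega)]
    ring

lemma eq_sum_pathCos (g : Fin (n + 1) → ℝ) (y : Fin (n + 1)) :
    g y = 1 / ((n : ℝ) + 1) * (∑ z, g z + 2 * ∑ k ∈ Finset.range n,
      (∑ z, g z * pathCos n (k + 1) z) * pathCos n (k + 1) y) := by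
  calc g y = ∑ z, g z * (if z = y then 1 else 0) := by simp
    _ = ∑ z, 1 / ((n : ℝ) + 1) * (g z + 2 * ∑ k ∈ Finset.range n,
        g z * pathCos n (k + 1) z * pathCos n (k + 1) y) := by
        refine Finset.sum_congr rfl fun z _ => ?_
        rw [← sum_pathCos_mul_pathCos, mul_left_comm, mul_add, mul_one, mul_left_comm _ (2 : ℝ),
          Finset.mul_sum]
        simp only [mul_assoc]
    _ = _ := by
        rw [← Finset.mul_sum, Finset.sum_add_distrib, ← Finset.mul_sum, Finset.sum_comm]
        simp only [← Finset.sum_mul]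

lemma H_lazyPath {t : ℝ} (ht : 0 ≤ t) (x y : Fin (n + 1)) :
    (lazyPath n).H t x y = 1 / ((n : ℝ) + 1) * (1 + 2 * ∑ k ∈ Finset.range n,
      Real.exp (-t * (1 - Real.cos (pathAngle n (k + 1)))) *
        (pathCos n (k + 1) x * pathCos n (k + 1) y)) := by
  have hrow : ∑ z : Fin (n + 1), (lazyPath n).H t x z = 1 :=
    ((lazyPath_isIrreducibleMarkov n).isMarkov.H_mem_stdSimplex ht x).2
  have heigen : ∀ k, ∑ z : Fin (n + 1), (lazyPath n).H t x z * pathCos n k z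
      = Real.exp (-t * (1 - Real.cos (pathAngle n k))) * pathCos n k x := fun k =>
    sum_H_mul_eigenfunction (C := lazyPath n) (f := fun z : Fin (n + 1) => pathCos n k z)
      (sum_lazyPath_K_mul_pathCos k) t x
  have hexpand := eq_sum_pathCos ((lazyPath n).H t x) y
  rw [hrow] at hexpand
  simp only [heigen, mul_assoc] at hexpand
  exact hexpand

lemma le_one_sub_cos_pathAngle {k : ℕ} (hk : k < n) :
    (k + 1) * (2 / ((n : ℝ) + 1) ^ 2) ≤ 1 - Real.cos (pathAngle n (k + 1)) := by
  have hθ0 := pathAngle_nonneg n (k + 1)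
  have hcos := Real.cos_le_one_sub_mul_cos_sq
    (abs_le.2 ⟨by linarith [Real.pi_pos], pathAngle_le_pi (show k + 1 ≤ n + 1 by omega)⟩)
  have hsq : 2 / Real.pi ^ 2 * pathAngle n (k + 1) ^ 2
      = ((k : ℝ) + 1) ^ 2 * (2 / ((n : ℝ) + 1) ^ 2) := by
    rw [pathAngle]
    push_cast
    field_simp
  have hle : ((k : ℝ) + 1) * (2 / ((n : ℝ) + 1) ^ 2)
      ≤ ((k : ℝ) + 1) ^ 2 * (2 / ((n : ℝ) + 1) ^ 2) := by
    gcongr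
    exact le_self_pow₀ (by linarith [Nat.cast_nonneg (α := ℝ) k]) two_ne_zero
  linarith

lemma sum_exp_neg_mul_le {z : ℝ} (hz : 0 < z) (n : ℕ) :
    ∑ k ∈ Finset.range n, Real.exp (-((k + 1) * z)) ≤ 1 / z := by
  set q := Real.exp (-z) with hq
  have hq0 : 0 < q := Real.exp_pos _
  have hq_mul : q * (1 + z) ≤ 1 := by
    calc q * (1 + z) ≤ q * Real.exp z := by
          gcongr
          linarith [Real.add_one_le_exp z]
      _ = 1 := by rw [hq, ← Real.exp_add, neg_add_cancel, Real.exp_zero]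
  have hterm : ∀ k : ℕ, Real.exp (-((k + 1) * z)) = q * q ^ k := fun k => by
    rw [hq, ← Real.exp_nat_mul, ← Real.exp_add]
    congr 1
    ring
  have hsum : 0 ≤ ∑ i ∈ Finset.range n, q ^ i := by positivity
  simp only [hterm]
  rw [← Finset.mul_sum, le_div_iff₀ hz]
  calc q * (∑ i ∈ Finset.range n, q ^ i) * z = q * z * ∑ i ∈ Finset.range n, q ^ i := by ring
    _ ≤ (1 - q) * ∑ i ∈ Finset.range n, q ^ i := by
        gcongr
        linarith
    _ = 1 - q ^ n := mul_neg_geom_sum q n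
    _ ≤ 1 := sub_le_self _ (by positivity)

lemma abs_H_lazyPath_sub_stat_le {t : ℝ} (ht : 0 < t) (x y : Fin (n + 1)) :
    |(lazyPath n).H t x y - 1 / ((n : ℝ) + 1)| ≤ ((n : ℝ) + 1) / t := by
  set z : ℝ := 2 * t / ((n : ℝ) + 1) ^ 2 with hz
  calc |(lazyPath n).H t x y - 1 / ((n : ℝ) + 1)|
      = 2 / ((n : ℝ) + 1) * |∑ k ∈ Finset.range n,
        Real.exp (-t * (1 - Real.cos (pathAngle n (k + 1)))) *
          (pathCos n (k + 1) x * pathCos n (k + 1) y)| := by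
        rw [H_lazyPath ht.le, mul_add, mul_one, add_sub_cancel_left, ← mul_assoc,
          one_div_mul_eq_div, abs_mul, abs_of_nonneg (by positivity)]
    _ ≤ 2 / ((n : ℝ) + 1) * ∑ k ∈ Finset.range n, Real.exp (-((k + 1) * z)) := by
        gcongr
        refine (Finset.abs_sum_le_sum_abs _ _).trans (Finset.sum_le_sum fun k hk => ?_)
        rw [abs_mul, abs_mul, abs_of_pos (Real.exp_pos _)]
        refine (mul_le_of_le_one_right (Real.exp_pos _).le (mul_le_one₀
          (abs_pathCos_le_one _ _ _) (abs_nonneg _) (abs_pathCos_le_one _ _ _))).trans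
            (Real.exp_le_exp.2 ?_)
        rw [neg_mul, neg_le_neg_iff]
        calc (k + 1) * z = t * ((k + 1) * (2 / ((n : ℝ) + 1) ^ 2)) := by rw [hz]; ring
          _ ≤ _ := by
            gcongr
            exact le_one_sub_cos_pathAngle (Finset.mem_range.1 hk)
    _ ≤ 2 / ((n : ℝ) + 1) * (1 / z) := by
        gcongr
        exact sum_exp_neg_mul_le (by positivity) n
    _ = ((n : ℝ) + 1) / t := by
        rw [hz]
        field_simp

lemma tv_lazyPath_le {t : ℝ} (ht : 0 < t) (x : (lazyPath n).X) :
    (lazyPath n).tv t x ≤ ((n : ℝ) + 1) ^ 2 / (2 * t) := by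
  rw [Chain.tv, tvDist_eq_sum]
  calc 1 / 2 * ∑ y, |(lazyPath n).H t x y - (lazyPath n).stat y|
      ≤ 1 / 2 * ∑ _y : Fin (n + 1), ((n : ℝ) + 1) / t := by
        gcongr
        exact Finset.sum_le_sum fun y _ => abs_H_lazyPath_sub_stat_le ht x y
    _ = ((n : ℝ) + 1) ^ 2 / (2 * t) := by
        rw [Finset.sum_const, Finset.card_univ, Fintype.card_fin, nsmul_eq_mul]
        push_cast
        field_simp

lemma pathAngle_one_sq_le (n : ℕ) : pathAngle n 1 ^ 2 ≤ 10 / ((n : ℝ) + 1) ^ 2 := by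
  rw [pathAngle, Nat.cast_one, one_mul, div_pow]
  gcongr
  nlinarith [Real.pi_lt_d2, Real.pi_pos]

lemma one_half_le_pathCos_one_zero (hn : 1 ≤ n) : 1 / 2 ≤ pathCos n 1 0 := by
  have hn' : (2 : ℝ) ≤ n + 1 := by exact_mod_cast Nat.succ_le_succ hn
  have hcos := Real.one_sub_sq_div_two_le_cos (x := pathAngle n 1 * ((0 : ℕ) + 1 / 2))
  have hsq : pathAngle n 1 ^ 2 ≤ 10 / 2 ^ 2 := (pathAngle_one_sq_le n).trans (by gcongr)
  refine le_trans ?_ hcos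
  push_cast
  linarith

lemma exists_le_tv_lazyPath (hn : 1 ≤ n) {t : ℝ} (ht : 0 ≤ t) :
    ∃ x, Real.exp (-(5 * t / ((n : ℝ) + 1) ^ 2)) / 4 ≤ (lazyPath n).tv t x := by
  have hθ0 : 0 < pathAngle n 1 := by
    rw [pathAngle]
    positivity
  have hcos_ne : Real.cos (pathAngle n 1) ≠ 1 := by
    have hlt := Real.cos_lt_cos_of_nonneg_of_le_pi le_rfl (pathAngle_le_pi (by omega)) hθ0
    rw [Real.cos_zero] at hlt
    exact hlt.ne
  have hcos : 1 - Real.cos (pathAngle n 1) ≤ 5 / ((n : ℝ) + 1) ^ 2 := by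
    have hsq := pathAngle_one_sq_le n
    rw [show (10 : ℝ) / ((n : ℝ) + 1) ^ 2 = 2 * (5 / ((n : ℝ) + 1) ^ 2) by ring] at hsq
    linarith [Real.one_sub_sq_div_two_le_cos (x := pathAngle n 1)]
  have hexp : Real.exp (-(5 * t / ((n : ℝ) + 1) ^ 2))
      ≤ Real.exp (-t * (1 - Real.cos (pathAngle n 1))) := by
    rw [neg_mul, mul_comm 5 t, mul_div_assoc]
    gcongr
  refine ⟨(0 : Fin (n + 1)), ?_⟩
  calc Real.exp (-(5 * t / ((n : ℝ) + 1) ^ 2)) / 4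
      = Real.exp (-(5 * t / ((n : ℝ) + 1) ^ 2)) * (1 / 2) / 2 := by ring
    _ ≤ Real.exp (-t * (1 - Real.cos (pathAngle n 1))) * pathCos n 1 0 / 2 := by
        gcongr
        exact one_half_le_pathCos_one_zero hn
    _ ≤ _ := exp_mul_eigenfunction_le_tv (C := lazyPath n)
        (f := fun x : Fin (n + 1) => pathCos n 1 x) (lazyPath_isIrreducibleMarkov n).isMarkov
        (sum_lazyPath_K_mul_pathCos 1) hcos_ne (fun _ => abs_pathCos_le_one _ _ _) t
        (0 : Fin (n + 1))

end Path

/-! ### Ehrenfest chains alternating with lazy paths -/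

section Mixed

lemma mixedFamily_even (j : ℕ) : mixedFamily (2 * j) = ehrenfest (j + 1) := by
  rw [mixedFamily, if_pos (even_two_mul j), Nat.mul_div_cancel_left j two_pos]

lemma mixedFamily_odd (j : ℕ) : mixedFamily (2 * j + 1) = lazyPath (j + 1) := by
  rw [mixedFamily, if_neg (by simp), show (2 * j + 1) / 2 = j by omega]

lemma mixedWeights_even (r : ℝ) (j : ℕ) : mixedWeights r (2 * j) = r ^ j := by
  rw [mixedWeights, if_pos (even_two_mul j), Nat.mul_div_cancel_left j two_pos]

lemma mixedWeights_odd (r : ℝ) (j : ℕ) : mixedWeights r (2 * j + 1) = 1 := by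
  rw [mixedWeights, if_neg (by simp)]

instance mixedFamilyFinite (k : ℕ) : Finite (mixedFamily k).X := by
  rw [mixedFamily]
  split_ifs <;> infer_instance

lemma mixedFamily_isIrreducibleMarkov (k : ℕ) : (mixedFamily k).IsIrreducibleMarkov := by
  rw [mixedFamily]
  split_ifs
  · exact ehrenfest_isIrreducibleMarkov (by omega)
  · exact lazyPath_isIrreducibleMarkov _

lemma mixedFamily_isMarkov (k : ℕ) : (mixedFamily k).IsMarkov :=
  (mixedFamily_isIrreducibleMarkov k).isMarkov

variable {r : ℝ}

lemma mixedWeights_pos (hr : 0 < r) (k : ℕ) : 0 < mixedWeights r k := by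
  rw [mixedWeights]
  split_ifs <;> positivity

/- Both the lower and the upper bound for the path live on the time scale `(n + 1) ^ 2`, so its
distance to stationarity cannot drop from near `1` to near `0` within a factor `4` of time. -/
lemma not_cutoffAff_mixedFamily : ¬ CutoffAff mixedFamily := by
  rintro ⟨t, ht, hone, hzero⟩
  have hodd : Tendsto (fun j : ℕ => 2 * j + 1) atTop atTop :=
    tendsto_atTop_mono (fun j => by omega : ∀ j : ℕ, j ≤ 2 * j + 1) tendsto_id
  have hlate := ((((hone 2 one_lt_two).comp hodd).pow 2).const_sub 1).sqrt
  have hearly := (hzero (1 / 2) (by norm_num) (by norm_num)).comp hodd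
  norm_num at hlate
  obtain ⟨j, hjlate, hjearly⟩ :=
    ((hlate.eventually_lt_const (by positivity : 0 < Real.exp (-20) / 4)).and
      (hearly.eventually_lt_const (one_half_pos (α := ℝ)))).exists
  simp only [Function.comp, mixedFamily_odd] at hjlate hjearly
  have hpath := (lazyPath_isIrreducibleMarkov (j + 1)).isMarkov
  set s := t (2 * j + 1)
  have hs : 0 < s := ht _
  set M : ℝ := (((j + 1 : ℕ) : ℝ) + 1) ^ 2 with hM
  have hM0 : 0 < M := by positivity
  have hsM : s < 2 * M := by
    have hbound := hpath.one_sub_le_minAff_of_tv_le (t := 1 / 2 * s) (by positivity)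
      (fun x => tv_lazyPath_le (by positivity) x)
    rw [← hM, show 2 * (1 / 2 * s) = s by ring] at hbound
    have : 1 / 2 < M / s := by linarith
    rw [lt_div_iff₀ hs] at this
    linarith
  obtain ⟨x, hx⟩ := exists_le_tv_lazyPath (n := j + 1) (by omega) (t := 2 * s) (by positivity)
  have htv := hpath.tv_le_sqrt_one_sub_sq_minAff (t := 2 * s) (by positivity) x
  have hexp : Real.exp (-20) ≤ Real.exp (-(5 * (2 * s) / M)) := by
    rw [Real.exp_le_exp, neg_le_neg_iff, div_le_iff₀ hM0]
    linarith
  linarith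

lemma sum_range_two_mul (f : ℕ → ℝ) (M : ℕ) :
    ∑ k ∈ Finset.range (2 * M), f k = ∑ j ∈ Finset.range M, (f (2 * j) + f (2 * j + 1)) := by
  induction M with
  | zero => simp
  | succ M ih =>
    rw [Finset.sum_range_succ, ← ih, show 2 * (M + 1) = 2 * M + 1 + 1 by ring,
      Finset.sum_range_succ, Finset.sum_range_succ, add_assoc]

lemma prod_minAff_mixedFamily_le (hr : 0 < r) (N : ℕ) {s : ℝ} (hs : 0 ≤ s) :
    ∏ k ∈ Finset.range (N + 1), (mixedFamily k).minAff (mixedWeights r k * s)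
      ≤ (ehrenfest (N / 2 + 1)).minAff (r ^ (N / 2) * s) := by
  have hmem : 2 * (N / 2) ∈ Finset.range (N + 1) := Finset.mem_range.2 (by omega)
  rw [← Finset.mul_prod_erase _ _ hmem, mixedFamily_even, mixedWeights_even]
  refine mul_le_of_le_one_right (Chain.minAff_nonneg _ _)
    (Finset.prod_le_one (fun k _ => (mixedFamily k).minAff_nonneg _) fun k _ => ?_)
  exact (mixedFamily_isMarkov k).minAff_le_one (mul_nonneg (mixedWeights_pos hr k).le hs)

lemma one_sub_sum_le_prod_minAff_mixedFamily (hr : 0 < r) (N : ℕ) {s : ℝ} (hs : 0 < s) :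
    1 - ∑ j ∈ Finset.range (N / 2 + 1),
      (((j + 1 : ℕ) : ℝ) * Real.exp (-4 * (r ^ j * s / ((j + 1 : ℕ) : ℝ)))
        + (((j + 1 : ℕ) : ℝ) + 1) ^ 2 / (2 * s))
      ≤ ∏ k ∈ Finset.range (N + 1), (mixedFamily k).minAff (mixedWeights r k * s) := by
  have hle_one : ∀ k, (mixedFamily k).minAff (mixedWeights r k * s) ≤ 1 := fun k =>
    (mixedFamily_isMarkov k).minAff_le_one (mul_nonneg (mixedWeights_pos hr k).le hs.le)
  refine le_trans (sub_le_sub_left ?_ 1) (one_sub_sum_le_prod (Finset.range (N + 1))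
    (fun k => (mixedFamily k).minAff (mixedWeights r k * s))
    (fun k => 1 - (mixedFamily k).minAff (mixedWeights r k * s))
    (fun k _ => (mixedFamily k).minAff_nonneg _) (fun k _ => hle_one k) fun k _ => by simp)
  have hsub : Finset.range (N + 1) ⊆ Finset.range (2 * (N / 2 + 1)) :=
    Finset.range_subset_range.2 (by omega)
  refine (Finset.sum_le_sum_of_subset_of_nonneg hsub fun k _ _ =>
    sub_nonneg.2 (hle_one k)).trans ?_
  rw [sum_range_two_mul]
  refine Finset.sum_le_sum fun j _ => add_le_add ?_ ?_
  · rw [mixedFamily_even, mixedWeights_even]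
    have := le_minAff_ehrenfest (n := j + 1) (by omega) (t := r ^ j * s) (by positivity)
    linarith
  · rw [mixedFamily_odd, mixedWeights_odd, one_mul]
    have := (lazyPath_isIrreducibleMarkov (j + 1)).isMarkov.one_sub_le_minAff_of_tv_le hs.le
      fun x => tv_lazyPath_le hs x
    linarith

/-- The cutoff time of the last Ehrenfest chain in the product of `mixedFamily`, in units in which
a chain of weight one jumps at rate one. -/
def mixedTime (r : ℝ) (m : ℕ) : ℝ := (r ^ m)⁻¹ * ((m + 1) / 4 * Real.log (m + 2))

lemma log_two_le_log_add_two (m : ℕ) : Real.log 2 ≤ Real.log ((m : ℝ) + 2) :=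
  Real.log_le_log two_pos (le_add_of_nonneg_left m.cast_nonneg)

lemma log_add_two_pos (m : ℕ) : 0 < Real.log ((m : ℝ) + 2) :=
  (Real.log_pos one_lt_two).trans_le (log_two_le_log_add_two m)

lemma mixedTime_pos (hr : 0 < r) (m : ℕ) : 0 < mixedTime r m := by
  have := log_add_two_pos m
  rw [mixedTime]
  positivity

lemma four_mul_pow_mul_mixedTime_div (hr : r ≠ 0) (a : ℝ) (i j : ℕ) :
    4 * (r ^ j * (a * mixedTime r (j + i)) / ((j + 1 : ℕ) : ℝ))
      = (((j + i : ℕ) : ℝ) + 1) / ((j + 1 : ℕ) : ℝ)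
        * ((r ^ i)⁻¹ * (a * Real.log ((j + i : ℕ) + 2))) := by
  rw [mixedTime, pow_add]
  field_simp

/- At the time `a * mixedTime r m` the Ehrenfest chain `j = m - i` is past its own cutoff by a
factor at least `a * r⁻¹ ^ i ≥ a * (1 + i * (r⁻¹ - 1))`. -/
lemma le_four_mul_pow_mul_mixedTime_div (hr : 0 < r) (hr1 : r < 1) {a : ℝ} (ha : 1 < a)
    (i j : ℕ) :
    a * Real.log ((j + i : ℕ) + 2) + i * ((r⁻¹ - 1) * Real.log 2)
      ≤ 4 * (r ^ j * (a * mixedTime r (j + i)) / ((j + 1 : ℕ) : ℝ)) := by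
  have hδ : 0 < r⁻¹ - 1 := sub_pos.2 ((one_lt_inv₀ hr).2 hr1)
  set δ := r⁻¹ - 1 with hδ_def
  set L := Real.log ((j + i : ℕ) + 2)
  have hlog : Real.log 2 ≤ a * L :=
    (log_two_le_log_add_two (j + i)).trans (le_mul_of_one_le_left (log_add_two_pos _).le ha.le)
  have haL : 0 < a * L := (Real.log_pos one_lt_two).trans_le hlog
  have hbernoulli : 1 + i * δ ≤ (r ^ i)⁻¹ := by
    have := one_add_mul_le_pow (a := δ) (by linarith) i
    rwa [hδ_def, add_sub_cancel, inv_pow] at this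
  have hratio : (1 : ℝ) ≤ (((j + i : ℕ) : ℝ) + 1) / ((j + 1 : ℕ) : ℝ) := by
    rw [le_div_iff₀ (by positivity)]
    push_cast
    linarith [(i.cast_nonneg : (0 : ℝ) ≤ i)]
  calc a * L + i * (δ * Real.log 2) ≤ a * L + i * (δ * (a * L)) := by gcongr
    _ = (1 + i * δ) * (a * L) := by ring
    _ ≤ (r ^ i)⁻¹ * (a * L) := by gcongr
    _ ≤ (((j + i : ℕ) : ℝ) + 1) / ((j + 1 : ℕ) : ℝ) * ((r ^ i)⁻¹ * (a * L)) :=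
        le_mul_of_one_le_left (by positivity) hratio
    _ = _ := (four_mul_pow_mul_mixedTime_div hr.ne' a i j).symm

lemma mul_exp_mixedTime_le (hr : 0 < r) (hr1 : r < 1) {a : ℝ} (ha : 1 < a) {j m : ℕ}
    (hjm : j ≤ m) :
    ((j + 1 : ℕ) : ℝ) * Real.exp (-4 * (r ^ j * (a * mixedTime r m) / ((j + 1 : ℕ) : ℝ)))
      ≤ Real.exp (-(a - 1) * Real.log (m + 2))
        * Real.exp (-((r⁻¹ - 1) * Real.log 2)) ^ (m - j) := by
  obtain ⟨i, rfl⟩ := Nat.exists_eq_add_of_le hjm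
  rw [Nat.add_sub_cancel_left]
  set L := Real.log ((j + i : ℕ) + 2) with hL
  have hj : ((j + 1 : ℕ) : ℝ) ≤ Real.exp L := by
    rw [hL, Real.exp_log (by positivity)]
    push_cast
    linarith [(i.cast_nonneg : (0 : ℝ) ≤ i)]
  have hexponent := le_four_mul_pow_mul_mixedTime_div hr hr1 ha i j
  calc _ ≤ Real.exp L * Real.exp (-(a * L + i * ((r⁻¹ - 1) * Real.log 2))) := by
        gcongr
        linarith
    _ = _ := by
        rw [← Real.exp_nat_mul, ← Real.exp_add, ← Real.exp_add]
        ring_nf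

lemma sum_pow_sub_le {q : ℝ} (hq0 : 0 ≤ q) (hq1 : q < 1) (m : ℕ) :
    ∑ j ∈ Finset.range (m + 1), q ^ (m - j) ≤ (1 - q)⁻¹ := by
  have hreflect : ∑ j ∈ Finset.range (m + 1), q ^ (m - j) = ∑ i ∈ Finset.range (m + 1), q ^ i := by
    simpa only [Nat.add_sub_cancel] using Finset.sum_range_reflect (fun i => q ^ i) (m + 1)
  rw [hreflect, ← tsum_geometric_of_lt_one hq0 hq1]
  exact (summable_geometric_of_lt_one hq0 hq1).sum_le_tsum _ fun i _ => by positivity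

lemma sum_mul_exp_mixedTime_le (hr : 0 < r) (hr1 : r < 1) {a : ℝ} (ha : 1 < a) (m : ℕ) :
    ∑ j ∈ Finset.range (m + 1),
      ((j + 1 : ℕ) : ℝ) * Real.exp (-4 * (r ^ j * (a * mixedTime r m) / ((j + 1 : ℕ) : ℝ)))
      ≤ Real.exp (-(a - 1) * Real.log (m + 2))
        * (1 - Real.exp (-((r⁻¹ - 1) * Real.log 2)))⁻¹ := by
  refine (Finset.sum_le_sum fun j hj =>
    mul_exp_mixedTime_le hr hr1 ha (Nat.lt_succ_iff.1 (Finset.mem_range.1 hj))).trans ?_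
  rw [← Finset.mul_sum]
  gcongr
  refine sum_pow_sub_le (Real.exp_pos _).le (Real.exp_lt_one_iff.2 (neg_neg_of_pos ?_)) m
  exact mul_pos (sub_pos.2 ((one_lt_inv₀ hr).2 hr1)) (Real.log_pos one_lt_two)

lemma sum_sq_div_mixedTime_le (hr : 0 < r) {a : ℝ} (ha : 1 < a) (m : ℕ) :
    ∑ j ∈ Finset.range (m + 1), (((j + 1 : ℕ) : ℝ) + 1) ^ 2 / (2 * (a * mixedTime r m))
      ≤ 2 / Real.log 2 * (((m + 2 : ℕ) : ℝ) ^ 2 * r ^ m) := by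
  have hτ := mixedTime_pos hr m
  have hlog := log_add_two_pos m
  have hlog_le := log_two_le_log_add_two m
  have := Real.log_pos one_lt_two
  have hterm : ∀ j ∈ Finset.range (m + 1),
      (((j + 1 : ℕ) : ℝ) + 1) ^ 2 / (2 * (a * mixedTime r m))
        ≤ ((m + 2 : ℕ) : ℝ) ^ 2 / (2 * mixedTime r m) := by
    intro j hj
    have hbase : (((j + 1 : ℕ) : ℝ) + 1) ≤ ((m + 2 : ℕ) : ℝ) := by
      have := Finset.mem_range.1 hj
      exact_mod_cast (by omega : j + 1 + 1 ≤ m + 2)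
    gcongr
    exact le_mul_of_one_le_left hτ.le ha.le
  calc _ ≤ (m + 1) • (((m + 2 : ℕ) : ℝ) ^ 2 / (2 * mixedTime r m)) := by
        simpa only [Finset.sum_const, Finset.card_range] using Finset.sum_le_sum hterm
    _ = 2 / Real.log (m + 2) * (((m + 2 : ℕ) : ℝ) ^ 2 * r ^ m) := by
        rw [mixedTime, nsmul_eq_mul]
        push_cast
        field_simp
        ring
    _ ≤ _ := by gcongr

lemma minAff_ehrenfest_mixedTime_le (hr : 0 < r) {a : ℝ} (ha : 0 < a) (m : ℕ) :
    (ehrenfest (m + 1)).minAff (r ^ m * (a * mixedTime r m))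
      ≤ √(Real.exp (-(1 / 8 * Real.exp ((1 - a) * Real.log ((m : ℝ) + 2))))) := by
  have hτ := mixedTime_pos hr m
  refine Real.le_sqrt_of_sq_le ((minAff_ehrenfest_sq_le (by omega) (by positivity)).trans
    (Real.exp_le_exp.2 (neg_le_neg ?_)))
  have hexponent : -4 * (r ^ m * (a * mixedTime r m) / ((m + 1 : ℕ) : ℝ))
      = -a * Real.log ((m : ℝ) + 2) := by
    have := four_mul_pow_mul_mixedTime_div hr.ne' a 0 m
    rw [Nat.add_zero, pow_zero, inv_one, one_mul, Nat.cast_succ,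
      div_self (by positivity), one_mul] at this
    rw [Nat.cast_succ]
    linarith
  rw [hexponent, sub_mul, one_mul, sub_eq_add_neg, Real.exp_add, Real.exp_log (by positivity),
    ← neg_mul]
  push_cast
  nlinarith [Real.exp_pos (-a * Real.log ((m : ℝ) + 2)), (m.cast_nonneg : (0 : ℝ) ≤ m)]

lemma tendsto_log_add_two : Tendsto (fun m : ℕ => Real.log ((m : ℝ) + 2)) atTop atTop :=
  Real.tendsto_log_atTop.comp
    (tendsto_atTop_add_const_right _ 2 tendsto_natCast_atTop_atTop)

lemma tendsto_exp_neg_mul_log_add_two {c : ℝ} (hc : 0 < c) :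
    Tendsto (fun m : ℕ => Real.exp (-c * Real.log (m + 2))) atTop (𝓝 0) :=
  Real.tendsto_exp_atBot.comp (tendsto_log_add_two.const_mul_atTop_of_neg (neg_neg_of_pos hc))

lemma tendsto_sq_mul_pow (hr : 0 < r) (hr1 : r < 1) :
    Tendsto (fun m : ℕ => ((m + 2 : ℕ) : ℝ) ^ 2 * r ^ m) atTop (𝓝 0) := by
  have hshift := (((tendsto_pow_const_mul_const_pow_of_lt_one 2 hr.le hr1).comp
    (tendsto_add_atTop_nat 2)).const_mul (r ^ 2)⁻¹)
  rw [mul_zero] at hshift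
  refine hshift.congr fun m => ?_
  simp only [Function.comp, pow_add]
  field_simp

lemma minAff_prodFamily_mixedFamily (hr : 0 < r) {a : ℝ} (ha : 0 < a) (N : ℕ) :
    (prodFamily mixedFamily (mixedWeights r) N).minAff
        (a * ((∑ j ∈ Finset.range (N + 1), mixedWeights r j) * mixedTime r (N / 2)))
      = ∏ k ∈ Finset.range (N + 1),
        (mixedFamily k).minAff (mixedWeights r k * (a * mixedTime r (N / 2))) := by
  have hsum : 0 < ∑ j ∈ Finset.range (N + 1), mixedWeights r j :=
    Finset.sum_pos (fun j _ => mixedWeights_pos hr j) (by simp)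
  have hτ := mixedTime_pos hr (N / 2)
  rw [minAff_prodFamily mixedFamily_isMarkov (mixedWeights_pos hr) N (by positivity),
    mul_left_comm, mul_div_cancel_left₀ _ hsum.ne']

lemma tendsto_prod_minAff_mixedFamily_one (hr : 0 < r) (hr1 : r < 1) {a : ℝ} (ha : 1 < a) :
    Tendsto (fun N => ∏ k ∈ Finset.range (N + 1),
      (mixedFamily k).minAff (mixedWeights r k * (a * mixedTime r (N / 2)))) atTop (𝓝 1) := by
  have hs : ∀ N, 0 < a * mixedTime r (N / 2) := fun N =>
    mul_pos (by linarith) (mixedTime_pos hr _)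
  have hlower := ((((tendsto_exp_neg_mul_log_add_two (sub_pos.2 ha)).mul_const
    (1 - Real.exp (-((r⁻¹ - 1) * Real.log 2)))⁻¹).add
      ((tendsto_sq_mul_pow hr hr1).const_mul (2 / Real.log 2))).const_sub 1).comp
        (Nat.tendsto_div_const_atTop two_ne_zero)
  simp only [zero_mul, mul_zero, add_zero, sub_zero] at hlower
  refine tendsto_of_tendsto_of_tendsto_of_le_of_le hlower tendsto_const_nhds (fun N => ?_)
    fun N => ?_
  · refine le_trans ?_ (one_sub_sum_le_prod_minAff_mixedFamily hr N (hs N))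
    rw [Finset.sum_add_distrib]
    exact sub_le_sub_left (add_le_add (sum_mul_exp_mixedTime_le hr hr1 ha _)
      (sum_sq_div_mixedTime_le hr ha _)) 1
  · exact Finset.prod_le_one (fun k _ => (mixedFamily k).minAff_nonneg _) fun k _ =>
      (mixedFamily_isMarkov k).minAff_le_one (mul_pos (mixedWeights_pos hr k) (hs N)).le

lemma tendsto_prod_minAff_mixedFamily_zero (hr : 0 < r) {a : ℝ} (ha0 : 0 < a) (ha1 : a < 1) :
    Tendsto (fun N => ∏ k ∈ Finset.range (N + 1),
      (mixedFamily k).minAff (mixedWeights r k * (a * mixedTime r (N / 2)))) atTop (𝓝 0) := by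
  have hupper : Tendsto (fun m : ℕ =>
      √(Real.exp (-(1 / 8 * Real.exp ((1 - a) * Real.log ((m : ℝ) + 2)))))) atTop (𝓝 0) := by
    rw [← Real.sqrt_zero]
    refine (Real.tendsto_exp_atBot.comp (tendsto_neg_atTop_atBot.comp ?_)).sqrt
    refine (Real.tendsto_exp_atTop.comp ?_).const_mul_atTop (by norm_num)
    exact tendsto_log_add_two.const_mul_atTop (sub_pos.2 ha1)
  refine tendsto_of_tendsto_of_tendsto_of_le_of_le tendsto_const_nhds
    (hupper.comp (Nat.tendsto_div_const_atTop two_ne_zero))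
    (fun N => Finset.prod_nonneg fun k _ => (mixedFamily k).minAff_nonneg _) fun N => ?_
  exact (prod_minAff_mixedFamily_le hr N (mul_pos ha0 (mixedTime_pos hr _)).le).trans
    (minAff_ehrenfest_mixedTime_le hr ha0 _)

lemma cutoffAff_prodFamily_mixedFamily (hr : 0 < r) (hr1 : r < 1) :
    CutoffAff (prodFamily mixedFamily (mixedWeights r)) := by
  refine ⟨fun N => (∑ j ∈ Finset.range (N + 1), mixedWeights r j) * mixedTime r (N / 2),
    fun N => mul_pos (Finset.sum_pos (fun j _ => mixedWeights_pos hr j) (by simp))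
      (mixedTime_pos hr _), fun a ha => ?_, fun a ha0 ha1 => ?_⟩
  · simp only [minAff_prodFamily_mixedFamily hr (one_pos.trans ha)]
    exact tendsto_prod_minAff_mixedFamily_one hr hr1 ha
  · simp only [minAff_prodFamily_mixedFamily hr ha0]
    exact tendsto_prod_minAff_mixedFamily_zero hr ha0 ha1

end Mixed

/-! ### Hitting the top of the Lacoin chain -/

section LacoinHit

variable {n : ℕ} {a b : ℝ}

/-- The state `2n` of a Lacoin chain, which carries almost all of the stationary mass. -/
def lacoinTop (n : ℕ) (a b : ℝ) : (lacoin n a b).X := (Fin.last (2 * n) : Fin (2 * n + 1))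

/-- The state `0` of a Lacoin chain, from which `2n` is hardest to reach. -/
def lacoinBot (n : ℕ) (a b : ℝ) : (lacoin n a b).X := (0 : Fin (2 * n + 1))

/-- The probability that a Lacoin chain started from `j` is at `2n` after `k` steps, with the junk
value `0` for `j > 2n`. -/
def lacoinHit (n : ℕ) (a b : ℝ) (k j : ℕ) : ℝ :=
  if h : j < 2 * n + 1 then
    (lacoin n a b).pow k ((⟨j, h⟩ : Fin (2 * n + 1)) : (lacoin n a b).X) (lacoinTop n a b)
  else 0

lemma pow_lacoinTop (k : ℕ) (x : Fin (2 * n + 1)) :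
    (lacoin n a b).pow k x (lacoinTop n a b) = lacoinHit n a b k x := by
  rw [lacoinHit, dif_pos x.2]

lemma lacoinHit_zero {j : ℕ} (hj : j ≤ 2 * n) :
    lacoinHit n a b 0 j = if j = 2 * n then 1 else 0 := by
  have hiff : (⟨j, by omega⟩ : Fin (2 * n + 1)) = lacoinTop n a b ↔ j = 2 * n := Fin.ext_iff
  rw [lacoinHit, dif_pos (by omega), Chain.pow]
  by_cases hj' : j = 2 * n
  · rw [if_pos hj']
    exact if_pos (hiff.2 hj')
  · rw [if_neg hj']
    exact if_neg (mt hiff.1 hj')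

lemma lacoinHit_succ (hn : 1 ≤ n) (k : ℕ) {j : ℕ} (hj : j ≤ 2 * n) :
    lacoinHit n a b (k + 1) j
      = (if j ≠ n ∧ j ≠ 2 * n then (1 - a) * lacoinHit n a b k (j + 1) else 0)
      + (if 0 < j then a * lacoinHit n a b k (j - 1) else 0)
      + (if j = 0 then a * lacoinHit n a b k 0 else 0)
      + (if j = n then b * lacoinHit n a b k (n + 1) else 0)
      + (if j = n then (1 - a - b) * lacoinHit n a b k (2 * n) else 0)
      + (if j = 2 * n then lacoinC n a b * lacoinHit n a b k n else 0)
      + (if j = 2 * n then (1 - a - lacoinC n a b) * lacoinHit n a b k (2 * n) else 0) := by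
  rw [← sum_lacoin_K_mul (a := a) (b := b) hn ⟨j, by omega⟩ (lacoinHit n a b k), lacoinHit,
    dif_pos (by omega)]
  exact (Chain.pow_succ_apply k _ _).trans
    (Finset.sum_congr rfl fun z _ => congrArg _ (pow_lacoinTop k z))

lemma lacoinHit_succ_of_ne (hn : 1 ≤ n) (k : ℕ) {j : ℕ} (hj : j < 2 * n) (hjn : j ≠ n) :
    lacoinHit n a b (k + 1) j
      = (1 - a) * lacoinHit n a b k (j + 1) + a * lacoinHit n a b k (j - 1) := by
  rw [lacoinHit_succ hn k hj.le, if_pos ⟨hjn, hj.ne⟩, if_neg hjn, if_neg hjn, if_neg hj.ne,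
    if_neg hj.ne]
  rcases Nat.eq_zero_or_pos j with rfl | hpos
  · simp
  · rw [if_pos hpos, if_neg hpos.ne']
    ring

lemma lacoinHit_succ_mid (hn : 1 ≤ n) (k : ℕ) :
    lacoinHit n a b (k + 1) n = a * lacoinHit n a b k (n - 1) + b * lacoinHit n a b k (n + 1)
      + (1 - a - b) * lacoinHit n a b k (2 * n) := by
  rw [lacoinHit_succ hn k (by omega), if_neg (by omega), if_pos (by omega), if_neg (by omega),
    if_pos rfl, if_pos rfl, if_neg (by omega), if_neg (by omega)]
  ring

/-- The moment generating function `E exp (l S)` of the change `S` of the distance to the right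
end in a step that goes right with probability `1 - a` and left with probability `a`. -/
def stepMGF (a l : ℝ) : ℝ := (1 - a) * Real.exp (-l) + a * Real.exp l

lemma exp_mul_stepMGF (a l : ℝ) (d : ℕ) :
    Real.exp (l * (d + 1 : ℕ)) * stepMGF a l
      = (1 - a) * Real.exp (l * d) + a * Real.exp (l * (d + 2 : ℕ)) := by
  rw [stepMGF, mul_add, mul_left_comm, mul_left_comm _ a, ← Real.exp_add, ← Real.exp_add]
  push_cast
  ring_nf

namespace LacoinParams

variable (h : LacoinParams a b)
include h

lemma stepMGF_pos (l : ℝ) : 0 < stepMGF a l := by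
  have := h.a_pos
  have := h.one_sub_a_pos
  rw [stepMGF]
  positivity

lemma step_le_exp_mul_stepMGF_pow {l u v γ : ℝ} {d k : ℕ}
    (hu : u ≤ Real.exp (l * d) * stepMGF a l ^ k + γ)
    (hv : v ≤ Real.exp (l * (d + 2 : ℕ)) * stepMGF a l ^ k + γ) :
    (1 - a) * u + a * v ≤ Real.exp (l * (d + 1 : ℕ)) * stepMGF a l ^ (k + 1) + γ :=
  calc (1 - a) * u + a * v
      ≤ (1 - a) * (Real.exp (l * d) * stepMGF a l ^ k + γ)
        + a * (Real.exp (l * (d + 2 : ℕ)) * stepMGF a l ^ k + γ) :=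
        add_le_add (mul_le_mul_of_nonneg_left hu h.one_sub_a_pos.le)
          (mul_le_mul_of_nonneg_left hv h.a_pos.le)
    _ = Real.exp (l * (d + 1 : ℕ)) * stepMGF a l ^ (k + 1) + γ := by
        rw [pow_succ', ← mul_assoc, exp_mul_stepMGF]
        ring

lemma isMarkov (hn : 1 ≤ n) : (lacoin n a b).IsMarkov := (h.isIrreducibleMarkov hn).isMarkov

lemma lacoinHit_mem_Icc (hn : 1 ≤ n) (k j : ℕ) : lacoinHit n a b k j ∈ Set.Icc 0 1 := by
  rw [lacoinHit]
  split_ifs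
  · exact mem_Icc_of_mem_stdSimplex ((h.isMarkov hn).pow_mem_stdSimplex k _) _
  · simp

lemma lacoinHit_nonneg (hn : 1 ≤ n) (k j : ℕ) : 0 ≤ lacoinHit n a b k j :=
  (h.lacoinHit_mem_Icc hn k j).1

lemma lacoinHit_le_one (hn : 1 ≤ n) (k j : ℕ) : lacoinHit n a b k j ≤ 1 :=
  (h.lacoinHit_mem_Icc hn k j).2

lemma sum_lacoinWeight_range_le {j : ℕ} (hj : j ≤ n) :
    ∑ i ∈ Finset.range j, lacoinWeight n a b i ≤ 2 * a * lacoinWeight n a b j := by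
  have ha := h.a_pos
  have hW := h.lacoinWeight_pos n
  induction j with
  | zero => simpa using (mul_pos (by positivity : 0 < 2 * a) (hW 0)).le
  | succ j ih =>
    rw [Finset.sum_range_succ, mul_assoc, mul_comm a, h.lacoinWeight_succ (by omega)]
    nlinarith [ih (by omega), hW j, h.a_lt_quarter]

lemma sum_lacoinWeight_range_succ_mid_le :
    ∑ i ∈ Finset.range (n + 1), lacoinWeight n a b i ≤ 2 * lacoinWeight n a b (n + 1) := by
  have hW := h.lacoinWeight_pos n
  have hmono : lacoinWeight n a b n ≤ lacoinWeight n a b (n + 1) := by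
    have := h.lacoinWeight_succ_mid (n := n)
    nlinarith [hW (n + 1), h.b_pos, h.a_lt_b]
  rw [Finset.sum_range_succ]
  nlinarith [h.sum_lacoinWeight_range_le (n := n) le_rfl, hW n, h.a_lt_quarter]

lemma sum_lacoinWeight_range_add_le (i : ℕ) :
    ∑ j ∈ Finset.range (n + 2 + i), lacoinWeight n a b j
      ≤ 4 * a * lacoinWeight n a b (n + 2 + i) := by
  have hW := h.lacoinWeight_pos n
  have ha4 := h.a_lt_quarter
  induction i with
  | zero =>
    have hsucc := h.lacoinWeight_succ (n := n) (j := n + 1) (by omega)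
    rw [add_zero, Finset.sum_range_succ]
    nlinarith [hW (n + 1), h.sum_lacoinWeight_range_succ_mid_le (n := n)]
  | succ i ih =>
    have hsucc := h.lacoinWeight_succ (n := n) (j := n + 2 + i) (by omega)
    rw [← add_assoc, Finset.sum_range_succ]
    nlinarith [hW (n + 2 + i)]

lemma one_sub_le_stat_lacoinTop (hn : 2 ≤ n) :
    1 - 4 * a ≤ (lacoin n a b).stat (lacoinTop n a b) := by
  have hsum := h.sum_lacoinWeight_range_add_le (n := n) (n - 2)
  rw [show n + 2 + (n - 2) = 2 * n by omega] at hsum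
  have htop := h.lacoinWeight_pos n (2 * n)
  have hnonneg : 0 ≤ ∑ i ∈ Finset.range (2 * n), lacoinWeight n a b i :=
    Finset.sum_nonneg fun i _ => (h.lacoinWeight_pos n i).le
  change 1 - 4 * a
    ≤ lacoinWeight n a b (2 * n) / ∑ i ∈ Finset.range (2 * n + 1), lacoinWeight n a b i
  rw [Finset.sum_range_succ, le_div_iff₀ (by linarith)]
  nlinarith [h.a_pos]

section Fast

variable {l η : ℝ} (hn : 1 ≤ n) (hl : 0 ≤ l) (hη : ∀ k, 1 - lacoinHit n a b k (2 * n) ≤ η)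
include hn hl hη

lemma one_sub_lacoinHit_mid_sub_le (k : ℕ) {d : ℕ} (hd : d ≤ n) :
    1 - lacoinHit n a b k (n - d) ≤ Real.exp (l * d) * stepMGF a l ^ k + 2 * (b + η) := by
  have ha := h.a_pos
  have ha1 := h.one_sub_a_pos
  have hb := h.b_pos
  have hρ := h.stepMGF_pos l
  have hη0 : 0 ≤ η := (sub_nonneg.2 (h.lacoinHit_le_one hn 0 (2 * n))).trans (hη 0)
  induction k generalizing d with
  | zero =>
    have : 1 ≤ Real.exp (l * d) := Real.one_le_exp (by positivity)
    linarith [h.lacoinHit_nonneg hn 0 (n - d), pow_zero (stepMGF a l)]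
  | succ k ih =>
    rcases d with _ | d
    · have hright := h.lacoinHit_nonneg hn k (n + 1)
      have htop : (1 - a - b) * (1 - lacoinHit n a b k (2 * n)) ≤ η :=
        (mul_le_of_le_one_left (sub_nonneg.2 (h.lacoinHit_le_one hn k (2 * n)))
          (by linarith)).trans (hη k)
      have hleft := mul_le_mul_of_nonneg_left (ih hn) ha.le
      have hρ_ge : a * Real.exp l ≤ stepMGF a l := by
        rw [stepMGF]
        linarith [mul_pos ha1 (Real.exp_pos (-l))]
      have hpow := mul_le_mul_of_nonneg_right hρ_ge (pow_nonneg hρ.le k)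
      rw [Nat.cast_one, mul_one] at hleft
      rw [Nat.sub_zero, lacoinHit_succ_mid hn k, Nat.cast_zero, mul_zero, Real.exp_zero, one_mul,
        pow_succ']
      nlinarith [h.a_lt_quarter]
    · rw [lacoinHit_succ_of_ne hn k (by omega) (by omega),
        show n - (d + 1) + 1 = n - d by omega]
      refine le_of_eq_of_le (by ring) (h.step_le_exp_mul_stepMGF_pow (ih (d := d) (by omega))
        (v := 1 - lacoinHit n a b k (n - (d + 1) - 1)) ?_)
      rcases hd.lt_or_eq with hlt | rfl
      · exact ih hlt
      · rw [show d + 1 - (d + 1) - 1 = d + 1 - (d + 1) by omega]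
        refine (ih le_rfl).trans ?_
        gcongr
        omega

lemma one_sub_lacoinHit_top_sub_le (k : ℕ) {d : ℕ} (hd : d < n) :
    1 - lacoinHit n a b k (2 * n - d) ≤ Real.exp (l * d) * stepMGF a l ^ k + a * k + η := by
  have ha := h.a_pos
  have hρ := h.stepMGF_pos l
  have hη0 : 0 ≤ η := (sub_nonneg.2 (h.lacoinHit_le_one hn 0 (2 * n))).trans (hη 0)
  induction k generalizing d with
  | zero =>
    have : 1 ≤ Real.exp (l * d) := Real.one_le_exp (by positivity)
    rw [pow_zero, Nat.cast_zero]
    linarith [h.lacoinHit_nonneg hn 0 (2 * n - d)]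
  | succ k ih =>
    rcases d with _ | d
    · have : 0 ≤ Real.exp (l * (0 : ℕ)) * stepMGF a l ^ (k + 1) + a * ((k + 1 : ℕ) : ℝ) := by
        positivity
      rw [Nat.sub_zero]
      linarith [hη (k + 1)]
    · rw [lacoinHit_succ_of_ne hn k (by omega) (by omega),
        show 2 * n - (d + 1) + 1 = 2 * n - d by omega]
      have hstep := h.step_le_exp_mul_stepMGF_pow (γ := a * k + η) (v := 0)
        ((ih (d := d) (by omega)).trans_eq (add_assoc _ _ _)) (by positivity)
      have hleft := mul_nonneg ha.le (h.lacoinHit_nonneg hn k (2 * n - (d + 1) - 1))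
      rw [Nat.cast_succ k]
      linarith

/- From the left half the chain crosses `n`, where it jumps to `2n` unless it uses the edge of
probability `b`; the term `a * k` bounds the probability that a start in the right half ever steps
left. -/
lemma one_sub_lacoinHit_le (k : ℕ) {j : ℕ} (hj : j ≤ 2 * n) :
    1 - lacoinHit n a b k j
      ≤ Real.exp (l * n) * stepMGF a l ^ k + a * k + 2 * (b + η) := by
  have ha := h.a_pos
  have hb := h.b_pos
  have hρ := h.stepMGF_pos l
  have hη0 : 0 ≤ η := (sub_nonneg.2 (h.lacoinHit_le_one hn 0 (2 * n))).trans (hη 0)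
  have hak : 0 ≤ a * (k : ℝ) := by positivity
  have hmono : ∀ d : ℕ, d ≤ n →
      Real.exp (l * d) * stepMGF a l ^ k ≤ Real.exp (l * n) * stepMGF a l ^ k := fun d hd => by
    gcongr
  rcases le_or_gt j n with hjn | hjn
  · have hbound := h.one_sub_lacoinHit_mid_sub_le hn hl hη k (d := n - j) (by omega)
    rw [show n - (n - j) = j by omega] at hbound
    linarith [hmono (n - j) (by omega)]
  · have hbound := h.one_sub_lacoinHit_top_sub_le hn hl hη k (d := 2 * n - j) (by omega)
    rw [show 2 * n - (2 * n - j) = j by omega] at hbound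
    linarith [hmono (2 * n - j) (by omega)]

end Fast

lemma one_sub_H_lacoin_le (hn : 2 ≤ n) (ha : a ≤ 1 / 8) {l t : ℝ} (hl : 0 ≤ l) (ht : 0 ≤ t)
    (x : (lacoin n a b).X) :
    1 - (lacoin n a b).H t x (lacoinTop n a b)
      ≤ Real.exp (l * n - t * (1 - stepMGF a l)) + a * t + 2 * b + 16 * a := by
  have hn1 : 1 ≤ n := one_le_two.trans hn
  have htop : ∀ k, 1 - lacoinHit n a b k (2 * n) ≤ 8 * a := fun k => by
    have hself := (h.isMarkov hn1).one_sub_pow_self_le k (by linarith)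
      (h.one_sub_le_stat_lacoinTop hn)
    have heq := pow_lacoinTop (a := a) (b := b) k (Fin.last (2 * n))
    rw [Fin.val_last] at heq
    rw [← heq]
    exact hself.trans_eq (by ring)
  have hH := Chain.one_sub_H_le_of_one_sub_pow_le (C := lacoin n a b) (x := x)
    (y := lacoinTop n a b) ht fun k => by
      rw [show (lacoin n a b).pow k x (lacoinTop n a b) = _ from pow_lacoinTop k x]
      exact h.one_sub_lacoinHit_le hn1 hl htop k
        (Nat.lt_succ_iff.1 (Fin.is_lt (n := 2 * n + 1) x))
  rw [← Real.exp_add, neg_mul, ← sub_eq_add_neg] at hH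
  linarith

section Slow

variable {l : ℝ} (hn : 1 ≤ n) (hl : 0 ≤ l)
include hn hl

lemma lacoinHit_le_exp (k : ℕ) {j : ℕ} (hj : j ≤ n) :
    lacoinHit n a b k j ≤ Real.exp (l * (k + j - n)) := by
  induction k generalizing j with
  | zero =>
    rw [lacoinHit_zero (by omega), if_neg (by omega)]
    positivity
  | succ k ih =>
    rcases hj.eq_or_lt with rfl | hj
    · refine (h.lacoinHit_le_one hn _ _).trans (Real.one_le_exp ?_)
      rw [add_sub_cancel_right]
      positivity
    · set X := Real.exp (l * ((k + 1 : ℕ) + j - n)) with hX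
      have hright : lacoinHit n a b k (j + 1) ≤ X := by
        refine (ih hj).trans_eq ?_
        rw [hX]
        push_cast
        ring_nf
      have hleft : lacoinHit n a b k (j - 1) ≤ X := by
        refine (ih (by omega)).trans ?_
        rw [hX]
        gcongr <;> omega
      rw [lacoinHit_succ_of_ne hn k (by omega) hj.ne]
      nlinarith [h.a_pos, h.one_sub_a_pos]

lemma lacoinHit_le_exp_add_of_gt (k : ℕ) {j : ℕ} (hnj : n < j) (hj : j ≤ 2 * n) :
    lacoinHit n a b k j ≤ Real.exp (l * (k + j - 2 * n)) + a * k := by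
  have ha := h.a_pos
  induction k generalizing j with
  | zero =>
    rw [lacoinHit_zero hj, Nat.cast_zero, mul_zero, add_zero, zero_add]
    split_ifs with htop
    · rw [htop]
      simp
    · positivity
  | succ k ih =>
    rcases hj.eq_or_lt with rfl | hj
    · have : 1 ≤ Real.exp (l * ((k + 1 : ℕ) + (2 * n : ℕ) - 2 * n)) := by
        refine Real.one_le_exp ?_
        push_cast
        rw [add_sub_cancel_right]
        positivity
      have : 0 ≤ a * ((k + 1 : ℕ) : ℝ) := by positivity
      linarith [h.lacoinHit_le_one hn (k + 1) (2 * n)]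
    · have hright := ih (j := j + 1) (by omega) hj
      rw [show l * (k + (j + 1 : ℕ) - 2 * n) = l * ((k + 1 : ℕ) + j - 2 * n) by
        push_cast; ring] at hright
      have hleft := h.lacoinHit_le_one hn k (j - 1)
      rw [lacoinHit_succ_of_ne hn k hj (by omega), Nat.cast_succ k] at *
      set X := Real.exp (l * (k + 1 + j - 2 * n))
      have hX : 0 ≤ X + a * k := by positivity
      nlinarith [h.one_sub_a_pos]

/- Reaching `2n` without the jump from `n` takes `2n` steps, and from `n` that jump has
probability less than `1 - b`. -/
lemma lacoinHit_le_exp_add_of_le (k : ℕ) {j : ℕ} (hj : j ≤ n) :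
    lacoinHit n a b k j ≤ 1 - b + Real.exp (l * (k + j - 2 * n)) + a * k := by
  have ha := h.a_pos
  have hb := h.b_pos
  have ha1 := h.one_sub_a_pos
  have hab1 := h.one_sub_a_sub_b_pos
  induction k generalizing j with
  | zero =>
    rw [lacoinHit_zero (by omega), if_neg (by omega), Nat.cast_zero, mul_zero, add_zero]
    linarith [Real.exp_pos (l * (0 + j - 2 * n))]
  | succ k ih =>
    set X := Real.exp (l * ((k + 1 : ℕ) + j - 2 * n)) with hX
    have hX_eq : Real.exp (l * (k + (j + 1 : ℕ) - 2 * n)) = X := by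
      rw [hX]
      push_cast
      ring_nf
    have hleft : lacoinHit n a b k (j - 1) ≤ 1 - b + X + a * k := by
      refine (ih (j := j - 1) (by omega)).trans ?_
      rw [hX]
      gcongr <;> omega
    have hXk : 0 < X + a * k := by positivity
    rw [Nat.cast_succ k]
    rcases hj.eq_or_lt with rfl | hj
    · have hright := h.lacoinHit_le_exp_add_of_gt hn hl k (j := j + 1) (by omega) (by omega)
      rw [hX_eq] at hright
      have htop := h.lacoinHit_le_one hn k (2 * j)
      rw [lacoinHit_succ_mid hn k]
      calc a * lacoinHit j a b k (j - 1) + b * lacoinHit j a b k (j + 1)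
            + (1 - a - b) * lacoinHit j a b k (2 * j)
          ≤ a * (1 - b + X + a * k) + b * (X + a * k) + (1 - a - b) * 1 := by gcongr
        _ ≤ 1 - b + X + a * (k + 1) := by nlinarith
    · have hright := ih (j := j + 1) hj
      rw [hX_eq] at hright
      rw [lacoinHit_succ_of_ne hn k (by omega) hj.ne]
      nlinarith

end Slow

lemma H_lacoin_bot_top_le (hn : 1 ≤ n) {l t : ℝ} (hl : 0 ≤ l) (ht : 0 ≤ t) :
    (lacoin n a b).H t (lacoinBot n a b) (lacoinTop n a b)
      ≤ Real.exp (t * (Real.exp l - 1) - l * n) := by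
  have hH := Chain.H_le_of_pow_le (C := lacoin n a b) (x := lacoinBot n a b)
    (y := lacoinTop n a b) (α := Real.exp (-(l * n))) (ρ := Real.exp l) (β := 0) (γ := 0) ht
    fun k => by
      rw [show (lacoin n a b).pow k (lacoinBot n a b) (lacoinTop n a b) = _ from
        pow_lacoinTop k 0, ← Real.exp_nat_mul, ← Real.exp_add, zero_mul, add_zero, add_zero]
      refine (h.lacoinHit_le_exp hn hl k (Nat.zero_le n)).trans_eq ?_
      push_cast
      ring_nf
  rw [← Real.exp_add, zero_mul, add_zero, add_zero] at hH
  exact hH.trans_eq (by ring_nf)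

lemma H_lacoin_bot_top_le_one_sub_add (hn : 1 ≤ n) {l t : ℝ} (hl : 0 ≤ l) (ht : 0 ≤ t) :
    (lacoin n a b).H t (lacoinBot n a b) (lacoinTop n a b)
      ≤ 1 - b + Real.exp (t * (Real.exp l - 1) - l * (2 * n)) + a * t := by
  have hH := Chain.H_le_of_pow_le (C := lacoin n a b) (x := lacoinBot n a b)
    (y := lacoinTop n a b) (α := Real.exp (-(l * (2 * n)))) (ρ := Real.exp l) (β := a)
    (γ := 1 - b) ht fun k => by
      rw [show (lacoin n a b).pow k (lacoinBot n a b) (lacoinTop n a b) = _ from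
        pow_lacoinTop k 0, ← Real.exp_nat_mul, ← Real.exp_add]
      refine (h.lacoinHit_le_exp_add_of_le hn hl k (Nat.zero_le n)).trans_eq ?_
      push_cast
      ring_nf
  rw [← Real.exp_add] at hH
  exact hH.trans_eq (by ring_nf)

end LacoinParams

end LacoinHit

/-! ### Triangular arrays -/

section Triangle

lemma triangle_succ (m : ℕ) : (m + 1) * (m + 1 + 1) / 2 = m * (m + 1) / 2 + (m + 1) := by
  rw [show (m + 1) * (m + 1 + 1) = m * (m + 1) + (m + 1) * 2 by ring,
    Nat.add_mul_div_right _ _ two_pos]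

lemma le_triangle (m : ℕ) : m ≤ m * (m + 1) / 2 := by
  rcases m with _ | m
  · rfl
  · rw [triangle_succ]
    omega

lemma triangle_mono {m n : ℕ} (hmn : m ≤ n) : m * (m + 1) / 2 ≤ n * (n + 1) / 2 :=
  Nat.div_le_div_right (Nat.mul_le_mul hmn (Nat.succ_le_succ hmn))

lemma exists_eq_triangle_add (k : ℕ) : ∃ m i, i ≤ m ∧ k = m * (m + 1) / 2 + i := by
  set m := Nat.findGreatest (fun n => n * (n + 1) / 2 ≤ k) k
  have hle : m * (m + 1) / 2 ≤ k :=
    Nat.findGreatest_spec (P := fun n => n * (n + 1) / 2 ≤ k) (Nat.zero_le k) (by simp)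
  have hlt : k < (m + 1) * (m + 1 + 1) / 2 := by
    by_cases hk : m + 1 ≤ k
    · exact not_le.1 (Nat.findGreatest_is_greatest (P := fun n => n * (n + 1) / 2 ≤ k)
        (Nat.lt_succ_self m) hk)
    · exact (not_le.1 hk).trans_le (le_triangle (m + 1))
  rw [triangle_succ] at hlt
  exact ⟨m, k - m * (m + 1) / 2, by omega, by omega⟩

lemma triRow_triangle_add {m i : ℕ} (hi : i ≤ m) : triRow (m * (m + 1) / 2 + i) = m + 1 := by
  rw [triRow, Nat.add_right_cancel_iff, Nat.findGreatest_eq_iff]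
  refine ⟨(le_triangle m).trans (Nat.le_add_right _ _), fun _ => Nat.le_add_right _ _,
    fun n hn _ => ?_⟩
  have hmono := triangle_mono (show m + 1 ≤ n from hn)
  rw [triangle_succ] at hmono
  omega

lemma triCol_triangle_add {m i : ℕ} (hi : i ≤ m) : triCol (m * (m + 1) / 2 + i) = i + 1 := by
  rw [triCol, triRow_triangle_add hi, Nat.add_sub_cancel, Nat.add_sub_cancel_left]

lemma triCol_mem (k : ℕ) : 1 ≤ triCol k ∧ triCol k ≤ triRow k := by
  obtain ⟨m, i, hi, rfl⟩ := exists_eq_triangle_add k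
  rw [triRow_triangle_add hi, triCol_triangle_add hi]
  omega

lemma one_le_triRow (k : ℕ) : 1 ≤ triRow k := (triCol_mem k).1.trans (triCol_mem k).2

lemma tendsto_triRow : Tendsto triRow atTop atTop := by
  rw [tendsto_atTop]
  intro M
  filter_upwards [eventually_ge_atTop (M * (M + 1) / 2)] with k hk
  obtain ⟨m, i, hi, rfl⟩ := exists_eq_triangle_add k
  rw [triRow_triangle_add hi]
  by_contra hlt
  have hmono := triangle_mono (show m + 1 ≤ M by omega)
  rw [triangle_succ] at hmono
  omega

lemma prod_range_triangle (f : ℕ → ℝ) (M : ℕ) :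
    ∏ k ∈ Finset.range (M * (M + 1) / 2), f k
      = ∏ m ∈ Finset.range M, ∏ i ∈ Finset.range (m + 1), f (m * (m + 1) / 2 + i) := by
  induction M with
  | zero => simp
  | succ M ih =>
    rw [triangle_succ, Finset.prod_range_add, ih,
      Finset.prod_range_succ fun m => ∏ i ∈ Finset.range (m + 1), f (m * (m + 1) / 2 + i)]

lemma rowSum_eq_sum_range (p : ℕ → ℕ → ℝ) (n : ℕ) :
    rowSum p n = ∑ i ∈ Finset.range n, p n (i + 1) := by
  rw [rowSum, Finset.range_eq_Ico, Finset.sum_Ico_add' (fun i => p n i) 0 n 1]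
  rfl

lemma rowMin_le (p : ℕ → ℕ → ℝ) {n i : ℕ} (hi : 1 ≤ i) (hin : i ≤ n) : rowMin p n ≤ p n i :=
  csInf_le ((Set.finite_Icc 1 n).image _).bddBelow ⟨i, ⟨hi, hin⟩, rfl⟩

lemma le_rowMax (p : ℕ → ℕ → ℝ) {n i : ℕ} (hi : 1 ≤ i) (hin : i ≤ n) : p n i ≤ rowMax p n :=
  le_csSup ((Set.finite_Icc 1 n).image _).bddAbove ⟨i, ⟨hi, hin⟩, rfl⟩

end Triangle

/-! ### Cutoff for the Lacoin chains -/

lemma exists_lt_mul_one_sub_exp_neg {A : ℝ} (hA : 1 < A) :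
    ∃ l, 0 ≤ l ∧ l < A * (1 - Real.exp (-l)) := by
  have hA0 : 0 < A := one_pos.trans hA
  refine ⟨Real.log A, Real.log_nonneg hA.le, ?_⟩
  rw [Real.exp_neg, Real.exp_log hA0, mul_sub, mul_one, mul_inv_cancel₀ hA0.ne']
  exact Real.log_lt_sub_one_of_pos hA0 hA.ne'

lemma exists_mul_exp_sub_one_lt {A : ℝ} (hA0 : 0 < A) (hA : A < 1) :
    ∃ l, 0 ≤ l ∧ A * (Real.exp l - 1) < l := by
  refine ⟨-Real.log A, neg_nonneg.2 (Real.log_nonpos hA0.le hA.le), ?_⟩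
  rw [Real.exp_neg, Real.exp_log hA0, mul_sub, mul_one, mul_inv_cancel₀ hA0.ne']
  linarith [Real.log_lt_sub_one_of_pos hA0 hA.ne]

lemma exp_neg_mul_le_inv {γ x : ℝ} (hγ : 0 < γ) (hx : 0 < x) :
    Real.exp (-(γ * x)) ≤ γ⁻¹ / x := by
  rw [Real.exp_neg, inv_eq_one_div, inv_eq_one_div, div_div]
  exact one_div_le_one_div_of_le (by positivity) (by linarith [Real.add_one_le_exp (γ * x)])

lemma exp_stepMGF_le {A D a l x : ℝ} (hA : 0 ≤ A) (ha : 0 ≤ a) (hx : 0 < x) (hax : a * x ≤ D)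
    (hl : l < A * (1 - Real.exp (-l))) :
    Real.exp (l * x - A * x * (1 - stepMGF a l))
      ≤ Real.exp (A * D * Real.exp l) * (A * (1 - Real.exp (-l)) - l)⁻¹ / x := by
  set γ := A * (1 - Real.exp (-l)) - l with hγ
  have hdrift : l * x - A * x * (1 - stepMGF a l) ≤ A * D * Real.exp l + -(γ * x) := by
    have hleft : A * (a * x) * Real.exp l ≤ A * D * Real.exp l := by gcongr
    have hright : 0 ≤ A * (a * x) * Real.exp (-l) := by positivity
    rw [hγ, stepMGF]
    linarith
  calc Real.exp (l * x - A * x * (1 - stepMGF a l))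
      ≤ Real.exp (A * D * Real.exp l) * Real.exp (-(γ * x)) := by
        rw [← Real.exp_add]
        exact Real.exp_le_exp.2 hdrift
    _ ≤ Real.exp (A * D * Real.exp l) * (γ⁻¹ / x) := by
        gcongr
        exact exp_neg_mul_le_inv (sub_pos.2 hl) hx
    _ = _ := (mul_div_assoc _ _ _).symm

instance lacoinFamilyFinite (a b : ℕ → ℕ → ℝ) (k : ℕ) : Finite (lacoinFamily a b k).X :=
  inferInstanceAs (Finite (Fin (2 * triRow k + 1)))

namespace LacoinArrays

variable {a b p : ℕ → ℕ → ℝ} (h : LacoinArrays a b p)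
include h

lemma params {n i : ℕ} (hi : 1 ≤ i) (hin : i ≤ n) : LacoinParams (a n i) (b n i) :=
  ⟨h.a_pos n i hi hin, h.a_lt_b n i hi hin, h.a_add_b n i hi hin⟩

lemma isMarkov {n i : ℕ} (hi : 1 ≤ i) (hin : i ≤ n) : (lacoin n (a n i) (b n i)).IsMarkov :=
  (h.params hi hin).isMarkov (hi.trans hin)

lemma family_isIrreducibleMarkov (k : ℕ) : (lacoinFamily a b k).IsIrreducibleMarkov :=
  (h.params (triCol_mem k).1 (triCol_mem k).2).isIrreducibleMarkov (one_le_triRow k)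

lemma family_isMarkov (k : ℕ) : (lacoinFamily a b k).IsMarkov :=
  (h.family_isIrreducibleMarkov k).isMarkov

lemma rowMin_pos {n : ℕ} (hn : 1 ≤ n) : 0 < rowMin p n := by
  have hne : (p n '' Set.Icc 1 n).Nonempty := ⟨_, 1, ⟨le_rfl, hn⟩, rfl⟩
  obtain ⟨i, ⟨hi, hin⟩, hpi⟩ := hne.csInf_mem ((Set.finite_Icc 1 n).image _)
  rw [rowMin, ← hpi]
  exact h.p_pos n i hi hin

lemma rowSum_pos {n : ℕ} (hn : 1 ≤ n) : 0 < rowSum p n :=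
  Finset.sum_pos (fun i hi => h.p_pos n i (Finset.mem_Icc.1 hi).1 (Finset.mem_Icc.1 hi).2)
    ⟨1, Finset.mem_Icc.2 ⟨le_rfl, hn⟩⟩

lemma weights_triangle_add (α : ℝ) {m i : ℕ} (hi : i ≤ m) :
    lacoinWeights p α (m * (m + 1) / 2 + i)
      = p (m + 1) (i + 1) / rowMin p (m + 1)
        * (((m + 1 : ℕ) : ℝ) * Real.exp (-((m + 1 : ℕ) : ℝ) ^ α)) := by
  have hmin := h.rowMin_pos (n := m + 1) (by omega)
  have hsum := h.rowSum_pos (n := m + 1) (by omega)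
  rw [lacoinWeights, triRow_triangle_add hi, triCol_triangle_add hi, lacoinR]
  field_simp

lemma weights_pos (α : ℝ) (k : ℕ) : 0 < lacoinWeights p α k := by
  obtain ⟨m, i, hi, rfl⟩ := exists_eq_triangle_add k
  have hmin := h.rowMin_pos (n := m + 1) (by omega)
  have hp := h.p_pos (m + 1) (i + 1) (by omega) (by omega)
  rw [h.weights_triangle_add α hi]
  positivity

lemma exists_a_mul_le : ∃ D, 0 < D ∧ ∀ n i, 1 ≤ i → i ≤ n → a n i * n ≤ D / n := by
  obtain ⟨D, hD⟩ := h.a_bound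
  refine ⟨D, ?_, fun n i hi hin => ?_⟩
  · have h11 := (h.a_pos 1 1 le_rfl le_rfl).trans_le (hD 1 1 le_rfl le_rfl)
    rwa [Nat.cast_one, one_pow, div_one] at h11
  · have hn : (0 : ℝ) < n := Nat.cast_pos.2 (hi.trans hin)
    calc a n i * n ≤ D / (n : ℝ) ^ 2 * n := by gcongr; exact hD n i hi hin
      _ = D / n := by field_simp

lemma exists_a_le : ∃ D, 0 < D ∧ ∀ n i, 1 ≤ i → i ≤ n → a n i ≤ D / n := by
  obtain ⟨D, hD0, hD⟩ := h.exists_a_mul_le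
  refine ⟨D, hD0, fun n i hi hin => (le_mul_of_one_le_right (h.a_pos n i hi hin).le ?_).trans
    (hD n i hi hin)⟩
  exact_mod_cast hi.trans hin

lemma exists_one_sub_H_le {A : ℝ} (hA : 1 < A) :
    ∃ D, 0 < D ∧ ∀ n i, 1 ≤ i → i ≤ n → ∀ x,
      1 - (lacoin n (a n i) (b n i)).H (A * n) x (lacoinTop n (a n i) (b n i)) ≤ D / n := by
  obtain ⟨Ca, hCa0, hCa⟩ := h.exists_a_mul_le
  obtain ⟨Cb, hCb1, hCb⟩ := h.b_bound
  obtain ⟨l, hl0, hl⟩ := exists_lt_mul_one_sub_exp_neg hA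
  have hA0 : 0 < A := one_pos.trans hA
  set E := Real.exp (A * Ca * Real.exp l) * (A * (1 - Real.exp (-l)) - l)⁻¹
  have : 0 < E := mul_pos (Real.exp_pos _) (inv_pos.2 (sub_pos.2 hl))
  set B := E + A * Ca + 2 * Cb + 16 * Ca
  set N := 8 * Ca + 2
  refine ⟨B + N, by positivity, fun n i hi hin x => ?_⟩
  have hn : (1 : ℝ) ≤ n := by exact_mod_cast hi.trans hin
  have hn0 : (0 : ℝ) < n := by linarith
  rcases lt_or_ge (n : ℝ) N with hnN | hnN
  · calc 1 - (lacoin n (a n i) (b n i)).H (A * n) x (lacoinTop n (a n i) (b n i))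
        ≤ 1 := sub_le_self _ ((h.isMarkov hi hin).H_nonneg (by positivity) _ _)
      _ ≤ (B + N) / n := (one_le_div hn0).2 (by linarith [show 0 < B by positivity])
  · have hn2 : 2 ≤ n := by exact_mod_cast (show (2 : ℝ) ≤ n by linarith)
    have ha0 := h.a_pos n i hi hin
    have han := hCa n i hi hin
    have ha : a n i ≤ Ca / n := (le_mul_of_one_le_right ha0.le hn).trans han
    have ha8 : a n i ≤ 1 / 8 := ha.trans (by rw [div_le_iff₀ hn0]; linarith)
    have hexp := exp_stepMGF_le hA0.le ha0.le hn0 (han.trans (div_le_self hCa0.le hn)) hl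
    calc 1 - (lacoin n (a n i) (b n i)).H (A * n) x (lacoinTop n (a n i) (b n i))
        ≤ Real.exp (l * n - A * n * (1 - stepMGF (a n i) l)) + a n i * (A * n) + 2 * b n i
          + 16 * a n i :=
          (h.params hi hin).one_sub_H_lacoin_le hn2 ha8 hl0 (by positivity) x
      _ ≤ E / n + A * (Ca / n) + 2 * (Cb / n) + 16 * (Ca / n) := by
          have hAan : a n i * (A * n) ≤ A * (Ca / n) := by
            rw [mul_left_comm]
            gcongr
          linarith [(hCb n i hi hin).2]
      _ = B / n := by ring
      _ ≤ (B + N) / n := by gcongr; exact le_add_of_nonneg_right (by positivity)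

lemma exists_concentration {A : ℝ} (hA : 1 < A) :
    ∃ D, 0 < D ∧ ∀ n i, 1 ≤ i → i ≤ n → ∀ x,
      1 - (lacoin n (a n i) (b n i)).H (A * n) x (lacoinTop n (a n i) (b n i)) ≤ D / n ∧
      (lacoin n (a n i) (b n i)).tv (A * n) x ≤ D / n := by
  obtain ⟨D, hD0, hD⟩ := h.exists_one_sub_H_le hA
  obtain ⟨Ca, hCa0, hCa⟩ := h.exists_a_le
  refine ⟨D + 4 * Ca + 1, by positivity, fun n i hi hin x => ?_⟩
  have hn0 : (0 : ℝ) < n := Nat.cast_pos.2 (hi.trans hin)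
  have hAn : 0 ≤ A * n := by positivity
  have hH := hD n i hi hin x
  refine ⟨hH.trans (by gcongr; linarith), ?_⟩
  rcases lt_or_ge n 2 with hn2 | hn2
  · obtain rfl : n = 1 := by omega
    refine ((h.isMarkov hi hin).tv_le_one hAn x).trans ?_
    rw [Nat.cast_one, div_one]
    linarith
  · calc (lacoin n (a n i) (b n i)).tv (A * n) x
        ≤ D / n + 4 * a n i := (h.isMarkov hi hin).tv_le_of_concentrated hAn _ x
          (sub_le_comm.1 hH) ((h.params hi hin).one_sub_le_stat_lacoinTop hn2)
      _ ≤ D / n + 4 * (Ca / n) := by gcongr; exact hCa n i hi hin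
      _ = (D + 4 * Ca) / n := by ring
      _ ≤ (D + 4 * Ca + 1) / n := div_le_div_of_nonneg_right (by linarith) hn0.le

lemma exists_minAff_le {A : ℝ} (hA0 : 0 < A) (hA : A < 1) :
    ∃ D γ, 0 < γ ∧ ∀ n i, 1 ≤ i → i ≤ n → 2 ≤ n →
      (lacoin n (a n i) (b n i)).minAff (A * n) ≤ √(Real.exp (-(γ * n))) + √(D / n) := by
  obtain ⟨Ca, -, hCa⟩ := h.exists_a_le
  obtain ⟨l, hl0, hl⟩ := exists_mul_exp_sub_one_lt hA0 hA
  refine ⟨4 * Ca, l - A * (Real.exp l - 1), sub_pos.2 hl, fun n i hi hin hn2 => ?_⟩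
  have hP := h.params hi hin
  have hM := h.isMarkov hi hin
  have hAn : 0 ≤ A * n := by positivity
  set top := lacoinTop n (a n i) (b n i)
  set bot := lacoinBot n (a n i) (b n i)
  have hH : (lacoin n (a n i) (b n i)).H (A * n) bot top
      ≤ Real.exp (-((l - A * (Real.exp l - 1)) * n)) :=
    (hP.H_lacoin_bot_top_le (hi.trans hin) hl0 hAn).trans_eq (by ring_nf)
  have hstat : 1 - (lacoin n (a n i) (b n i)).stat top ≤ 4 * Ca / n := by
    rw [mul_div_assoc]
    linarith [hP.one_sub_le_stat_lacoinTop hn2, hCa n i hi hin]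
  calc (lacoin n (a n i) (b n i)).minAff (A * n)
      ≤ (lacoin n (a n i) (b n i)).aff (A * n) bot := Chain.minAff_le_aff _ _ _
    _ ≤ √((lacoin n (a n i) (b n i)).H (A * n) bot top)
        + √(1 - (lacoin n (a n i) (b n i)).stat top) :=
      affinity_le_sqrt_add_sqrt_one_sub (hM.H_mem_stdSimplex hAn bot) hM.stat_mem_stdSimplex top
    _ ≤ _ := by gcongr

lemma cutoffAff_family : CutoffAff (lacoinFamily a b) := by
  have hrow : Tendsto (fun k => (triRow k : ℝ)) atTop atTop :=
    tendsto_natCast_atTop_atTop.comp tendsto_triRow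
  refine ⟨fun k => triRow k, fun k => Nat.cast_pos.2 (one_le_triRow k), fun A hA => ?_,
    fun A hA0 hA => ?_⟩
  · obtain ⟨D, _, hD⟩ := h.exists_concentration hA
    have hlower := (hrow.const_div_atTop D).const_sub 1
    rw [sub_zero] at hlower
    refine tendsto_of_tendsto_of_tendsto_of_le_of_le hlower tendsto_const_nhds
      (fun k => ?_) fun k => (h.family_isMarkov k).minAff_le_one (by positivity)
    exact (h.family_isMarkov k).one_sub_le_minAff_of_tv_le (by positivity)
      fun x => (hD _ _ (triCol_mem k).1 (triCol_mem k).2 x).2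
  · obtain ⟨D, γ, hγ, hD⟩ := h.exists_minAff_le hA0 hA
    have hexp : Tendsto (fun k => Real.exp (-(γ * triRow k))) atTop (𝓝 0) :=
      Real.tendsto_exp_neg_atTop_nhds_zero.comp (hrow.const_mul_atTop hγ)
    have hupper := hexp.sqrt.add (hrow.const_div_atTop D).sqrt
    rw [Real.sqrt_zero, add_zero] at hupper
    refine tendsto_of_tendsto_of_tendsto_of_le_of_le' tendsto_const_nhds hupper
      (Eventually.of_forall fun k => Chain.minAff_nonneg _ _) ?_
    filter_upwards [tendsto_triRow.eventually_ge_atTop 2] with k hk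
    exact hD _ _ (triCol_mem k).1 (triCol_mem k).2 hk

end LacoinArrays

/-! ### No cutoff for the products of Lacoin chains -/

lemma exp_neg_two_mul_le {x : ℝ} (hx0 : 0 ≤ x) (hx : x ≤ 1 / 2) :
    Real.exp (-(2 * x)) ≤ 1 - x := by
  rw [Real.exp_neg, inv_le_iff_one_le_mul₀ (Real.exp_pos _)]
  nlinarith [Real.add_one_le_exp (2 * x)]

lemma exp_le_one_sub_div_pow_pow {D : ℝ} (hD : 0 ≤ D) {n : ℕ} (hn : 0 < n)
    (hDn : D / n ≤ 1 / 2) (d : ℕ) :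
    Real.exp (-(2 * D) * (1 / 2) ^ d) ≤ (1 - (D / n) ^ (d + 1)) ^ n := by
  have : (0 : ℝ) < n := Nat.cast_pos.2 hn
  have hDn0 : 0 ≤ D / n := by positivity
  set x := (D / n) ^ (d + 1) with hx
  have hx0 : 0 ≤ x := by positivity
  have hx_half : x ≤ 1 / 2 :=
    (pow_le_of_le_one hDn0 (hDn.trans (by norm_num)) (Nat.succ_ne_zero d)).trans hDn
  have hnx : n * x ≤ D * (1 / 2) ^ d := by
    calc n * x = D * (D / n) ^ d := by
          rw [hx, pow_succ]
          field_simp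
      _ ≤ D * (1 / 2) ^ d := by gcongr
  calc Real.exp (-(2 * D) * (1 / 2) ^ d) ≤ Real.exp (n * -(2 * x)) :=
        Real.exp_le_exp.2 (by linarith)
    _ = Real.exp (-(2 * x)) ^ n := Real.exp_nat_mul _ _
    _ ≤ (1 - x) ^ n := by
        gcongr
        exact exp_neg_two_mul_le hx0 hx_half

lemma sum_Ico_half_pow_le (N M : ℕ) : ∑ m ∈ Finset.Ico N M, (1 / 2 : ℝ) ^ (M - 1 - m) ≤ 2 :=
  calc ∑ m ∈ Finset.Ico N M, (1 / 2 : ℝ) ^ (M - 1 - m)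
      ≤ ∑ m ∈ Finset.range M, (1 / 2 : ℝ) ^ (M - 1 - m) :=
        Finset.sum_le_sum_of_subset_of_nonneg
          (fun m hm => Finset.mem_range.2 (Finset.mem_Ico.1 hm).2) fun _ _ _ => by positivity
    _ = ∑ m ∈ Finset.range M, (1 / 2 : ℝ) ^ m :=
        Finset.sum_range_reflect (fun m => (1 / 2 : ℝ) ^ m) M
    _ ≤ 2 := sum_geometric_two_le M

lemma sub_le_rpow_sub_rpow {α x y : ℝ} (hα : 1 ≤ α) (hx : 1 ≤ x) (hxy : x ≤ y) :
    y - x ≤ y ^ α - x ^ α := by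
  have hx0 : 0 < x := by linarith
  have hsplit : ∀ z : ℝ, 0 < z → z ^ α = z * z ^ (α - 1) := fun z hz => by
    rw [← Real.rpow_one_add' hz.le (by linarith), add_sub_cancel]
  have hone : 1 ≤ x ^ (α - 1) := Real.one_le_rpow hx (by linarith)
  have hmono : x ^ (α - 1) ≤ y ^ (α - 1) := Real.rpow_le_rpow hx0.le hxy (by linarith)
  rw [hsplit x hx0, hsplit y (hx0.trans_le hxy)]
  nlinarith

lemma tendsto_nat_mul_exp_neg_div {c : ℝ} (hc : 0 < c) :
    Tendsto (fun n : ℕ => (n : ℝ) * Real.exp (-(n / c))) atTop (𝓝 0) := by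
  have hlim := ((Real.tendsto_pow_mul_exp_neg_atTop_nhds_zero 1).comp
    ((tendsto_natCast_atTop_atTop (R := ℝ)).atTop_div_const hc)).const_mul c
  rw [mul_zero] at hlim
  refine hlim.congr fun n => ?_
  simp only [Function.comp_apply, pow_one]
  field_simp

namespace LacoinArrays

variable {a b p : ℕ → ℕ → ℝ} (h : LacoinArrays a b p)
include h

/- If the product up to row `M` is run up to a time `c * q * exp (M ^ α)`, where `q` is the sum of
its weights, then chain `k` runs for time `c * n * exp (M ^ α - n ^ α)` with `n = triRow k`, up to
the ratio of the weights in its row. -/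
lemma le_weights_mul {α : ℝ} (hα : 1 ≤ α) {k M : ℕ} (hM : triRow k ≤ M) {s : ℝ}
    (hs : 6 / 5 * Real.exp ((M : ℝ) ^ α) ≤ s) :
    6 / 5 * (triRow k : ℝ) * ((M - triRow k : ℕ) + 1) ≤ lacoinWeights p α k * s := by
  obtain ⟨m, i, hi, rfl⟩ := exists_eq_triangle_add k
  rw [h.weights_triangle_add α hi]
  rw [triRow_triangle_add hi] at hM ⊢
  have hp : 1 ≤ p (m + 1) (i + 1) / rowMin p (m + 1) :=
    (one_le_div (h.rowMin_pos (by omega))).2 (rowMin_le p (by omega) (by omega))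
  have hn1 : (1 : ℝ) ≤ (m + 1 : ℕ) := by exact_mod_cast Nat.succ_pos m
  have hnM : ((m + 1 : ℕ) : ℝ) ≤ M := by exact_mod_cast hM
  have hpow := sub_le_rpow_sub_rpow hα hn1 hnM
  rw [Nat.cast_sub hM]
  generalize ((m + 1 : ℕ) : ℝ) = n at *
  calc 6 / 5 * n * ((M : ℝ) - n + 1)
      ≤ 6 / 5 * n * Real.exp ((M : ℝ) ^ α - n ^ α) := by
        gcongr
        linarith [Real.add_one_le_exp ((M : ℝ) ^ α - n ^ α)]
    _ = 1 * (n * Real.exp (-n ^ α)) * (6 / 5 * Real.exp ((M : ℝ) ^ α)) := by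
        rw [sub_eq_add_neg, Real.exp_add]
        ring
    _ ≤ _ := by gcongr

lemma exists_one_sub_pow_le_minAff :
    ∃ D, 0 < D ∧ ∀ k (d : ℕ) t, 6 / 5 * (triRow k : ℝ) * (d + 1) ≤ t →
      1 - (D / triRow k) ^ (d + 1) ≤ (lacoinFamily a b k).minAff t := by
  obtain ⟨D, hD0, hD⟩ := h.exists_concentration (A := 6 / 5) (by norm_num)
  refine ⟨D, hD0, fun k d t ht => ?_⟩
  have hM := h.family_isMarkov k
  have hDk := hD _ _ (triCol_mem k).1 (triCol_mem k).2
  have hs : 0 ≤ 6 / 5 * (triRow k : ℝ) := by positivity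
  refine hM.one_sub_le_minAff_of_tv_le ((by positivity : (0 : ℝ) ≤ _).trans ht) fun x => ?_
  calc (lacoinFamily a b k).tv t x
      ≤ (lacoinFamily a b k).tv (6 / 5 * triRow k + d * (6 / 5 * triRow k)) x :=
        hM.tv_antitone (by positivity) (le_of_eq_of_le (by ring) ht) x
    _ ≤ (D / triRow k) ^ d * (lacoinFamily a b k).tv (6 / 5 * triRow k) x :=
        hM.tv_add_mul_le (lacoinTop _ _ _) x hs hs (by positivity)
          (fun w => sub_le_comm.1 (hDk w).1) d
    _ ≤ (D / triRow k) ^ (d + 1) := by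
        rw [pow_succ]
        exact mul_le_mul_of_nonneg_left (hDk x).2 (by positivity)

lemma eventually_half_pow_le_prod_minAff {α : ℝ} (hα : 1 ≤ α) (N : ℕ) :
    ∀ᶠ M : ℕ in atTop, ∀ s, 6 / 5 * Real.exp ((M : ℝ) ^ α) ≤ s →
      (1 / 2) ^ N
        ≤ ∏ k ∈ Finset.range N, (lacoinFamily a b k).minAff (lacoinWeights p α k * s) := by
  have hT : ∀ k, ∃ T, ∀ t, T ≤ t → 1 / 2 ≤ (lacoinFamily a b k).minAff t := fun k => by
    obtain ⟨T, hT0, hT⟩ :=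
      (h.family_isIrreducibleMarkov k).exists_tv_le (ε := 1 / 2) (by norm_num)
    refine ⟨T, fun t ht => ?_⟩
    linarith [(h.family_isMarkov k).one_sub_le_minAff_of_tv_le (hT0.trans ht) (hT t ht)]
  choose T hT using hT
  have hlarge : ∀ᶠ M : ℕ in atTop, ∀ k ∈ Finset.range N, triRow k ≤ M ∧ T k + triRow k ≤ M := by
    rw [Finset.eventually_all]
    exact fun k _ => (eventually_ge_atTop _).and
      (tendsto_natCast_atTop_atTop.eventually_ge_atTop _)
  filter_upwards [hlarge] with M hM s hs
  have hfactor : ∀ k ∈ Finset.range N,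
      1 / 2 ≤ (lacoinFamily a b k).minAff (lacoinWeights p α k * s) := fun k hk => by
    obtain ⟨hkM, hTM⟩ := hM k hk
    have htime := h.le_weights_mul hα hkM hs
    have hk1 : (1 : ℝ) ≤ triRow k := by exact_mod_cast one_le_triRow k
    have hkM' : (triRow k : ℝ) ≤ M := by exact_mod_cast hkM
    rw [Nat.cast_sub hkM] at htime
    exact hT k _ (by nlinarith)
  calc (1 / 2 : ℝ) ^ N = ∏ _k ∈ Finset.range N, (1 / 2 : ℝ) := by
        rw [Finset.prod_const, Finset.card_range]
    _ ≤ _ := Finset.prod_le_prod (fun _ _ => by norm_num) hfactor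

lemma exists_exp_le_prod_row_minAff {α : ℝ} (hα : 1 ≤ α) :
    ∃ (D : ℝ) (N : ℕ), 0 ≤ D ∧ ∀ m M : ℕ, N ≤ m → m < M →
      ∀ s, 6 / 5 * Real.exp ((M : ℝ) ^ α) ≤ s →
      Real.exp (-(2 * D) * (1 / 2) ^ (M - 1 - m))
        ≤ ∏ i ∈ Finset.range (m + 1), (lacoinFamily a b (m * (m + 1) / 2 + i)).minAff
          (lacoinWeights p α (m * (m + 1) / 2 + i) * s) := by
  obtain ⟨D, hD0, hD⟩ := h.exists_one_sub_pow_le_minAff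
  obtain ⟨N, hN⟩ := exists_nat_ge (2 * D)
  refine ⟨D, N, hD0.le, fun m M hNm hmM s hs => ?_⟩
  have hDm : D / (m + 1 : ℕ) ≤ 1 / 2 := by
    rw [div_le_iff₀ (by positivity)]
    have : (N : ℝ) ≤ (m + 1 : ℕ) := by exact_mod_cast hNm.trans (Nat.le_succ m)
    linarith
  set d := M - 1 - m
  have hfactor : ∀ i ∈ Finset.range (m + 1), 1 - (D / (m + 1 : ℕ)) ^ (d + 1)
      ≤ (lacoinFamily a b (m * (m + 1) / 2 + i)).minAff
        (lacoinWeights p α (m * (m + 1) / 2 + i) * s) := fun i hi => by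
    have hrow := triRow_triangle_add (Nat.lt_succ_iff.1 (Finset.mem_range.1 hi))
    have htime := h.le_weights_mul hα (hrow.trans_le hmM) hs
    rw [hrow, show M - (m + 1) = d by omega, ← hrow] at htime
    have hbound := hD _ d _ htime
    rwa [hrow] at hbound
  have hnonneg : 0 ≤ 1 - (D / (m + 1 : ℕ)) ^ (d + 1) :=
    sub_nonneg.2 (pow_le_one₀ (by positivity) (hDm.trans (by norm_num)))
  calc Real.exp (-(2 * D) * (1 / 2) ^ d)
      ≤ (1 - (D / (m + 1 : ℕ)) ^ (d + 1)) ^ (m + 1) :=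
        exp_le_one_sub_div_pow_pow hD0.le m.succ_pos hDm d
    _ = ∏ _i ∈ Finset.range (m + 1), (1 - (D / (m + 1 : ℕ)) ^ (d + 1)) := by
        rw [Finset.prod_const, Finset.card_range]
    _ ≤ _ := Finset.prod_le_prod (fun _ _ => hnonneg) hfactor

lemma exists_le_prod_minAff {α : ℝ} (hα : 1 ≤ α) :
    ∃ δ, 0 < δ ∧ ∀ᶠ M : ℕ in atTop, ∀ s, 6 / 5 * Real.exp ((M : ℝ) ^ α) ≤ s →
      δ ≤ ∏ k ∈ Finset.range (M * (M + 1) / 2),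
        (lacoinFamily a b k).minAff (lacoinWeights p α k * s) := by
  obtain ⟨D, N, hD, hrow⟩ := h.exists_exp_le_prod_row_minAff hα
  refine ⟨(1 / 2) ^ (N * (N + 1) / 2) * Real.exp (-(2 * D) * 2), by positivity, ?_⟩
  filter_upwards [h.eventually_half_pow_le_prod_minAff hα (N * (N + 1) / 2),
    eventually_ge_atTop N] with M hhead hNM s hs
  rw [prod_range_triangle, ← Finset.prod_range_mul_prod_Ico _ hNM, ← prod_range_triangle
    fun k => (lacoinFamily a b k).minAff (lacoinWeights p α k * s)]
  refine mul_le_mul (hhead s hs) ?_ (by positivity)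
    (Finset.prod_nonneg fun k _ => Chain.minAff_nonneg _ _)
  calc Real.exp (-(2 * D) * 2)
      ≤ Real.exp (∑ m ∈ Finset.Ico N M, -(2 * D) * (1 / 2) ^ (M - 1 - m)) := by
        rw [← Finset.mul_sum]
        exact Real.exp_le_exp.2
          (mul_le_mul_of_nonpos_left (sum_Ico_half_pow_le N M) (by linarith))
    _ = ∏ m ∈ Finset.Ico N M, Real.exp (-(2 * D) * (1 / 2) ^ (M - 1 - m)) := Real.exp_sum _ _
    _ ≤ _ := Finset.prod_le_prod (fun _ _ => (Real.exp_pos _).le) fun m hm =>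
        hrow m M (Finset.mem_Ico.1 hm).1 (Finset.mem_Ico.1 hm).2 s hs

lemma minAff_le_exp {n i : ℕ} (hi : 1 ≤ i) (hin : i ≤ n) (hn : 2 ≤ n) {t : ℝ} (ht0 : 0 ≤ t)
    (ht : t ≤ 19 / 10 * n) :
    (lacoin n (a n i) (b n i)).minAff t
      ≤ Real.exp (-(b n i / 4) + Real.exp (-(n / 4000)) + 5 * (n * a n i)) := by
  have hP := h.params hi hin
  have hM := h.isMarkov hi hin
  have hn' : (2 : ℝ) ≤ n := by exact_mod_cast hn
  have ha := hP.a_pos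
  have hexp_le : Real.exp (1 / 20) - 1 ≤ 21 / 400 := by
    have := (abs_le.1 (Real.abs_exp_sub_one_sub_id_le (x := 1 / 20)
      (by rw [abs_of_pos] <;> norm_num))).2
    linarith
  have hdrift : t * (Real.exp (1 / 20) - 1) ≤ 19 / 10 * n * (21 / 400) := by
    gcongr
    linarith [Real.add_one_le_exp (1 / 20)]
  have hexp : Real.exp (t * (Real.exp (1 / 20) - 1) - 1 / 20 * (2 * n)) ≤ Real.exp (-(n / 4000)) :=
    Real.exp_le_exp.2 (by linarith)
  have hat : a n i * t ≤ a n i * (19 / 10 * n) := by gcongr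
  have hH := hP.H_lacoin_bot_top_le_one_sub_add (hi.trans hin) (l := 1 / 20) (by norm_num) ht0
  have hstat := hP.one_sub_le_stat_lacoinTop hn
  set top := lacoinTop n (a n i) (b n i)
  set bot := lacoinBot n (a n i) (b n i)
  calc (lacoin n (a n i) (b n i)).minAff t
      ≤ (lacoin n (a n i) (b n i)).aff t bot := Chain.minAff_le_aff _ _ _
    _ ≤ 1 - (1 - (lacoin n (a n i) (b n i)).H t bot top) / 4
        + (1 - (lacoin n (a n i) (b n i)).stat top) :=
      affinity_le_one_sub_quarter_add (hM.H_mem_stdSimplex ht0 bot) hM.stat_mem_stdSimplex top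
    _ ≤ -(b n i / 4) + Real.exp (-(n / 4000)) + 5 * (n * a n i) + 1 := by
      nlinarith [Real.exp_pos (-(n / 4000 : ℝ))]
    _ ≤ _ := Real.add_one_le_exp _

lemma weights_mul_le {α s : ℝ} {m i : ℕ} (hi : i ≤ m)
    (hratio : rowMax p (m + 1) / rowMin p (m + 1) ≤ 19 / 18) (hs0 : 0 ≤ s)
    (hs : s ≤ 9 / 5 * Real.exp (((m + 1 : ℕ) : ℝ) ^ α)) :
    lacoinWeights p α (m * (m + 1) / 2 + i) * s ≤ 19 / 10 * (m + 1 : ℕ) := by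
  have hp : p (m + 1) (i + 1) / rowMin p (m + 1) ≤ 19 / 18 :=
    (div_le_div_of_nonneg_right (le_rowMax p (by omega) (by omega))
      (h.rowMin_pos (by omega)).le).trans hratio
  have hn0 : (0 : ℝ) ≤ (m + 1 : ℕ) := Nat.cast_nonneg _
  rw [h.weights_triangle_add α hi]
  generalize ((m + 1 : ℕ) : ℝ) = n at *
  calc p (m + 1) (i + 1) / rowMin p (m + 1) * (n * Real.exp (-n ^ α)) * s
      ≤ 19 / 18 * (n * Real.exp (-n ^ α)) * (9 / 5 * Real.exp (n ^ α)) := by gcongr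
    _ = 19 / 10 * n * (Real.exp (-n ^ α) * Real.exp (n ^ α)) := by ring
    _ = 19 / 10 * n := by rw [← Real.exp_add, neg_add_cancel, Real.exp_zero, mul_one]

lemma prod_row_minAff_le {α s : ℝ} {m : ℕ} (hm : 1 ≤ m) {β : ℝ}
    (hβ : ∀ i, 1 ≤ i → i ≤ m + 1 → β / (m + 1 : ℕ) ≤ b (m + 1) i)
    (hratio : rowMax p (m + 1) / rowMin p (m + 1) ≤ 19 / 18) (hs0 : 0 ≤ s)
    (hs : s ≤ 9 / 5 * Real.exp (((m + 1 : ℕ) : ℝ) ^ α)) :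
    ∏ i ∈ Finset.range (m + 1), (lacoinFamily a b (m * (m + 1) / 2 + i)).minAff
        (lacoinWeights p α (m * (m + 1) / 2 + i) * s)
      ≤ Real.exp (-(β / 4) + ((m + 1 : ℕ) : ℝ) * Real.exp (-((m + 1 : ℕ) / 4000))
        + 5 * (((m + 1 : ℕ) : ℝ) * rowSum a (m + 1))) := by
  set E := Real.exp (-((m + 1 : ℕ) / 4000 : ℝ))
  have hfactor : ∀ i ∈ Finset.range (m + 1),
      (lacoinFamily a b (m * (m + 1) / 2 + i)).minAff
          (lacoinWeights p α (m * (m + 1) / 2 + i) * s)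
        ≤ Real.exp (-(β / (m + 1 : ℕ) / 4) + E + 5 * ((m + 1 : ℕ) * a (m + 1) (i + 1))) := by
    intro i hi
    have him : i ≤ m := Nat.lt_succ_iff.1 (Finset.mem_range.1 hi)
    rw [lacoinFamily, triRow_triangle_add him, triCol_triangle_add him]
    refine (h.minAff_le_exp (by omega) (by omega) (by omega)
      (mul_nonneg (h.weights_pos α _).le hs0) (h.weights_mul_le him hratio hs0 hs)).trans
      (Real.exp_le_exp.2 ?_)
    linarith [hβ (i + 1) (by omega) (by omega)]
  refine (Finset.prod_le_prod (fun i _ => Chain.minAff_nonneg _ _) hfactor).trans_eq ?_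
  rw [← Real.exp_sum, Finset.sum_add_distrib, ← Finset.mul_sum, ← Finset.mul_sum,
    ← rowSum_eq_sum_range, Finset.sum_const, Finset.card_range, nsmul_eq_mul]
  field_simp

lemma exists_prod_minAff_le {α : ℝ} :
    ∃ δ, 0 < δ ∧ ∀ᶠ M : ℕ in atTop, ∀ s, 0 ≤ s → s ≤ 9 / 5 * Real.exp ((M : ℝ) ^ α) →
      ∏ k ∈ Finset.range (M * (M + 1) / 2),
        (lacoinFamily a b k).minAff (lacoinWeights p α k * s) ≤ 1 - δ := by
  obtain ⟨C, hC1, hC⟩ := h.b_bound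
  have : 0 < C := one_pos.trans hC1
  have hβ : 0 < 1 / C / 8 := by positivity
  have herr := (tendsto_nat_mul_exp_neg_div (c := 4000) (by norm_num)).add (h.a_sum.const_mul 5)
  rw [mul_zero, add_zero] at herr
  refine ⟨1 - Real.exp (-(1 / C / 8)),
    sub_pos.2 (Real.exp_lt_one_iff.2 (neg_lt_zero.2 hβ)), ?_⟩
  filter_upwards [herr.eventually_le_const hβ,
    h.p_ratio.eventually_le_const (show (1 : ℝ) < 19 / 18 by norm_num),
    eventually_ge_atTop 2] with M hM hratio hM2 s hs0 hs
  obtain ⟨m, rfl⟩ : ∃ m, M = m + 1 := ⟨M - 1, by omega⟩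
  set f := fun k => (lacoinFamily a b k).minAff (lacoinWeights p α k * s)
  have hf0 : ∀ k, 0 ≤ f k := fun k => Chain.minAff_nonneg _ _
  have hf1 : ∀ k, f k ≤ 1 := fun k =>
    (h.family_isMarkov k).minAff_le_one (mul_nonneg (h.weights_pos α k).le hs0)
  rw [triangle_succ, Finset.prod_range_add, sub_sub_cancel]
  calc (∏ k ∈ Finset.range (m * (m + 1) / 2), f k)
        * ∏ i ∈ Finset.range (m + 1), f (m * (m + 1) / 2 + i)
      ≤ ∏ i ∈ Finset.range (m + 1), f (m * (m + 1) / 2 + i) :=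
        mul_le_of_le_one_left (Finset.prod_nonneg fun i _ => hf0 _)
          (Finset.prod_le_one (fun k _ => hf0 k) fun k _ => hf1 k)
    _ ≤ _ := h.prod_row_minAff_le (by omega) (β := 1 / C)
        (fun i hi him => by rw [div_div]; exact (hC (m + 1) i hi him).1) hratio hs0 hs
    _ ≤ Real.exp (-(1 / C / 8)) := Real.exp_le_exp.2 (by linarith)

lemma minAff_prodFamily_triangle (α : ℝ) (n : ℕ) {t : ℝ} (ht : 0 ≤ t) :
    (prodFamily (lacoinFamily a b) (lacoinWeights p α) (n * (n + 1) / 2 + n)).minAff t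
      = ∏ k ∈ Finset.range ((n + 1) * (n + 1 + 1) / 2), (lacoinFamily a b k).minAff
        (lacoinWeights p α k
          * (t / ∑ j ∈ Finset.range (n * (n + 1) / 2 + n + 1), lacoinWeights p α j)) := by
  rw [minAff_prodFamily h.family_isMarkov (h.weights_pos α) _ ht, triangle_succ, add_assoc]

/- With `q` the sum of the weights of the first `n + 1` rows, a cutoff time of their product would
be at least `3 / 2 * q * exp ((n + 1) ^ α)` or at most that. In the first case the product has mixed
too much already at `4 / 5` of it, in the second case too little still at `6 / 5` of it. -/
lemma not_cutoffAff_prodFamily {α : ℝ} (hα : 1 ≤ α) :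
    ¬ CutoffAff (prodFamily (lacoinFamily a b) (lacoinWeights p α)) := by
  rintro ⟨t, ht0, hafter, hbefore⟩
  obtain ⟨δ, hδ, hlow⟩ := h.exists_le_prod_minAff hα
  obtain ⟨ε, hε, hup⟩ := h.exists_prod_minAff_le (α := α)
  set N : ℕ → ℕ := fun n => n * (n + 1) / 2 + n
  have hN : Tendsto N atTop atTop := tendsto_atTop_mono (fun n => Nat.le_add_left _ _) tendsto_id
  have hafter' := ((hafter (6 / 5) (by norm_num)).comp hN).eventually_const_lt (sub_lt_self 1 hε)
  have hbefore' :=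
    ((hbefore (4 / 5) (by norm_num) (by norm_num)).comp hN).eventually_lt_const hδ
  obtain ⟨n, ⟨hn_after, hn_before⟩, hn_low, hn_up⟩ := ((hafter'.and hbefore').and
    (((tendsto_add_atTop_nat 1).eventually hlow).and
      ((tendsto_add_atTop_nat 1).eventually hup))).exists
  set q := ∑ j ∈ Finset.range (N n + 1), lacoinWeights p α j with hq
  have hq0 : 0 ≤ q := Finset.sum_nonneg fun j _ => (h.weights_pos α j).le
  have ht := ht0 (N n)
  have hσ : 0 ≤ t (N n) / q := by positivity
  rw [Function.comp_apply, h.minAff_prodFamily_triangle α n (by positivity), ← hq, mul_div_assoc]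
    at hn_after hn_before
  rcases le_total (3 / 2 * Real.exp (((n + 1 : ℕ) : ℝ) ^ α)) (t (N n) / q) with hσ_ge | hσ_le
  · exact absurd (hn_low (4 / 5 * (t (N n) / q)) (by linarith)) (not_le.2 hn_before)
  · exact absurd (hn_up (6 / 5 * (t (N n) / q)) (by positivity) (by linarith))
      (not_le.2 hn_after)

end LacoinArrays

/-! ### The two counterexamples -/

lemma rowMax_one {n : ℕ} (hn : 1 ≤ n) : rowMax (fun _ _ => 1) n = 1 := by
  rw [rowMax, Set.Nonempty.image_const ⟨1, Set.mem_Icc.2 ⟨le_rfl, hn⟩⟩, csSup_singleton]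

lemma rowMin_one {n : ℕ} (hn : 1 ≤ n) : rowMin (fun _ _ => 1) n = 1 := by
  rw [rowMin, Set.Nonempty.image_const ⟨1, Set.mem_Icc.2 ⟨le_rfl, hn⟩⟩, csInf_singleton]

lemma lacoinArrays_inv_cube_inv_one :
    LacoinArrays (fun n _ => 1 / (8 * (n : ℝ) ^ 3)) (fun n _ => 1 / (4 * (n : ℝ)))
      (fun _ _ => 1) where
  p_pos _ _ _ _ := one_pos
  a_pos n i hi hin := by
    have : (0 : ℝ) < n := by exact_mod_cast hi.trans hin
    positivity
  a_lt_b n i hi hin := by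
    have hn : (1 : ℝ) ≤ n := by exact_mod_cast hi.trans hin
    have : (n : ℝ) ≤ n ^ 3 := le_self_pow₀ hn (by norm_num)
    exact one_div_lt_one_div_of_lt (by linarith) (by linarith)
  a_add_b n i hi hin := by
    have hn : (1 : ℝ) ≤ n := by exact_mod_cast hi.trans hin
    have hn3 : (1 : ℝ) ≤ n ^ 3 := one_le_pow₀ hn
    have ha : 1 / (8 * (n : ℝ) ^ 3) ≤ 1 / 8 := one_div_le_one_div_of_le (by norm_num) (by linarith)
    have hb : 1 / (4 * (n : ℝ)) ≤ 1 / 4 := one_div_le_one_div_of_le (by norm_num) (by linarith)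
    linarith
  a_bound := by
    refine ⟨1, fun n i hi hin => ?_⟩
    have hn : (1 : ℝ) ≤ n := by exact_mod_cast hi.trans hin
    have : (n : ℝ) ^ 2 ≤ n ^ 3 := pow_le_pow_right₀ hn (by norm_num)
    exact one_div_le_one_div_of_le (by positivity) (by nlinarith [sq_nonneg (n : ℝ)])
  a_sum := by
    refine (tendsto_const_div_atTop_nhds_zero_nat (1 / 8)).congr' ?_
    filter_upwards [eventually_ge_atTop 1] with n hn
    have : (n : ℝ) ≠ 0 := by exact_mod_cast (by omega : n ≠ 0)
    rw [rowSum, Finset.sum_const, Nat.card_Icc, nsmul_eq_mul, Nat.add_sub_cancel]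
    field_simp
  b_bound := by
    refine ⟨4, by norm_num, fun n i hi hin => ⟨le_rfl, ?_⟩⟩
    have hn : (1 : ℝ) ≤ n := by exact_mod_cast hi.trans hin
    exact div_le_div₀ (by norm_num) (by norm_num) (by linarith) (by linarith)
  p_ratio := by
    refine tendsto_const_nhds.congr' ?_
    filter_upwards [eventually_ge_atTop 1] with n hn
    rw [rowMax_one hn, rowMin_one hn, div_one]

lemma mixedFamily_cutoffs {r : ℝ} (hr : 0 < r) (hr1 : r < 1) :
    ¬ CutoffTV mixedFamily ∧ CutoffTV (prodFamily mixedFamily (mixedWeights r)) ∧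
      ¬ CutoffH mixedFamily ∧ CutoffH (prodFamily mixedFamily (mixedWeights r)) := by
  have hprod := isMarkov_prodFamily mixedFamily_isMarkov (mixedWeights_pos hr)
  have hcutoff := cutoffAff_prodFamily_mixedFamily hr hr1
  exact ⟨(cutoffTV_iff mixedFamily_isMarkov).not.2 not_cutoffAff_mixedFamily,
    (cutoffTV_iff hprod).2 hcutoff,
    (cutoffH_iff mixedFamily_isMarkov).not.2 not_cutoffAff_mixedFamily,
    (cutoffH_iff hprod).2 hcutoff⟩

lemma LacoinArrays.cutoffs {a b p : ℕ → ℕ → ℝ} (h : LacoinArrays a b p) {α : ℝ} (hα : 1 ≤ α) :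
    CutoffTV (lacoinFamily a b) ∧
      ¬ CutoffTV (prodFamily (lacoinFamily a b) (lacoinWeights p α)) ∧
      CutoffH (lacoinFamily a b) ∧
      ¬ CutoffH (prodFamily (lacoinFamily a b) (lacoinWeights p α)) := by
  have hprod := isMarkov_prodFamily h.family_isMarkov (h.weights_pos α)
  have hno_cutoff := h.not_cutoffAff_prodFamily hα
  exact ⟨(cutoffTV_iff h.family_isMarkov).2 h.cutoffAff_family,
    (cutoffTV_iff hprod).not.2 hno_cutoff,
    (cutoffH_iff h.family_isMarkov).2 h.cutoffAff_family,
    (cutoffH_iff hprod).not.2 hno_cutoff⟩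

end

end ProductCutoff

open ProductCutoff in
theorem theorem1p4 :
    -- in total variation, neither cutoff implies the other
    (¬ ∀ (F : ℕ → Chain) (P : ℕ → ℝ), (∀ n, (F n).IsIrreducibleMarkov) → (∀ n, 0 < P n) →
        CutoffTV F → CutoffTV (prodFamily F P)) ∧
    (¬ ∀ (F : ℕ → Chain) (P : ℕ → ℝ), (∀ n, (F n).IsIrreducibleMarkov) → (∀ n, 0 < P n) →
        CutoffTV (prodFamily F P) → CutoffTV F) ∧
    -- in the Hellinger distance, neither cutoff implies the other
    (¬ ∀ (F : ℕ → Chain) (P : ℕ → ℝ), (∀ n, (F n).IsIrreducibleMarkov) → (∀ n, 0 < P n) →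
        CutoffH F → CutoffH (prodFamily F P)) ∧
    (¬ ∀ (F : ℕ → Chain) (P : ℕ → ℝ), (∀ n, (F n).IsIrreducibleMarkov) → (∀ n, 0 < P n) →
        CutoffH (prodFamily F P) → CutoffH F) ∧
    -- first counterexample: Ehrenfest chains mixed with paths
    (∀ r : ℝ, 0 < r → r < 1 →
      (∀ n, (mixedFamily n).IsIrreducibleMarkov) ∧ (∀ n, 0 < mixedWeights r n) ∧
      ¬ CutoffTV mixedFamily ∧ CutoffTV (prodFamily mixedFamily (mixedWeights r)) ∧
      ¬ CutoffH mixedFamily ∧ CutoffH (prodFamily mixedFamily (mixedWeights r))) ∧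
    -- second counterexample: Lacoin chains listed row by row
    (∃ a b p : ℕ → ℕ → ℝ, LacoinArrays a b p) ∧
    (∀ (a b p : ℕ → ℕ → ℝ) (α : ℝ), LacoinArrays a b p → 1 ≤ α →
      (∀ n, (lacoinFamily a b n).IsIrreducibleMarkov) ∧ (∀ n, 0 < lacoinWeights p α n) ∧
      CutoffTV (lacoinFamily a b) ∧
      ¬ CutoffTV (prodFamily (lacoinFamily a b) (lacoinWeights p α)) ∧
      CutoffH (lacoinFamily a b) ∧
      ¬ CutoffH (prodFamily (lacoinFamily a b) (lacoinWeights p α))) := by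
  obtain ⟨hmixTV, hmixTV_prod, hmixH, hmixH_prod⟩ :=
    mixedFamily_cutoffs (r := 1 / 2) (by norm_num) (by norm_num)
  have hmix_weights := mixedWeights_pos (r := 1 / 2) (by norm_num)
  have hL := lacoinArrays_inv_cube_inv_one
  obtain ⟨hlacTV, hlacTV_prod, hlacH, hlacH_prod⟩ := hL.cutoffs le_rfl
  have hlac_weights := hL.weights_pos 1
  exact ⟨fun himp => hlacTV_prod (himp _ _ hL.family_isIrreducibleMarkov hlac_weights hlacTV),
    fun himp => hmixTV (himp _ _ mixedFamily_isIrreducibleMarkov hmix_weights hmixTV_prod),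
    fun himp => hlacH_prod (himp _ _ hL.family_isIrreducibleMarkov hlac_weights hlacH),
    fun himp => hmixH (himp _ _ mixedFamily_isIrreducibleMarkov hmix_weights hmixH_prod),
    fun r hr hr1 =>
      ⟨mixedFamily_isIrreducibleMarkov, mixedWeights_pos hr, mixedFamily_cutoffs hr hr1⟩,
    ⟨_, _, _, hL⟩,
    fun a b p α h hα => ⟨h.family_isIrreducibleMarkov, h.weights_pos α, h.cutoffs hα⟩⟩
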